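/- Let $\mu\in(0,1)$, $\rho,K>0$, $\gamma\ge 0$, $\omega\in\mathbb R$. Write $$E^{\gamma}_{\rho,\beta}(z)=\sum_{k\ge0}\frac{(\gamma)_k}{\Gamma(\rho k+\beta)}\frac{z^k}{k!},\qquad (\gamma)_k=\gamma(\gamma+1)\cdots(\gamma+k-1),$$ and, for $f$ absolutely continuous on every $[0,b]$, $${}^C\mathbf D^{\gamma,\mu}_{\rho,\omega,0^+}f(t)=\int_0^t (t-y)^{-\mu}E^{-\gamma}_{\rho,1-\mu}\big(\omega(t-y)^\rho\big)f'(y)\,dy .$$ Let $g:\mathbb R\to\mathbb C$ be integrable and $\hat g(p)=\int_{\mathbb R} e^{-ipx}g(x)\,dx$. Consider the Cauchy problem $${}^C\mathbf D^{\gamma,\mu}_{\rho,\omega,0^+}u(x,t)=K\,u_{xx}(x,t)\quad(x\in\mathbb R,\ t>0),\qquad u(x,0^+)=g(x),\qquad \lim_{x\to\pm\infty}u(x,t)=0\quad(t>0),$$ where the operator on the left acts in $t$. A solution is a function $u(x,t)$ that satisfies these relations, is absolutely continuous in $t$ on every $[0,b]$ for each $x$, is twice differentiable in $x$ for each $t>0$,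 and for which the integral defining ${}^C\mathbf D^{\gamma,\mu}_{\rho,\omega,0^+}u(x,t)$ converges absolutely for all $x$ and all $t>0$. Call $u$ dominated if for every $b>0$ there is $m\in L^1(0,b)$ such that, for every $x$, $|\partial_t u(x,t)|\le m(t)$ for almost every $t\in(0,b)$. Let $$U(x,t)=\frac1{2\pi}\int_{-\infty}^{\infty}e^{ipx}\,\hat g(p)\sum_{n=0}^{\infty}(-K)^n p^{2n}t^{n\mu}E^{n\gamma}_{\rho,n\mu+1}(\omega t^\rho)\,dp .$$ Then: 1. the series converges absolutely for all $p\in\mathbb R$, $t\ge0$, and the integral converges absolutely for all $t>0$; 2. if $g$ is continuous and $\hat g$ is integrable, then $U$ is a dominated solution of the Cauchy problem; 3. every dominated solution $u$ of the Cauchy problem satisfies $u(x,t)=U(x,t)$ for all $x\in\mathbb R$, $t>0$. -/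

import Mathlib

open MeasureTheory Filter Topology Set

noncomputable section

/-- The three-parameter (Prabhakar) Mittag-Leffler function
`E_{ρ,β}^γ(z) = ∑_k (γ)_k z^k / (k! Γ(ρ k + β))`, where `(γ)_k = γ (γ + 1) ⋯ (γ + k - 1)` is the
rising factorial, i.e. `Γ(γ + k) / Γ(γ)` read as `1 / Γ(γ) = 0` regularises it when `γ` is a
non-positive integer. -/
def prabhakarML (ρ β γ z : ℝ) : ℝ :=
  ∑' k : ℕ, (ascPochhammer ℝ k).eval γ / Real.Gamma (ρ * k + β) * (z ^ k / (k.factorial : ℝ))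

/-- The Prabhakar kernel `e_{ρ,β,ω}^γ(t) = t^{β-1} E_{ρ,β}^γ(ω t^ρ)`, for `t > 0`. -/
def prabhakarKernel (ρ β ω γ t : ℝ) : ℝ :=
  t ^ (β - 1) * prabhakarML ρ β γ (ω * t ^ ρ)

/-- The Prabhakar integral
`(𝐄_{ρ,β,ω,0+}^γ f)(t) = ∫_0^t (t-y)^{β-1} E_{ρ,β}^γ(ω (t-y)^ρ) f(y) dy`. -/
def prabhakarIntegral (ρ β ω γ : ℝ) (f : ℝ → ℂ) (t : ℝ) : ℂ :=
  ∫ y in (0 : ℝ)..t, (prabhakarKernel ρ β ω γ (t - y) : ℂ) * f y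

/-- The regularised (Caputo-type) Hilfer-Prabhakar derivative of order `μ`:
the Prabhakar integral `𝐄_{ρ,1-μ,ω,0+}^{-γ}` of `f'`. -/
def regHilferPrabhakarDeriv (ρ ω γ μ : ℝ) (f : ℝ → ℂ) (t : ℝ) : ℂ :=
  prabhakarIntegral ρ (1 - μ) ω (-γ) (deriv f) t

/-- The Fourier transform `ĝ(p) = ∫ e^{-ipx} g(x) dx`. -/
def fourierHat (g : ℝ → ℂ) (p : ℝ) : ℂ :=
  ∫ x : ℝ, Complex.exp (-(Complex.I * p * x)) * g x

/-- The inverse Fourier transform `(1 / 2π) ∫ h(p) e^{ipx} dp`. -/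
def fourierInvHat (h : ℝ → ℂ) (x : ℝ) : ℂ :=
  (1 / (2 * Real.pi) : ℂ) * ∫ p : ℝ, Complex.exp (Complex.I * p * x) * h p

/-- The `n`-th term `(-K)^n p^{2n} t^{nμ} E_{ρ,nμ+1}^{nγ}(ω t^ρ)` of the series. -/
def symbolTerm (ρ ω γ μ K p t : ℝ) (n : ℕ) : ℝ :=
  (-K) ^ n * p ^ (2 * n) * t ^ (n * μ) * prabhakarML ρ (n * μ + 1) (n * γ) (ω * t ^ ρ)

/-- `u(x,t) = (1 / 2π) ∫ e^{ipx} ĝ(p) ∑_n (-K)^n p^{2n} t^{nμ} E_{ρ,nμ+1}^{nγ}(ω t^ρ) dp`. -/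
def diffusionFormula (ρ ω γ μ K : ℝ) (g : ℝ → ℂ) (x t : ℝ) : ℂ :=
  fourierInvHat (fun p => fourierHat g p * ((∑' n : ℕ, symbolTerm ρ ω γ μ K p t n : ℝ) : ℂ)) x

/-- `u` is a solution of the Cauchy problem `ᶜ𝐃 u = K u_xx` (the derivative `ᶜ𝐃` acting in `t`),
`u(x,0+) = g(x)`, `u(x,t) → 0` as `x → ±∞`. Values of `u` at `t < 0` play no role. -/
structure IsDiffusionSolution (ρ ω γ μ K : ℝ) (g : ℝ → ℂ) (u : ℝ → ℝ → ℂ) : Prop where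
  /-- `u(x,·)` is absolutely continuous on every `[0,b]`, as `ᶜ𝐃` requires. -/
  absCont : ∀ x : ℝ, ∀ b > 0, AbsolutelyContinuousOnInterval (u x) 0 b
  /-- The integral that defines `ᶜ𝐃 u(x,t)` converges. -/
  converges : ∀ x : ℝ, ∀ t > 0, IntervalIntegrable
    (fun y => (prabhakarKernel ρ (1 - μ) ω (-γ) (t - y) : ℂ) * deriv (u x) y) volume 0 t
  /-- `u(·,t)` is twice differentiable. -/
  diff : ∀ t > 0, Differentiable ℝ (fun x => u x t)
  diff_two : ∀ t > 0, Differentiable ℝ (deriv fun x => u x t)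
  equation : ∀ x : ℝ, ∀ t > 0,
    regHilferPrabhakarDeriv ρ ω γ μ (u x) t = (K : ℂ) * deriv (deriv fun y => u y t) x
  initial : ∀ x : ℝ, Tendsto (u x) (𝓝[>] 0) (𝓝 (g x))
  decay_top : ∀ t > 0, Tendsto (fun x => u x t) atTop (𝓝 0)
  decay_bot : ∀ t > 0, Tendsto (fun x => u x t) atBot (𝓝 0)

/-- On every time interval `(0,b)` the function `∂u/∂t` is dominated, uniformly in `x`, by an
integrable function of `t`. -/
def HasDominatedTimeDeriv (u : ℝ → ℝ → ℂ) : Prop :=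
  ∀ b > 0, ∃ m : ℝ → ℝ, IntegrableOn m (Ioo 0 b) ∧
    ∀ x : ℝ, ∀ᵐ t ∂(volume.restrict (Ioo 0 b)), ‖deriv (u x) t‖ ≤ m t

end

/-! Write * for convolution on the half-line, k_α = t^(α-1)/Γ(α), h for the Prabhakar kernel with
indices (μ, γ), and k for the kernel of ᶜ𝐃, with indices (1-μ, -γ). Convolution of Prabhakar kernels
adds both indices (`hconv_prabhakarSeries`), so k * h = k_1 = 1: convolution with h inverts ᶜ𝐃 up to
the initial value. For a Fourier mode with L = K p² the problem becomes the Volterra equation w = 1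
- L (h * w). Its solution is w = 1 - 1 * r, where r = L h - L (h * r) is the resolvent kernel, and
the Neumann series of w is the series of the statement (`hasSum_symbolTerm`). Moreover k * r = L w.

Everything analytic rests on a bound for k_{1-μ} * |r| that does not depend on p
(`exists_hconv_abs_resolvent_le`). For the Riemann–Liouville kernel k_μ the resolvent r₀ is
nonnegative, because k_μ is log-convex (`resolvent_rlKernel_pos`). Then P = k_{1-μ} * r₀ = L (1 - 1
* r₀) is decreasing and k_μ * P = 1 * r₀ ≤ 1, which bounds P free of L. The Prabhakar kernel is h =
k_μ + k_μ * Q with Q of positive order ρ; a resolvent identity and a Gronwall inequality carry the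
bound over. Hence w = O(1/(1 + p²)), so the inverse Fourier integral converges. If ĝ is integrable,
two x-derivatives are allowed, time convolutions commute with the frequency integral, and the
equation holds mode by mode.

For uniqueness u(·,t) need not be integrable, so it is paired with φ = χ̂ for a compactly supported
C² function χ. The domination of ∂u/∂t makes u bounded and u_xx(·,s) bounded for almost every s. Two
integrations by parts then give a Volterra equation that links the pairing with φ to the pairing
with φ'', which is the transform of -p² χ (`IsDiffusionSolution.exists_weak_equation`). Iteration
reproduces the Neumann series, and the remainder vanishes because p is bounded on the support of χ.
This yields ∫ χ̂ u = ∫ ĝ χ w; letting χ run through amplitudes whose transforms concentrate at a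
point recovers u there. -/

/-! ### Riemann–Liouville kernels and convolution on the half-line. -/

/-- The Riemann–Liouville kernel `t^{α-1} / Γ(α)` on `(0, ∞)`, extended by zero. -/
noncomputable def rlKernel (α t : ℝ) : ℝ := if 0 < t then t ^ (α - 1) / Real.Gamma α else 0

/-- Convolution of functions supported on the half-line `(0, ∞)`. -/
noncomputable def hconv {E : Type*} [NormedAddCommGroup E] [NormedSpace ℝ E]
    (f : ℝ → ℝ) (F : ℝ → E) (t : ℝ) : E := ∫ y, f (t - y) • F y

theorem rlKernel_of_pos {α t : ℝ} (ht : 0 < t) :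
    rlKernel α t = t ^ (α - 1) / Real.Gamma α := if_pos ht

theorem rlKernel_of_nonpos {α t : ℝ} (ht : t ≤ 0) : rlKernel α t = 0 := if_neg ht.not_gt

theorem rlKernel_pos {α t : ℝ} (hα : 0 < α) (ht : 0 < t) : 0 < rlKernel α t := by
  rw [rlKernel_of_pos ht]
  exact div_pos (Real.rpow_pos_of_pos ht _) (Real.Gamma_pos_of_pos hα)

theorem rlKernel_nonneg {α : ℝ} (hα : 0 < α) (t : ℝ) : 0 ≤ rlKernel α t := by
  rcases lt_or_ge 0 t with ht | ht
  · exact (rlKernel_pos hα ht).le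
  · exact (rlKernel_of_nonpos ht).ge

theorem rlKernel_one {t : ℝ} (ht : 0 < t) : rlKernel 1 t = 1 := by
  simp [rlKernel_of_pos ht]

theorem measurable_rlKernel (α : ℝ) : Measurable (rlKernel α) := by
  unfold rlKernel
  exact Measurable.ite measurableSet_Ioi (by fun_prop) measurable_const

theorem hconv_rlKernel_eq_indicator (α β t : ℝ) :
    (fun y => rlKernel α (t - y) * rlKernel β y) = (Ioo 0 t).indicator
      (fun y => (y ^ (β - 1) * (t - y) ^ (α - 1)) * (Real.Gamma α * Real.Gamma β)⁻¹) := by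
  funext y
  by_cases hy : y ∈ Ioo 0 t
  · rw [indicator_of_mem hy, rlKernel_of_pos hy.1, rlKernel_of_pos (sub_pos.2 hy.2), mul_inv]
    ring
  · rw [indicator_of_notMem hy]
    rcases le_or_gt y 0 with h | h
    · rw [rlKernel_of_nonpos h, mul_zero]
    · have : t - y ≤ 0 := by
        by_contra h'
        exact hy ⟨h, by linarith⟩
      rw [rlKernel_of_nonpos this, zero_mul]

theorem integral_rpow_mul_sub_rpow {α β t : ℝ} (hα : 0 < α) (hβ : 0 < β) (ht : 0 < t) :
    ∫ y in Ioo 0 t, y ^ (β - 1) * (t - y) ^ (α - 1) =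
      t ^ (α + β - 1) * (Real.Gamma α * Real.Gamma β / Real.Gamma (α + β)) := by
  have h := Complex.betaIntegral_scaled (β : ℂ) (α : ℂ) ht
  have hc : Complex.betaIntegral (β : ℂ) α =
      ((Real.Gamma β * Real.Gamma α / Real.Gamma (β + α) : ℝ) : ℂ) := by
    rw [Complex.betaIntegral_eq_Gamma_mul_div _ _ (by simpa) (by simpa), ← Complex.ofReal_add,
      Complex.Gamma_ofReal, Complex.Gamma_ofReal, Complex.Gamma_ofReal]
    push_cast
    rfl
  rw [hc, intervalIntegral.integral_of_le ht.le, integral_Ioc_eq_integral_Ioo] at h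
  have h2 : ∫ x in Ioo 0 t, (x : ℂ) ^ ((β : ℂ) - 1) * ((t : ℂ) - x) ^ ((α : ℂ) - 1) =
      ((∫ y in Ioo 0 t, y ^ (β - 1) * (t - y) ^ (α - 1) : ℝ) : ℂ) := by
    rw [← integral_complex_ofReal]
    refine setIntegral_congr_fun measurableSet_Ioo fun x hx => ?_
    rw [Complex.ofReal_mul, Complex.ofReal_cpow hx.1.le, Complex.ofReal_cpow (sub_pos.2 hx.2).le]
    push_cast
    rfl
  rw [h2] at h
  have h3 : (t : ℂ) ^ ((β : ℂ) + α - 1) = ((t ^ (β + α - 1) : ℝ) : ℂ) := by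
    rw [Complex.ofReal_cpow ht.le]
    push_cast
    rfl
  rw [h3, ← Complex.ofReal_mul] at h
  rw [Complex.ofReal_injective h, add_comm β α, mul_comm (Real.Gamma β)]

theorem hconv_rlKernel {α β : ℝ} (hα : 0 < α) (hβ : 0 < β) (t : ℝ) :
    hconv (rlKernel α) (rlKernel β) t = rlKernel (α + β) t := by
  simp only [hconv, smul_eq_mul]
  rw [hconv_rlKernel_eq_indicator, integral_indicator measurableSet_Ioo, integral_mul_const]
  rcases lt_or_ge 0 t with ht | ht
  · rw [integral_rpow_mul_sub_rpow hα hβ ht, rlKernel_of_pos ht]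
    have := (Real.Gamma_pos_of_pos hα).ne'
    have := (Real.Gamma_pos_of_pos hβ).ne'
    field_simp
  · rw [Ioo_eq_empty (not_lt.2 ht), rlKernel_of_nonpos ht]
    simp

theorem integrable_rlKernel_mul {α β : ℝ} (hα : 0 < α) (hβ : 0 < β) (t : ℝ) :
    Integrable fun y => rlKernel α (t - y) * rlKernel β y := by
  rcases lt_or_ge 0 t with ht | ht
  -- Integrability is read off from the value: a non-integrable function would have Bochner integral
  -- 0, but the beta formula gives a positive number.
  · by_contra h
    have h1 := hconv_rlKernel hα hβ t
    simp only [hconv, smul_eq_mul] at h1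
    rw [integral_undef h] at h1
    exact (rlKernel_pos (add_pos hα hβ) ht).ne h1
  · rw [hconv_rlKernel_eq_indicator, Ioo_eq_empty (not_lt.2 ht), indicator_empty]
    exact integrable_zero _ _ _

theorem integrableOn_rlKernel {α : ℝ} (hα : 0 < α) (b : ℝ) :
    IntegrableOn (rlKernel α) (Iic b) := by
  -- At t = b + 1 the factor of order 1 equals 1 on all of (-∞, b].
  have h := integrable_rlKernel_mul one_pos hα (b + 1)
  refine (h.integrableOn (s := Iic b)).congr_fun (fun y hy => ?_) measurableSet_Iic
  have : 0 < b + 1 - y := by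
    have := mem_Iic.1 hy
    linarith
  simp only [rlKernel_one this, one_mul]

/-- For `0 < β ≤ α`, the kernel of order `α` is locally dominated by that of order `β`. -/
theorem rlKernel_le_mul {α β : ℝ} (hβ : 0 < β) (hαβ : β ≤ α) (b : ℝ) :
    ∃ C, 0 ≤ C ∧ ∀ t ≤ b, rlKernel α t ≤ C * rlKernel β t := by
  refine ⟨|b| ^ (α - β) * Real.Gamma β / Real.Gamma α, ?_, fun t ht => ?_⟩
  · have := (Real.Gamma_pos_of_pos hβ).le
    have := (Real.Gamma_pos_of_pos (hβ.trans_le hαβ)).le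
    positivity
  · rcases lt_or_ge 0 t with h0 | h0
    · have h1 := Real.Gamma_pos_of_pos hβ
      have h2 := Real.Gamma_pos_of_pos (hβ.trans_le hαβ)
      rw [rlKernel_of_pos h0, rlKernel_of_pos h0]
      have h3 : t ^ (α - 1) = t ^ (α - β) * t ^ (β - 1) := by
        rw [← Real.rpow_add h0]
        ring_nf
      have h4 : t ^ (α - β) ≤ |b| ^ (α - β) :=
        Real.rpow_le_rpow h0.le (ht.trans (le_abs_self b)) (by linarith)
      rw [h3, show |b| ^ (α - β) * Real.Gamma β / Real.Gamma α * (t ^ (β - 1) / Real.Gamma β) =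
        |b| ^ (α - β) * t ^ (β - 1) / Real.Gamma α by field_simp]
      gcongr
    · rw [rlKernel_of_nonpos h0, rlKernel_of_nonpos h0, mul_zero]

/-! ### The convolution algebra of functions locally bounded by a power. -/

section

set_option linter.unusedSectionVars false

variable {E : Type*} [NormedAddCommGroup E] [NormedSpace ℝ E]

/-- `F` vanishes on `(-∞, 0]` and is locally `O(t^{α-1})` there, uniformly on bounded intervals. -/
structure PowBound (α : ℝ) (F : ℝ → E) : Prop where
  meas : StronglyMeasurable F
  bound : ∀ b, ∃ C, 0 ≤ C ∧ ∀ t ≤ b, ‖F t‖ ≤ C * rlKernel α t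

theorem PowBound.eq_zero {α : ℝ} {F : ℝ → E} (hF : PowBound α F) {t : ℝ} (ht : t ≤ 0) :
    F t = 0 := by
  obtain ⟨C, -, h⟩ := hF.bound t
  simpa [rlKernel_of_nonpos ht] using h t le_rfl

theorem powBound_rlKernel {α : ℝ} (hα : 0 < α) : PowBound α (rlKernel α) :=
  ⟨(measurable_rlKernel α).stronglyMeasurable, fun _ => ⟨1, zero_le_one, fun t _ => by
    rw [one_mul, Real.norm_of_nonneg (rlKernel_nonneg hα t)]⟩⟩

theorem PowBound.mono {α β : ℝ} {F : ℝ → E} (hF : PowBound α F) (hβ : 0 < β) (h : β ≤ α) :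
    PowBound β F := by
  refine ⟨hF.meas, fun b => ?_⟩
  obtain ⟨C, hC, h1⟩ := hF.bound b
  obtain ⟨D, hD, h2⟩ := rlKernel_le_mul hβ h b
  refine ⟨C * D, by positivity, fun t ht => (h1 t ht).trans ?_⟩
  rw [mul_assoc]
  exact mul_le_mul_of_nonneg_left (h2 t ht) hC

theorem PowBound.add {α : ℝ} {F G : ℝ → E} (hF : PowBound α F) (hG : PowBound α G) :
    PowBound α (fun t => F t + G t) := by
  refine ⟨hF.meas.add hG.meas, fun b => ?_⟩
  obtain ⟨C, hC, h1⟩ := hF.bound b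
  obtain ⟨D, hD, h2⟩ := hG.bound b
  refine ⟨C + D, by positivity, fun t ht => (norm_add_le _ _).trans ?_⟩
  rw [add_mul]
  exact add_le_add (h1 t ht) (h2 t ht)

theorem PowBound.const_smul {α : ℝ} {F : ℝ → E} (hF : PowBound α F) (c : ℝ) :
    PowBound α (fun t => c • F t) := by
  refine ⟨hF.meas.const_smul c, fun b => ?_⟩
  obtain ⟨C, hC, h1⟩ := hF.bound b
  refine ⟨|c| * C, by positivity, fun t ht => ?_⟩
  rw [norm_smul, Real.norm_eq_abs, mul_assoc]
  exact mul_le_mul_of_nonneg_left (h1 t ht) (abs_nonneg c)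

theorem PowBound.const_mul {α : ℝ} {f : ℝ → ℝ} (hf : PowBound α f) (c : ℝ) :
    PowBound α (fun t => c * f t) := hf.const_smul c

theorem PowBound.sub {α : ℝ} {F G : ℝ → E} (hF : PowBound α F) (hG : PowBound α G) :
    PowBound α (fun t => F t - G t) := by
  simpa [sub_eq_add_neg] using hF.add (hG.const_smul (-1))

theorem PowBound.norm {α : ℝ} {F : ℝ → E} (hF : PowBound α F) : PowBound α (fun t => ‖F t‖) :=
  ⟨hF.meas.norm, fun b => by simpa using hF.bound b⟩

theorem PowBound.abs {α : ℝ} {f : ℝ → ℝ} (hf : PowBound α f) : PowBound α (fun t => |f t|) :=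
  hf.norm

/-- Outside 0 < y < t one factor vanishes, because its bound is a multiple of a kernel at a
nonpositive argument; `0 ≤ b` makes that bound available there. The size and integrability of the
convolutions below come from this pointwise estimate. -/
theorem norm_smul_le_rlKernel_mul {α β b C D : ℝ} {f : ℝ → ℝ} {F : ℝ → E} (hα : 0 < α)
    (hβ : 0 < β) (hf : ∀ s ≤ b, |f s| ≤ C * rlKernel α s)
    (hF : ∀ s ≤ b, ‖F s‖ ≤ D * rlKernel β s) (hC : 0 ≤ C) (hD : 0 ≤ D) (hb : 0 ≤ b)
    {t : ℝ} (ht : t ≤ b)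
    (y : ℝ) :
    ‖f (t - y) • F y‖ ≤ C * D * (rlKernel α (t - y) * rlKernel β y) := by
  have h0 : 0 ≤ C * D * (rlKernel α (t - y) * rlKernel β y) := by
    have := rlKernel_nonneg hα (t - y)
    have := rlKernel_nonneg hβ y
    positivity
  rw [norm_smul, Real.norm_eq_abs]
  rcases le_or_gt y 0 with hy | hy
  · by_cases hyb : y ≤ b
    · have : ‖F y‖ = 0 := le_antisymm (by simpa [rlKernel_of_nonpos hy] using hF y hyb)
        (norm_nonneg _)
      rw [this, mul_zero]
      exact h0
    · exact absurd (hy.trans hb) hyb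
  · rcases le_or_gt t y with hty | hty
    · by_cases hyb : t - y ≤ b
      · have : |f (t - y)| = 0 := le_antisymm
          (by simpa [rlKernel_of_nonpos (show t - y ≤ 0 by linarith)] using hf (t - y) hyb)
          (abs_nonneg _)
        rw [this, zero_mul]
        exact h0
      · exact absurd (by linarith) hyb
    · calc |f (t - y)| * ‖F y‖ ≤ (C * rlKernel α (t - y)) * (D * rlKernel β y) := by
            refine mul_le_mul (hf _ (by linarith)) (hF _ (by linarith)) (norm_nonneg _) ?_
            have := rlKernel_nonneg hα (t - y)
            positivity
        _ = _ := by ring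

theorem integrable_smul_of_le_rlKernel {α β b C D : ℝ} {f : ℝ → ℝ} {F : ℝ → E} (hα : 0 < α)
    (hβ : 0 < β) (hfm : StronglyMeasurable f) (hFm : StronglyMeasurable F)
    (hf : ∀ s ≤ b, |f s| ≤ C * rlKernel α s)
    (hF : ∀ s ≤ b, ‖F s‖ ≤ D * rlKernel β s) (hC : 0 ≤ C) (hD : 0 ≤ D) (hb : 0 ≤ b)
    {t : ℝ} (ht : t ≤ b) :
    Integrable fun y => f (t - y) • F y := by
  refine ((integrable_rlKernel_mul hα hβ t).const_mul (C * D)).mono' ?_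
    (Eventually.of_forall (norm_smul_le_rlKernel_mul hα hβ hf hF hC hD hb ht))
  exact ((hfm.comp_measurable (measurable_const.sub measurable_id)).smul hFm).aestronglyMeasurable

theorem norm_hconv_le {α β b C D : ℝ} {f : ℝ → ℝ} {F : ℝ → E} (hα : 0 < α)
    (hβ : 0 < β) (hf : ∀ s ≤ b, |f s| ≤ C * rlKernel α s)
    (hF : ∀ s ≤ b, ‖F s‖ ≤ D * rlKernel β s) (hC : 0 ≤ C) (hD : 0 ≤ D) (hb : 0 ≤ b)
    {t : ℝ} (ht : t ≤ b) :
    ‖hconv f F t‖ ≤ C * D * rlKernel (α + β) t := by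
  have h := norm_integral_le_of_norm_le ((integrable_rlKernel_mul hα hβ t).const_mul (C * D))
    (Eventually.of_forall (norm_smul_le_rlKernel_mul hα hβ hf hF hC hD hb ht))
  rw [integral_const_mul] at h
  have h2 := hconv_rlKernel hα hβ t
  simp only [hconv, smul_eq_mul] at h2
  rwa [h2] at h

theorem PowBound.integrable {α β : ℝ} {f : ℝ → ℝ} {F : ℝ → E} (hf : PowBound α f)
    (hF : PowBound β F) (hα : 0 < α) (hβ : 0 < β) (t : ℝ) :
    Integrable fun y => f (t - y) • F y := by
  obtain ⟨C, hC, h1⟩ := hf.bound (max t 0)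
  obtain ⟨D, hD, h2⟩ := hF.bound (max t 0)
  exact integrable_smul_of_le_rlKernel hα hβ hf.meas hF.meas h1 h2 hC hD (le_max_right _ _)
    (le_max_left _ _)

theorem PowBound.integrableOn {α : ℝ} {F : ℝ → E} (hF : PowBound α F) (hα : 0 < α) (b : ℝ) :
    IntegrableOn F (Iic b) := by
  obtain ⟨C, hC, h1⟩ := hF.bound b
  refine ((integrableOn_rlKernel hα b).const_mul C).mono' hF.meas.aestronglyMeasurable ?_
  exact (ae_restrict_iff' measurableSet_Iic).2 (Eventually.of_forall h1)

theorem stronglyMeasurable_hconv {f : ℝ → ℝ} {F : ℝ → E} (hf : StronglyMeasurable f)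
    (hF : StronglyMeasurable F) : StronglyMeasurable (hconv f F) := by
  have : StronglyMeasurable (fun p : ℝ × ℝ => f (p.1 - p.2) • F p.2) :=
    (hf.comp_measurable (measurable_fst.sub measurable_snd)).smul
      (hF.comp_measurable measurable_snd)
  exact this.integral_prod_right'

/-- Orders add under convolution. With the growth of Γ this is what makes Neumann series converge.
-/
theorem PowBound.toHconv {α β : ℝ} {f : ℝ → ℝ} {F : ℝ → E} (hf : PowBound α f)
    (hF : PowBound β F) (hα : 0 < α) (hβ : 0 < β) : PowBound (α + β) (hconv f F) := by
  refine ⟨stronglyMeasurable_hconv hf.meas hF.meas, fun b => ?_⟩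
  obtain ⟨C, hC, h1⟩ := hf.bound (max b 0)
  obtain ⟨D, hD, h2⟩ := hF.bound (max b 0)
  exact ⟨C * D, by positivity, fun t ht => norm_hconv_le hα hβ h1 h2 hC hD (le_max_right _ _)
    (ht.trans (le_max_left _ _))⟩

theorem hconv_comm (f g : ℝ → ℝ) (t : ℝ) : hconv f g t = hconv g f t := by
  simp only [hconv, smul_eq_mul]
  rw [← integral_sub_left_eq_self (fun y => f (t - y) * g y) volume t]
  simp only [sub_sub_cancel, mul_comm]

theorem hconv_one_eq {F : ℝ → E} (hF : ∀ t ≤ 0, F t = 0) (t : ℝ) :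
    hconv (rlKernel 1) F t = ∫ y in Ioc 0 t, F y := by
  rw [hconv, ← integral_indicator measurableSet_Ioc]
  have h0 : ∀ᵐ y : ℝ, y ≠ t := by simp [ae_iff, measure_singleton]
  refine integral_congr_ae ?_
  filter_upwards [h0] with y hy
  by_cases hm : y ∈ Ioc 0 t
  · rw [indicator_of_mem hm, rlKernel_one (sub_pos.2 (lt_of_le_of_ne hm.2 hy)), one_smul]
  · rw [indicator_of_notMem hm]
    rcases le_or_gt y 0 with h | h
    · rw [hF y h, smul_zero]
    · rw [rlKernel_of_nonpos, zero_smul]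
      by_contra h'
      exact hm ⟨h, by linarith⟩

theorem hconv_eq_integral {f : ℝ → ℝ} {F : ℝ → E} (hf : ∀ t ≤ 0, f t = 0)
    (hF : ∀ t ≤ 0, F t = 0) (t : ℝ) :
    hconv f F t = ∫ y in Ioc 0 t, f (t - y) • F y := by
  rw [hconv, ← integral_indicator measurableSet_Ioc]
  congr 1
  funext y
  by_cases hm : y ∈ Ioc 0 t
  · rw [indicator_of_mem hm]
  · rw [indicator_of_notMem hm]
    rcases le_or_gt y 0 with h | h
    · rw [hF y h, smul_zero]
    · rw [hf, zero_smul]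
      by_contra h'
      exact hm ⟨h, by linarith⟩

/-- Fubini, with |h| * |k| dominated by the kernel of order α + β. No power bound is asked of `F`,
because the time derivative of a solution only has an integrable majorant. -/
theorem hconv_assoc_of_integrable [CompleteSpace E] {α β : ℝ} (hα : 0 < α) (hβ : 0 < β)
    {h k : ℝ → ℝ} {F : ℝ → E} (hh : PowBound α h) (hk : PowBound β k) (hF : StronglyMeasurable F)
    (hF0 : ∀ t ≤ 0, F t = 0) {t : ℝ}
    (hint : Integrable fun y => rlKernel (α + β) (t - y) * ‖F y‖) :
    hconv h (hconv k F) t = hconv (hconv h k) F t := by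
  have hm : StronglyMeasurable (fun p : ℝ × ℝ => (h (t - p.1) * k (p.1 - p.2)) • F p.2) :=
    (((hh.meas.comp_measurable (measurable_const.sub measurable_fst)).mul
      (hk.meas.comp_measurable (measurable_fst.sub measurable_snd)))).smul
      (hF.comp_measurable measurable_snd)
  have hshift : ∀ G : ℝ → ℝ, ∀ y, ∫ s, h (t - s) * G (s - y) = hconv h G (t - y) := by
    intro G y
    rw [hconv, ← integral_add_right_eq_self (fun s => h (t - s) * G (s - y)) y]
    refine integral_congr_ae (Eventually.of_forall fun s => ?_)
    simp only [smul_eq_mul, add_sub_cancel_right]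
    congr 2
    ring
  have hshift' : ∀ G : ℝ → ℝ, ∀ y, Integrable (fun s => h (t - y - s) * G s) →
      Integrable fun s => h (t - s) * G (s - y) := by
    intro G y hi
    have := hi.comp_sub_right y
    refine this.congr (Eventually.of_forall fun s => ?_)
    simp only
    congr 2
    ring
  have habs : ∀ y, ∫ s, ‖(h (t - s) * k (s - y)) • F y‖ =
      hconv (fun s => |h s|) (fun s => |k s|) (t - y) * ‖F y‖ := by
    intro y
    simp_rw [norm_smul, integral_mul_const, norm_mul, Real.norm_eq_abs]
    congr 1
    rw [hconv, ← integral_add_right_eq_self (fun s => |h (t - s)| * |k (s - y)|) y]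
    refine integral_congr_ae (Eventually.of_forall fun s => ?_)
    simp only [smul_eq_mul, add_sub_cancel_right]
    congr 3
    ring
  have hI : Integrable (fun p : ℝ × ℝ => (h (t - p.1) * k (p.1 - p.2)) • F p.2)
      (volume.prod volume) := by
    rw [integrable_prod_iff' hm.aestronglyMeasurable]
    refine ⟨Eventually.of_forall fun y => ?_, ?_⟩
    · exact (hshift' k y (hh.integrable hk hα hβ (t - y))).smul_const (F y)
    · simp only [habs]
      obtain ⟨C, hC, hb⟩ := (hh.abs.toHconv hk.abs hα hβ).bound t
      refine (hint.const_mul C).mono' ?_ (Eventually.of_forall fun y => ?_)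
      · exact (((stronglyMeasurable_hconv hh.abs.meas hk.abs.meas).comp_measurable
          (measurable_const.sub measurable_id)).mul hF.norm).aestronglyMeasurable
      · rw [norm_mul, norm_norm, ← mul_assoc]
        rcases le_or_gt y 0 with hy | hy
        · rw [hF0 y hy]
          simp
        · exact mul_le_mul_of_nonneg_right (hb (t - y) (by linarith)) (norm_nonneg _)
  have h1 : hconv h (hconv k F) t = ∫ s, ∫ y, (h (t - s) * k (s - y)) • F y := by
    simp only [hconv, ← integral_smul, smul_smul]
  rw [h1, integral_integral_swap hI, hconv]
  congr 1
  funext y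
  rw [integral_smul_const, hshift]

theorem PowBound.hconv_assoc [CompleteSpace E] {α β δ : ℝ} (hα : 0 < α) (hβ : 0 < β)
    (hδ : 0 < δ) {h k : ℝ → ℝ} {F : ℝ → E} (hh : PowBound α h) (hk : PowBound β k) (hF : PowBound δ F) (t : ℝ) :
    hconv h (hconv k F) t = hconv (hconv h k) F t :=
  hconv_assoc_of_integrable hα hβ hh hk hF.meas (fun _ => hF.eq_zero)
    ((powBound_rlKernel (add_pos hα hβ)).integrable hF.norm (add_pos hα hβ) hδ t)

theorem hconv_add_right {f : ℝ → ℝ} {F G : ℝ → E} {t : ℝ}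
    (hF : Integrable fun y => f (t - y) • F y) (hG : Integrable fun y => f (t - y) • G y) :
    hconv f (fun s => F s + G s) t = hconv f F t + hconv f G t := by
  simp only [hconv, smul_add]
  exact integral_add hF hG

theorem hconv_sub_right {f : ℝ → ℝ} {F G : ℝ → E} {t : ℝ}
    (hF : Integrable fun y => f (t - y) • F y) (hG : Integrable fun y => f (t - y) • G y) :
    hconv f (fun s => F s - G s) t = hconv f F t - hconv f G t := by
  simp only [hconv, smul_sub]
  exact integral_sub hF hG

theorem hconv_const_smul_right (f : ℝ → ℝ) (c : ℝ) (F : ℝ → E) (t : ℝ) :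
    hconv f (fun s => c • F s) t = c • hconv f F t := by
  simp only [hconv, smul_comm _ c, integral_smul]

theorem hconv_const_mul_right (f : ℝ → ℝ) (c : ℝ) (g : ℝ → ℝ) (t : ℝ) :
    hconv f (fun s => c * g s) t = c * hconv f g t := hconv_const_smul_right f c g t

theorem hconv_const_mul_left (c : ℝ) (f : ℝ → ℝ) (F : ℝ → E) (t : ℝ) :
    hconv (fun s => c * f s) F t = c • hconv f F t := by
  simp only [hconv, mul_smul, integral_smul]

theorem hconv_mono {f : ℝ → ℝ} {g g' : ℝ → ℝ} {t : ℝ} (hf : ∀ s, 0 ≤ f s)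
    (hg : Integrable fun y => f (t - y) • g y) (hg' : Integrable fun y => f (t - y) • g' y)
    (hle : ∀ s < t, g s ≤ g' s) (hf0 : ∀ s ≤ 0, f s = 0) : hconv f g t ≤ hconv f g' t := by
  refine integral_mono hg hg' fun y => ?_
  rcases lt_or_ge y t with h | h
  · exact mul_le_mul_of_nonneg_left (hle y h) (hf _)
  · simp [hf0 (t - y) (by linarith)]

theorem hconv_nonneg {f g : ℝ → ℝ} (hf : ∀ s, 0 ≤ f s) (hg : ∀ s, 0 ≤ g s) (t : ℝ) :
    0 ≤ hconv f g t := integral_nonneg fun _ => mul_nonneg (hf _) (hg _)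

theorem norm_hconv_le_hconv (f : ℝ → ℝ) (F : ℝ → E) (t : ℝ) :
    ‖hconv f F t‖ ≤ hconv (fun s => |f s|) (fun s => ‖F s‖) t := by
  refine (norm_integral_le_integral_norm _).trans_eq ?_
  simp only [norm_smul, hconv, smul_eq_mul, Real.norm_eq_abs]

end

/-! ### Fractional power series. -/

/-- Keep only u > T in Euler's integral for Γ(x + β), where u^x ≥ T^x. As T is arbitrary, Γ outgrows
every exponential. -/
theorem exists_mul_rpow_le_Gamma {β T : ℝ} (hβ : 0 < β) (hT : 0 < T) :
    ∃ c, 0 < c ∧ ∀ x, 0 ≤ x → c * T ^ x ≤ Real.Gamma (x + β) := by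
  have hi : ∀ x, 0 ≤ x → IntegrableOn (fun u : ℝ => Real.exp (-u) * u ^ (x + β - 1)) (Ioi T) :=
    fun x hx => (Real.GammaIntegral_convergent (by linarith)).mono_set (Ioi_subset_Ioi hT.le)
  have hi0 : IntegrableOn (fun u : ℝ => Real.exp (-u) * u ^ (β - 1)) (Ioi T) := by
    simpa using hi 0 le_rfl
  refine ⟨∫ u in Ioi T, Real.exp (-u) * u ^ (β - 1), ?_, fun x hx => ?_⟩
  · rw [integral_pos_iff_support_of_nonneg_ae]
    · have : Ioi T ⊆ Function.support fun u : ℝ => Real.exp (-u) * u ^ (β - 1) := fun u hu =>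
        (mul_pos (Real.exp_pos _) (Real.rpow_pos_of_pos (hT.trans hu) _)).ne'
      rw [Measure.restrict_apply' measurableSet_Ioi, inter_eq_self_of_subset_right this]
      simp
    · refine (ae_restrict_iff' measurableSet_Ioi).2 (Eventually.of_forall fun u hu => ?_)
      exact (mul_pos (Real.exp_pos _) (Real.rpow_pos_of_pos (hT.trans hu) _)).le
    · exact hi0
  · rw [Real.Gamma_eq_integral (by linarith), mul_comm, ← integral_const_mul]
    calc ∫ u in Ioi T, T ^ x * (Real.exp (-u) * u ^ (β - 1))
        ≤ ∫ u in Ioi T, Real.exp (-u) * u ^ (x + β - 1) := by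
          refine setIntegral_mono_on (hi0.const_mul _) (hi x hx) measurableSet_Ioi fun u hu => ?_
          have hu0 : 0 < u := hT.trans hu
          rw [add_sub_assoc, Real.rpow_add hu0, mul_left_comm]
          have : T ^ x ≤ u ^ x := Real.rpow_le_rpow hT.le (le_of_lt hu) hx
          have := Real.rpow_pos_of_pos hu0 (β - 1)
          gcongr
      _ ≤ ∫ u in Ioi 0, Real.exp (-u) * u ^ (x + β - 1) := by
          refine setIntegral_mono_set (Real.GammaIntegral_convergent (by linarith)) ?_
            (Ioi_subset_Ioi hT.le).eventuallyLE
          refine (ae_restrict_iff' measurableSet_Ioi).2 (Eventually.of_forall fun u hu => ?_)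
          exact (mul_pos (Real.exp_pos _) (Real.rpow_pos_of_pos hu _)).le

/-- The kernels of order `ρ j + β` decay faster than any geometric sequence in `j`. -/
theorem exists_rlKernel_le_geometric {ρ β ε : ℝ} (hρ : 0 < ρ) (hβ : 0 < β) (hε : 0 < ε) (b : ℝ) :
    ∃ C, 0 ≤ C ∧ ∀ (j : ℕ) (t), t ≤ b → rlKernel (ρ * j + β) t ≤ C * ε ^ j * rlKernel β t := by
  set B := max b 1 with hB
  have hB0 : 0 < B := lt_of_lt_of_le one_pos (le_max_right _ _)
  -- Chosen so that (B/q)^(ρj) = B^(ρj)/ε^j: the bound for Γ with base B/q then supplies the factor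
  -- ε^j.
  set q := ε ^ (1 / ρ) with hq
  have hq0 : 0 < q := Real.rpow_pos_of_pos hε _
  obtain ⟨c, hc, h⟩ := exists_mul_rpow_le_Gamma hβ (div_pos hB0 hq0)
  have hG := Real.Gamma_pos_of_pos hβ
  refine ⟨Real.Gamma β / c, by positivity, fun j t ht => ?_⟩
  rcases lt_or_ge 0 t with h0 | h0
  · have hx : 0 ≤ ρ * (j : ℝ) := by positivity
    have h1 := h _ hx
    have hqj : q ^ (ρ * (j : ℝ)) = ε ^ j := by
      rw [hq, ← Real.rpow_mul hε.le, ← mul_assoc, one_div, inv_mul_cancel₀ hρ.ne', one_mul,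
        Real.rpow_natCast]
    rw [Real.div_rpow hB0.le hq0.le, hqj] at h1
    rw [rlKernel_of_pos h0, rlKernel_of_pos h0, add_sub_assoc, Real.rpow_add h0]
    have h2 : t ^ (ρ * (j : ℝ)) ≤ B ^ (ρ * (j : ℝ)) :=
      Real.rpow_le_rpow h0.le (ht.trans (le_max_left _ _)) hx
    have h3 := Real.rpow_pos_of_pos h0 (β - 1)
    have h4 : 0 < B ^ (ρ * (j : ℝ)) := Real.rpow_pos_of_pos hB0 _
    have hεj : 0 < ε ^ j := pow_pos hε j
    calc t ^ (ρ * (j : ℝ)) * t ^ (β - 1) / Real.Gamma (ρ * j + β)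
        ≤ B ^ (ρ * (j : ℝ)) * t ^ (β - 1) / (c * (B ^ (ρ * (j : ℝ)) / ε ^ j)) := by gcongr
      _ = Real.Gamma β / c * ε ^ j * (t ^ (β - 1) / Real.Gamma β) := by field_simp
  · rw [rlKernel_of_nonpos h0, rlKernel_of_nonpos h0, mul_zero]

/-- A sequence of at most exponential growth. -/
def ExpGrowth (a : ℕ → ℝ) : Prop := ∃ A R, 0 ≤ A ∧ 0 < R ∧ ∀ j, |a j| ≤ A * R ^ j

/-- The fractional power series `∑ a_j t^{ρ j + β - 1} / Γ(ρ j + β)` on `(0, ∞)`. -/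
noncomputable def rlSeries (ρ : ℝ) (a : ℕ → ℝ) (β t : ℝ) : ℝ :=
  ∑' j : ℕ, a j * rlKernel (ρ * j + β) t

/-- The ratio 1/(2R) absorbs the growth R^j of the coefficients and leaves (1/2)^j: a Weierstrass
majorant uniform for t ≤ b. -/
theorem ExpGrowth.exists_bound {ρ β : ℝ} (hρ : 0 < ρ) (hβ : 0 < β) {a : ℕ → ℝ} (ha : ExpGrowth a)
    (b : ℝ) : ∃ C, 0 ≤ C ∧ ∀ (j : ℕ) (t), t ≤ b →
      |a j * rlKernel (ρ * j + β) t| ≤ C * rlKernel β t * (1 / 2) ^ j := by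
  obtain ⟨A, R, hA, hR, h⟩ := ha
  obtain ⟨C, hC, h1⟩ := exists_rlKernel_le_geometric hρ hβ (show 0 < 1 / (2 * R) by positivity) b
  refine ⟨A * C, by positivity, fun j t ht => ?_⟩
  have hpos : 0 < ρ * (j : ℝ) + β := by positivity
  have h0 := rlKernel_nonneg hpos t
  rw [abs_mul, abs_of_nonneg h0]
  calc |a j| * rlKernel (ρ * j + β) t
      ≤ (A * R ^ j) * (C * (1 / (2 * R)) ^ j * rlKernel β t) :=
        mul_le_mul (h j) (h1 j t ht) h0 (by positivity)
    _ = A * C * rlKernel β t * (R * (1 / (2 * R))) ^ j := by rw [mul_pow]; ring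
    _ = A * C * rlKernel β t * (1 / 2) ^ j := by
        congr 2
        field_simp

theorem summable_half_pow : Summable fun j : ℕ => (1 / 2 : ℝ) ^ j :=
  summable_geometric_of_lt_one (by norm_num) (by norm_num)

theorem ExpGrowth.summable {ρ β : ℝ} (hρ : 0 < ρ) (hβ : 0 < β) {a : ℕ → ℝ} (ha : ExpGrowth a)
    (t : ℝ) : Summable fun j : ℕ => ‖a j * rlKernel (ρ * j + β) t‖ := by
  obtain ⟨C, hC, h⟩ := ha.exists_bound hρ hβ t
  exact Summable.of_nonneg_of_le (fun _ => norm_nonneg _) (fun j => h j t le_rfl)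
    (summable_half_pow.mul_left _)

theorem stronglyMeasurable_tsum {X : Type*} [MeasurableSpace X] {f : ℕ → X → ℝ}
    (hf : ∀ j, Measurable (f j)) (hs : ∀ x, Summable fun j => f j x) :
    StronglyMeasurable fun x => ∑' j, f j x := by
  refine (measurable_of_tendsto_metrizable
    (f := fun n x => ∑ j ∈ Finset.range n, f j x) (fun n => ?_) ?_).stronglyMeasurable
  · exact Finset.measurable_sum _ fun j _ => hf j
  · exact tendsto_pi_nhds.2 fun x => (hs x).hasSum.tendsto_sum_nat

theorem powBound_tsum {β : ℝ} {f : ℕ → ℝ → ℝ} (hf : ∀ j, Measurable (f j))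
    (h : ∀ b, ∃ C, 0 ≤ C ∧ ∀ (j : ℕ) (t), t ≤ b → |f j t| ≤ C * rlKernel β t * (1 / 2) ^ j) :
    PowBound β fun t => ∑' j, f j t := by
  refine ⟨stronglyMeasurable_tsum hf fun t => ?_, fun b => ?_⟩
  · obtain ⟨C, hC, h⟩ := h t
    exact Summable.of_norm_bounded (summable_half_pow.mul_left _) fun j => h j t le_rfl
  · obtain ⟨C, hC, h⟩ := h b
    refine ⟨2 * C, by positivity, fun t ht => ?_⟩
    refine (tsum_of_norm_bounded (summable_half_pow.mul_left _).hasSum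
      fun j => h j t ht).trans_eq ?_
    rw [tsum_mul_left, tsum_geometric_two]
    ring

theorem ExpGrowth.powBound {ρ β : ℝ} (hρ : 0 < ρ) (hβ : 0 < β) {a : ℕ → ℝ} (ha : ExpGrowth a) :
    PowBound β (rlSeries ρ a β) :=
  powBound_tsum (fun _ => (measurable_rlKernel _).const_mul _) fun b => ha.exists_bound hρ hβ b

/-- The geometric majorant makes the sum of the L¹ norms finite, so sum and integral may be
exchanged. -/
theorem hasSum_hconv_left {β : ℝ} {f : ℕ → ℝ → ℝ} {g : ℝ → ℝ} {t : ℝ}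
    (hf : ∀ b, ∃ C, 0 ≤ C ∧ ∀ (j : ℕ) (t), t ≤ b → |f j t| ≤ C * rlKernel β t * (1 / 2) ^ j)
    (hfm : ∀ j, Measurable (f j)) {α : ℝ} (hβ : 0 < β) (hα : 0 < α) (hg : PowBound α g) :
    HasSum (fun j => hconv (f j) g t) (hconv (fun s => ∑' j, f j s) g t) := by
  have hpb : ∀ j, PowBound β (f j) := fun j => ⟨(hfm j).stronglyMeasurable, fun b => by
    obtain ⟨C, hC, h⟩ := hf b
    refine ⟨C * (1 / 2) ^ j, by positivity, fun s hs => (h j s hs).trans_eq (by ring)⟩⟩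
  have hs : ∀ s, Summable fun j => f j s := fun s => by
    obtain ⟨C, hC, h⟩ := hf s
    exact Summable.of_norm_bounded (summable_half_pow.mul_left _) fun j => h j s le_rfl
  have hi : ∀ j, Integrable fun y => f j (t - y) • g y := fun j => (hpb j).integrable hg hβ hα t
  obtain ⟨C, hC, h⟩ := hf (max t 0)
  obtain ⟨D, hD, h'⟩ := hg.bound (max t 0)
  have hsum : Summable fun j => ∫ y, ‖f j (t - y) • g y‖ := by
    refine Summable.of_nonneg_of_le (fun j => integral_nonneg fun _ => norm_nonneg _) (fun j => ?_)
      (summable_half_pow.mul_left (C * D * rlKernel (β + α) t))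
    have := norm_hconv_le hβ hα (f := fun s => |f j s|) (F := fun s => |g s|)
      (b := max t 0) (C := C * (1 / 2) ^ j) (D := D) (t := t)
      (fun s hs => by rw [abs_abs]; exact (h j s hs).trans_eq (by ring))
      (fun s hs => by rw [Real.norm_eq_abs, abs_abs]; exact h' s hs)
      (by positivity) hD (le_max_right _ _) (le_max_left _ _)
    rw [Real.norm_of_nonneg (hconv_nonneg (fun _ => abs_nonneg _) (fun _ => abs_nonneg _) t)]
      at this
    simp only [smul_eq_mul, norm_mul, Real.norm_eq_abs]
    simp only [hconv, smul_eq_mul] at this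
    exact this.trans_eq (by ring)
  have := hasSum_integral_of_summable_integral_norm hi hsum
  simpa only [hconv, smul_eq_mul, tsum_mul_right] using this

theorem hasSum_rlSeries_hconv {ρ α β : ℝ} (hρ : 0 < ρ) (hα : 0 < α) (hβ : 0 < β) {a : ℕ → ℝ}
    (ha : ExpGrowth a) {g : ℝ → ℝ} (hg : PowBound β g) (t : ℝ) :
    HasSum (fun j : ℕ => a j * hconv (rlKernel (ρ * j + α)) g t) (hconv (rlSeries ρ a α) g t) := by
  have := hasSum_hconv_left (t := t) (fun b => ha.exists_bound hρ hα b)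
    (fun j => (measurable_rlKernel _).const_mul _) hα hβ hg
  simp only [hconv_const_mul_left, smul_eq_mul] at this
  exact this

theorem hconv_rlSeries_rlKernel {ρ α β : ℝ} (hρ : 0 < ρ) (hα : 0 < α) (hβ : 0 < β) {a : ℕ → ℝ}
    (ha : ExpGrowth a) (t : ℝ) :
    hconv (rlSeries ρ a α) (rlKernel β) t = rlSeries ρ a (α + β) t := by
  rw [← (hasSum_rlSeries_hconv hρ hα hβ ha (powBound_rlKernel hβ) t).tsum_eq, rlSeries]
  congr 1
  funext j
  rw [hconv_rlKernel (by positivity) hβ, add_assoc]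

/-- Convolution of fractional power series is the Cauchy product of the coefficients. -/
theorem hconv_rlSeries {ρ α β : ℝ} (hρ : 0 < ρ) (hα : 0 < α) (hβ : 0 < β) {a b c : ℕ → ℝ}
    (ha : ExpGrowth a) (hb : ExpGrowth b)
    (hc : ∀ n, c n = ∑ p ∈ Finset.HasAntidiagonal.antidiagonal n, a p.1 * b p.2) (t : ℝ) :
    hconv (rlSeries ρ a α) (rlSeries ρ b β) t = rlSeries ρ c (α + β) t := by
  set F : ℕ × ℕ → ℝ := fun p => a p.1 * b p.2 * rlKernel (ρ * ((p.1 + p.2 : ℕ) : ℝ) + (α + β)) t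
    with hF
  have hαβ : 0 < α + β := add_pos hα hβ
  have hsF : Summable F := by
    obtain ⟨A, R, hA, hR, h⟩ := ha
    obtain ⟨B, S, hB, hS, h'⟩ := hb
    -- The ratio 1/(2(R + S)) beats both growth rates at once, so the double series is dominated by
    -- a product of two geometric series and may be regrouped along antidiagonals.
    obtain ⟨C, hC, h1⟩ := exists_rlKernel_le_geometric hρ hαβ
      (show 0 < 1 / (2 * (R + S)) by positivity) t
    refine Summable.of_norm_bounded (g := fun p : ℕ × ℕ => A * B * C * rlKernel (α + β) t *
      ((1 / 2) ^ p.1 * (1 / 2) ^ p.2)) ?_ fun p => ?_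
    · exact (summable_half_pow.mul_of_nonneg summable_half_pow (fun _ => by positivity)
        (fun _ => by positivity)).mul_left _
    · have hk := rlKernel_nonneg (show 0 < ρ * ((p.1 + p.2 : ℕ) : ℝ) + (α + β) by positivity) t
      have hk' := rlKernel_nonneg hαβ t
      simp only [hF, norm_mul, Real.norm_eq_abs, abs_of_nonneg hk]
      have e1 : R * (1 / (2 * (R + S))) ≤ 1 / 2 := by
        rw [mul_one_div, div_le_div_iff₀ (by positivity) (by positivity)]
        nlinarith
      have e2 : S * (1 / (2 * (R + S))) ≤ 1 / 2 := by
        rw [mul_one_div, div_le_div_iff₀ (by positivity) (by positivity)]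
        nlinarith
      calc |a p.1| * |b p.2| * rlKernel (ρ * ((p.1 + p.2 : ℕ) : ℝ) + (α + β)) t
          ≤ (A * R ^ p.1) * (B * S ^ p.2) *
            (C * (1 / (2 * (R + S))) ^ (p.1 + p.2) * rlKernel (α + β) t) := by
            have := h p.1
            have := h' p.2
            have := h1 (p.1 + p.2) t le_rfl
            gcongr
        _ = A * B * C * rlKernel (α + β) t * ((R * (1 / (2 * (R + S)))) ^ p.1 *
            (S * (1 / (2 * (R + S)))) ^ p.2) := by
            rw [mul_pow, mul_pow, pow_add]
            ring
        _ ≤ _ := by gcongr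
  have h1 : hconv (rlSeries ρ a α) (rlSeries ρ b β) t = ∑' i, ∑' j, F (i, j) := by
    rw [← (hasSum_rlSeries_hconv hρ hα hβ ha (hb.powBound hρ hβ) t).tsum_eq]
    congr 1
    funext i
    have hi : 0 < ρ * (i : ℝ) + α := by positivity
    rw [hconv_comm, hconv_rlSeries_rlKernel hρ hβ hi hb, rlSeries, ← tsum_mul_left]
    congr 1
    funext j
    simp only [hF]
    push_cast
    rw [mul_assoc]
    congr 3
    ring
  have h2 : ∑' p, F p = ∑' i, ∑' j, F (i, j) := hsF.tsum_prod
  have h3 := (Finset.HasAntidiagonal.sigmaAntidiagonalEquivProd (A := ℕ)).summable_iff.2 hsF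
  rw [h1, ← h2, ← (Finset.HasAntidiagonal.sigmaAntidiagonalEquivProd (A := ℕ)).tsum_eq F,
    Summable.tsum_sigma (f := fun c => F (Finset.HasAntidiagonal.sigmaAntidiagonalEquivProd (A := ℕ) c)) h3,
    rlSeries]
  congr 1
  funext n
  rw [tsum_fintype, hc, Finset.sum_mul,
    ← Finset.sum_coe_sort (Finset.HasAntidiagonal.antidiagonal n)]
  refine Fintype.sum_congr _ _ fun p => ?_
  simp only [hF, Finset.HasAntidiagonal.sigmaAntidiagonalEquivProd_apply]
  rw [Finset.HasAntidiagonal.mem_antidiagonal.1 p.2]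

/-! ### Prabhakar kernels and their semigroup law. -/

/-- The coefficients `(γ)_j ω^j / j!` of `(1 - ω X)^{-γ}`. -/
noncomputable def pochCoeff (ω γ : ℝ) (j : ℕ) : ℝ :=
  (ascPochhammer ℝ j).eval γ / (j.factorial : ℝ) * ω ^ j

theorem pochCoeff_zero_right (ω γ : ℝ) : pochCoeff ω γ 0 = 1 := by simp [pochCoeff]

theorem pochCoeff_zero_left (ω : ℝ) (j : ℕ) : pochCoeff ω 0 (j + 1) = 0 := by
  simp [pochCoeff]

/-- On coefficients this is the differential equation (1 - ωX) f' = γω f satisfied by f = (1 -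
ωX)^(-γ). -/
theorem succ_mul_pochCoeff_succ (ω γ : ℝ) (j : ℕ) :
    ((j : ℝ) + 1) * pochCoeff ω γ (j + 1) = (γ + j) * ω * pochCoeff ω γ j := by
  have h2 : (j.factorial : ℝ) ≠ 0 := by positivity
  simp only [pochCoeff, ascPochhammer_succ_eval, Nat.factorial_succ, Nat.cast_mul, Nat.cast_add,
    Nat.cast_one, pow_succ]
  field_simp

theorem expGrowth_pochCoeff (ω γ : ℝ) : ExpGrowth (pochCoeff ω γ) := by
  refine ⟨1, (|γ| + 1) * (|ω| + 1), zero_le_one, by positivity, fun j => ?_⟩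
  rw [one_mul]
  induction j with
  | zero => simp [pochCoeff_zero_right]
  | succ j ih =>
    have h := congrArg abs (succ_mul_pochCoeff_succ ω γ j)
    rw [abs_mul, abs_mul, abs_mul, abs_of_pos (show (0 : ℝ) < j + 1 by positivity)] at h
    have h1 : |γ + j| ≤ ((j : ℝ) + 1) * (|γ| + 1) := by
      refine (abs_add_le _ _).trans ?_
      rw [abs_of_nonneg (show (0 : ℝ) ≤ j by positivity)]
      nlinarith [abs_nonneg γ, (show (0 : ℝ) ≤ j by positivity)]
    refine le_of_mul_le_mul_left ?_ (show (0 : ℝ) < j + 1 by positivity)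
    rw [h, pow_succ]
    calc |γ + j| * |ω| * |pochCoeff ω γ j|
        ≤ (((j : ℝ) + 1) * (|γ| + 1)) * (|ω| + 1) * ((|γ| + 1) * (|ω| + 1)) ^ j := by
          gcongr
          linarith
      _ = _ := by ring

/-- This is (1 - ωX)^(-γ) (1 - ωX)^(-δ) = (1 - ωX)^(-(γ+δ)), a form of Vandermonde's identity. Both
sides satisfy the same first-order recursion: writing n + 1 = p.1 + p.2 in each summand is the
Leibniz rule. -/
theorem pochCoeff_add (ω γ δ : ℝ) (n : ℕ) :
    pochCoeff ω (γ + δ) n =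
      ∑ p ∈ Finset.HasAntidiagonal.antidiagonal n, pochCoeff ω γ p.1 * pochCoeff ω δ p.2 := by
  induction n with
  | zero => simp [pochCoeff_zero_right]
  | succ n ih =>
    have hn : ((n : ℝ) + 1) ≠ 0 := by positivity
    refine mul_left_cancel₀ hn ?_
    rw [succ_mul_pochCoeff_succ, ih, Finset.mul_sum, Finset.mul_sum]
    have h : ∀ p ∈ Finset.HasAntidiagonal.antidiagonal (n + 1),
        ((n : ℝ) + 1) * (pochCoeff ω γ p.1 * pochCoeff ω δ p.2) =
        (p.1 : ℝ) * pochCoeff ω γ p.1 * pochCoeff ω δ p.2 +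
          pochCoeff ω γ p.1 * ((p.2 : ℝ) * pochCoeff ω δ p.2) := by
      intro p hp
      have : (p.1 : ℝ) + p.2 = n + 1 := by exact_mod_cast Finset.HasAntidiagonal.mem_antidiagonal.1 hp
      rw [← this]
      ring
    rw [Finset.sum_congr rfl h, Finset.sum_add_distrib, Finset.Nat.sum_antidiagonal_succ,
      Finset.Nat.sum_antidiagonal_succ']
    simp only [Nat.cast_zero, zero_mul, mul_zero, zero_add, Nat.cast_add, Nat.cast_one]
    rw [← Finset.sum_add_distrib]
    refine Finset.sum_congr rfl fun p hp => ?_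
    rw [succ_mul_pochCoeff_succ, succ_mul_pochCoeff_succ]
    have : (n : ℝ) = (p.1 : ℝ) + p.2 := by exact_mod_cast (Finset.HasAntidiagonal.mem_antidiagonal.1 hp).symm
    rw [this]
    ring

/-- The Prabhakar kernel, extended by zero to `(-∞, 0]`. -/
noncomputable def prabhakarSeries (ρ ω β γ t : ℝ) : ℝ := rlSeries ρ (pochCoeff ω γ) β t

theorem prabhakarKernel_eq_series {ρ : ℝ} (β ω γ : ℝ) {t : ℝ} (ht : 0 < t) :
    prabhakarKernel ρ β ω γ t = prabhakarSeries ρ ω β γ t := by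
  rw [prabhakarKernel, prabhakarML, prabhakarSeries, rlSeries, ← tsum_mul_left]
  congr 1
  funext j
  have : t ^ (ρ * j + β - 1) = t ^ (β - 1) * (t ^ ρ) ^ j := by
    rw [← Real.rpow_natCast (t ^ ρ), ← Real.rpow_mul ht.le, ← Real.rpow_add ht]
    ring_nf
  rw [rlKernel_of_pos ht, this, pochCoeff, mul_pow]
  ring

theorem powBound_prabhakarSeries {ρ ω β : ℝ} (γ : ℝ) (hρ : 0 < ρ) (hβ : 0 < β) :
    PowBound β (prabhakarSeries ρ ω β γ) := (expGrowth_pochCoeff ω γ).powBound hρ hβ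

/-- Formally the Laplace transform of the kernel is s^(-β) (1 - ω s^(-ρ))^(-γ), and both exponents
add under multiplication. On coefficients this is the Cauchy product together with Vandermonde's
identity. -/
theorem hconv_prabhakarSeries {ρ ω α β γ δ : ℝ} (hρ : 0 < ρ) (hα : 0 < α) (hβ : 0 < β) (t : ℝ) :
    hconv (prabhakarSeries ρ ω α γ) (prabhakarSeries ρ ω β δ) t =
      prabhakarSeries ρ ω (α + β) (γ + δ) t :=
  hconv_rlSeries hρ hα hβ (expGrowth_pochCoeff ω γ) (expGrowth_pochCoeff ω δ)
    (pochCoeff_add ω γ δ) t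

theorem prabhakarSeries_zero (ρ ω β t : ℝ) : prabhakarSeries ρ ω β 0 t = rlKernel β t := by
  rw [prabhakarSeries, rlSeries, tsum_eq_single 0]
  · simp [pochCoeff_zero_right]
  · intro j hj
    obtain ⟨k, rfl⟩ := Nat.exists_eq_succ_of_ne_zero hj
    rw [Nat.succ_eq_add_one, pochCoeff_zero_left, zero_mul]

/-- The correction kernel `Q` with `e^γ_μ = k_μ + k_μ * Q`. -/
noncomputable def prabhakarTail (ρ ω γ t : ℝ) : ℝ :=
  rlSeries ρ (fun j => pochCoeff ω γ (j + 1)) ρ t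

theorem expGrowth_succ {a : ℕ → ℝ} (ha : ExpGrowth a) : ExpGrowth fun j => a (j + 1) := by
  obtain ⟨A, R, hA, hR, h⟩ := ha
  exact ⟨A * R, R, by positivity, hR, fun j => (h (j + 1)).trans_eq (by ring)⟩

theorem powBound_prabhakarTail {ρ : ℝ} (ω γ : ℝ) (hρ : 0 < ρ) :
    PowBound ρ (prabhakarTail ρ ω γ) := (expGrowth_succ (expGrowth_pochCoeff ω γ)).powBound hρ hρ

/-- Split off the term j = 0; each later order ρ(j + 1) + μ is (ρj + ρ) + μ, a convolution with k_μ.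
So the kernel is a perturbation of k_μ by a factor of positive order ρ. -/
theorem prabhakarSeries_eq_add_hconv_tail {ρ ω μ : ℝ} (γ : ℝ) (hρ : 0 < ρ) (hμ : 0 < μ) (t : ℝ) :
    prabhakarSeries ρ ω μ γ t = rlKernel μ t + hconv (rlKernel μ) (prabhakarTail ρ ω γ) t := by
  have hs := expGrowth_pochCoeff ω γ
  rw [hconv_comm]
  unfold prabhakarTail
  rw [hconv_rlSeries_rlKernel hρ hρ hμ (expGrowth_succ hs), prabhakarSeries,
    rlSeries, ((hs.summable hρ hμ t).of_norm).tsum_eq_zero_add, rlSeries]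
  simp only [pochCoeff_zero_right, Nat.cast_zero, mul_zero, zero_add, one_mul, Nat.cast_add,
    Nat.cast_one]
  congr 2
  funext j
  congr 2
  ring

/-! ### Convolution powers and Volterra resolvents. -/

/-- `convPow h n` is the `(n+1)`-fold convolution power of `h`. -/
noncomputable def convPow (h : ℝ → ℝ) : ℕ → ℝ → ℝ
  | 0 => h
  | n + 1 => hconv h (convPow h n)

theorem convPow_prabhakarSeries {ρ ω μ γ : ℝ} (hρ : 0 < ρ) (hμ : 0 < μ) (n : ℕ) :
    convPow (prabhakarSeries ρ ω μ γ) n =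
      prabhakarSeries ρ ω (μ * n + μ) (((n + 1 : ℕ) : ℝ) * γ) := by
  induction n with
  | zero => simp [convPow]
  | succ n ih =>
    funext t
    rw [convPow, ih, hconv_prabhakarSeries hρ hμ (by positivity)]
    push_cast
    ring_nf

theorem convPow_rlKernel {μ : ℝ} (hμ : 0 < μ) (n : ℕ) :
    convPow (rlKernel μ) n = rlKernel (μ * n + μ) := by
  induction n with
  | zero => simp [convPow]
  | succ n ih =>
    funext t
    rw [convPow, ih, hconv_rlKernel hμ (by positivity)]
    push_cast
    ring_nf

theorem PowBound.toConvPow {α : ℝ} {h : ℝ → ℝ} (hh : PowBound α h) (hα : 0 < α) (n : ℕ) :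
    PowBound (α * n + α) (convPow h n) := by
  induction n with
  | zero => simpa [convPow] using hh
  | succ n ih =>
    have := hh.toHconv ih hα (by positivity)
    rw [show α * ((n + 1 : ℕ) : ℝ) + α = α + (α * n + α) by push_cast; ring]
    exact this

theorem abs_convPow_le {α b C : ℝ} {h : ℝ → ℝ} (hα : 0 < α) (hb : 0 ≤ b) (hC : 0 ≤ C)
    (hh : ∀ s ≤ b, |h s| ≤ C * rlKernel α s) (n : ℕ) {t : ℝ} (ht : t ≤ b) :
    |convPow h n t| ≤ C ^ (n + 1) * rlKernel (α * n + α) t := by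
  induction n generalizing t with
  | zero => simpa [convPow] using hh t ht
  | succ n ih =>
    have := norm_hconv_le hα (show 0 < α * (n : ℝ) + α by positivity) hh
      (F := convPow h n) (fun s hs => ih hs) hC (by positivity) hb ht
    rw [show α * ((n + 1 : ℕ) : ℝ) + α = α + (α * n + α) by push_cast; ring, pow_succ' C (n + 1)]
    exact this

/-- The `n`-th term of the Neumann series of the resolvent of `L • h`. -/
noncomputable def resolventTerm (h : ℝ → ℝ) (L : ℝ) (n : ℕ) (t : ℝ) : ℝ :=
  (-1) ^ n * L ^ (n + 1) * convPow h n t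

/-- The resolvent kernel `r` of `L • h`: the solution of `r = L h - L (h * r)`. -/
noncomputable def volterraResolvent (h : ℝ → ℝ) (L t : ℝ) : ℝ := ∑' n, resolventTerm h L n t

theorem PowBound.resolventTerm_le {α : ℝ} {h : ℝ → ℝ} (hh : PowBound α h) (hα : 0 < α) (L b : ℝ) :
    ∃ C, 0 ≤ C ∧ ∀ (n : ℕ) (t), t ≤ b →
      |resolventTerm h L n t| ≤ C * rlKernel α t * (1 / 2) ^ n := by
  obtain ⟨C, hC, h1⟩ := hh.bound (max b 0)
  -- The ratio is small enough to absorb (C|L|)^n; the summand 1 keeps the denominator positive when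
  -- C|L| = 0.
  obtain ⟨D, hD, h2⟩ := exists_rlKernel_le_geometric hα hα
    (show 0 < 1 / (2 * (C * |L| + 1)) by positivity) b
  refine ⟨D * (C * |L|), by positivity, fun n t ht => ?_⟩
  have h3 := abs_convPow_le hα (le_max_right b 0) hC h1 n (ht.trans (le_max_left b 0))
  have h4 := h2 n t ht
  have h5 := rlKernel_nonneg hα t
  rw [resolventTerm, abs_mul, abs_mul, abs_pow, abs_pow, abs_neg, abs_one, one_pow, one_mul]
  calc |L| ^ (n + 1) * |convPow h n t|
      ≤ |L| ^ (n + 1) * (C ^ (n + 1) *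
        (D * (1 / (2 * (C * |L| + 1))) ^ n * rlKernel α t)) := by
        refine mul_le_mul_of_nonneg_left (h3.trans ?_) (by positivity)
        gcongr
    _ = D * (C * |L|) * rlKernel α t * ((C * |L|) * (1 / (2 * (C * |L| + 1)))) ^ n := by
        rw [mul_pow, mul_pow, pow_succ, pow_succ]
        ring
    _ ≤ D * (C * |L|) * rlKernel α t * (1 / 2) ^ n := by
        gcongr
        rw [mul_one_div, div_le_div_iff₀ (by positivity) (by positivity)]
        nlinarith [show 0 ≤ C * |L| by positivity]

theorem PowBound.measurable_resolventTerm {α : ℝ} {h : ℝ → ℝ} (hh : PowBound α h) (hα : 0 < α)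
    (L : ℝ) (n : ℕ) : Measurable (resolventTerm h L n) :=
  (hh.toConvPow hα n).meas.measurable.const_mul _

theorem PowBound.summable_resolventTerm {α : ℝ} {h : ℝ → ℝ} (hh : PowBound α h) (hα : 0 < α)
    (L t : ℝ) : Summable fun n => resolventTerm h L n t := by
  obtain ⟨C, hC, h1⟩ := hh.resolventTerm_le hα L t
  exact Summable.of_norm_bounded (summable_half_pow.mul_left _) fun j => h1 j t le_rfl

theorem PowBound.toResolvent {α : ℝ} {h : ℝ → ℝ} (hh : PowBound α h) (hα : 0 < α) (L : ℝ) :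
    PowBound α (volterraResolvent h L) :=
  powBound_tsum (hh.measurable_resolventTerm hα L) (hh.resolventTerm_le hα L)

/-- Measurability jointly in the parameter and in time, as Fubini over time and frequency requires.
-/
theorem PowBound.measurable_resolvent {α : ℝ} {h : ℝ → ℝ} (hh : PowBound α h) (hα : 0 < α) :
    Measurable fun p : ℝ × ℝ => volterraResolvent h p.1 p.2 := by
  refine (stronglyMeasurable_tsum (f := fun n (p : ℝ × ℝ) => resolventTerm h p.1 n p.2)
    (fun n => ?_) (fun p => hh.summable_resolventTerm hα p.1 p.2)).measurable
  exact ((measurable_fst.pow_const _).const_mul _).mul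
    ((hh.toConvPow hα n).meas.measurable.comp measurable_snd)

theorem PowBound.hasSum_resolvent_hconv {α β : ℝ} {h g : ℝ → ℝ} (hh : PowBound α h) (hα : 0 < α)
    (hg : PowBound β g) (hβ : 0 < β) (L t : ℝ) :
    HasSum (fun n => (-1) ^ n * L ^ (n + 1) * hconv g (convPow h n) t)
      (hconv g (volterraResolvent h L) t) := by
  have := hasSum_hconv_left (t := t) (hh.resolventTerm_le hα L)
    (hh.measurable_resolventTerm hα L) hα hβ hg
  simp only [hconv_comm _ g] at this
  have e : ∀ n, hconv g (resolventTerm h L n) t = (-1) ^ n * L ^ (n + 1) * hconv g (convPow h n) t :=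
    fun n => hconv_const_mul_right g _ _ t
  simp only [e] at this
  exact this

theorem PowBound.resolvent_eq {α : ℝ} {h : ℝ → ℝ} (hh : PowBound α h) (hα : 0 < α) (L t : ℝ) :
    volterraResolvent h L t = L * h t - L * hconv h (volterraResolvent h L) t := by
  rw [volterraResolvent, (hh.summable_resolventTerm hα L t).tsum_eq_zero_add,
    ← (hh.hasSum_resolvent_hconv hα hh hα L t).tsum_eq, ← tsum_mul_left, sub_eq_add_neg,
    ← tsum_neg]
  congr 1
  · simp [resolventTerm, convPow]
  · congr 1
    funext n
    simp only [resolventTerm, convPow, pow_succ]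
    ring

/-- The effect on the resolvent of a multiplicative perturbation `h₀ ↦ h₀ + h₀ * Q`. -/
theorem resolvent_perturbation {α β : ℝ} {h h₀ Q : ℝ → ℝ} (hα : 0 < α) (hβ : 0 < β)
    (hh : PowBound α h) (hh₀ : PowBound α h₀) (hQ : PowBound β Q)
    (heq : ∀ t, h t = h₀ t + hconv h₀ Q t) (L t : ℝ) :
    volterraResolvent h L t = volterraResolvent h₀ L t + hconv (volterraResolvent h₀ L) Q t -
      hconv (volterraResolvent h₀ L) (hconv Q (volterraResolvent h L)) t := by
  -- Formally, with the unit δ adjoined, δ - r = (δ + Lh)⁻¹ and δ - r₀ = (δ + Lh₀)⁻¹. As L h₀ * (δ -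
  -- r₀) = r₀, multiplying δ + Lh = δ + Lh₀ + L h₀ * Q by δ - r₀ gives δ + r₀ * Q, so δ - r₀ = (δ +
  -- r₀ * Q) * (δ - r).
  set r := volterraResolvent h L with hr
  set r₀ := volterraResolvent h₀ L with hr₀
  have pr : PowBound α r := hh.toResolvent hα L
  have pr₀ : PowBound α r₀ := hh₀.toResolvent hα L
  have hαβ := add_pos hα hβ
  have hβα := add_pos hβ hα
  set δ := min α β with hδ
  have hδ0 : 0 < δ := lt_min hα hβ
  have pQr : PowBound (β + α) (hconv Q r) := hQ.toHconv pr hβ hα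
  -- δ + S = (δ + Q) * (δ - r), hence r = L h₀ * (δ + S). Computing r₀ * r and r₀ * S from the
  -- equations for r and r₀, the terms with h₀ * r₀ * S cancel.
  set S : ℝ → ℝ := fun s => Q s - r s - hconv Q r s with hS
  have pS : PowBound δ S := ((hQ.mono hδ0 (min_le_right _ _)).sub
    (pr.mono hδ0 (min_le_left _ _))).sub
      (pQr.mono hδ0 ((min_le_left _ _).trans (by linarith)))
  have expand : ∀ {f : ℝ → ℝ}, PowBound α f → ∀ s, hconv f S s =
      hconv f Q s - hconv f r s - hconv f (hconv Q r) s := by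
    intro f hf s
    have h1 := hf.integrable hQ hα hβ s
    have h2 := hf.integrable pr hα hα s
    have h3 := hf.integrable pQr hα hβα s
    rw [hS, hconv_sub_right (F := fun s => Q s - r s) ?_ h3, hconv_sub_right h1 h2]
    simpa only [smul_sub] using! h1.sub h2
  have r_eq : ∀ s, r s = L * h₀ s + L * hconv h₀ S s := by
    intro s
    have e1 : hconv h r s = hconv h₀ r s + hconv h₀ (hconv Q r) s := by
      have : h = fun s => h₀ s + hconv h₀ Q s := funext heq
      rw [hconv_comm h r, this, hconv_add_right (pr.integrable hh₀ hα hα s)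
        (pr.integrable (hh₀.toHconv hQ hα hβ) hα hαβ s), hconv_comm r h₀,
        hconv_comm r (hconv h₀ Q), PowBound.hconv_assoc hα hβ hα hh₀ hQ pr]
    rw [hr, hh.resolvent_eq hα L s, ← hr, e1, heq s, expand hh₀]
    ring
  have r₀_eq : ∀ s, r₀ s = L * h₀ s - L * hconv h₀ r₀ s := fun s => hh₀.resolvent_eq hα L s
  have p1 : PowBound (α + δ) (hconv h₀ S) := hh₀.toHconv pS hα hδ0
  have hαδ := add_pos hα hδ0
  have e2 : hconv r₀ r t = L * hconv h₀ r₀ t + L * hconv (hconv h₀ r₀) S t := by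
    have : r = fun s => L * h₀ s + L * hconv h₀ S s := funext r_eq
    rw [this, hconv_add_right (pr₀.integrable (hh₀.const_mul L) hα hα t)
      (pr₀.integrable (p1.const_mul L) hα hαδ t), hconv_const_mul_right, hconv_const_mul_right,
      PowBound.hconv_assoc hα hα hδ0 pr₀ hh₀ pS, hconv_comm r₀ h₀,
      show hconv r₀ h₀ = hconv h₀ r₀ from funext (hconv_comm r₀ h₀)]
  have p2 : PowBound (α + α) (hconv h₀ r₀) := hh₀.toHconv pr₀ hα hα
  have e3 : hconv r₀ S t = L * hconv h₀ S t - L * hconv (hconv h₀ r₀) S t := by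
    have : r₀ = fun s => L * h₀ s - L * hconv h₀ r₀ s := funext r₀_eq
    rw [hconv_comm]
    conv_lhs => rw [this]
    rw [hconv_sub_right (pS.integrable (hh₀.const_mul L) hδ0 hα t)
      (pS.integrable (p2.const_mul L) hδ0 (add_pos hα hα) t), hconv_const_mul_right,
      hconv_const_mul_right, hconv_comm S h₀, hconv_comm S (hconv h₀ r₀)]
  have e4 := expand pr₀ t
  have e5 := r_eq t
  have e6 := r₀_eq t
  linarith

/-! ### Positivity of the resolvent of the Riemann–Liouville kernel. -/

theorem continuousOn_rlKernel (α : ℝ) : ContinuousOn (rlKernel α) (Ioi 0) := by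
  have : ContinuousOn (fun t : ℝ => t ^ (α - 1) / Real.Gamma α) (Ioi 0) :=
    (continuousOn_id.rpow_const fun x hx => Or.inl (ne_of_gt hx)).div_const _
  exact this.congr fun t ht => rlKernel_of_pos ht

theorem rlKernel_antitone {α s t : ℝ} (hα : 0 < α) (hα1 : α ≤ 1) (hs : 0 < s) (hst : s ≤ t) :
    rlKernel α t ≤ rlKernel α s := by
  rw [rlKernel_of_pos hs, rlKernel_of_pos (hs.trans_le hst)]
  have := Real.rpow_le_rpow_of_nonpos hs hst (show α - 1 ≤ 0 by linarith)
  have := Real.Gamma_pos_of_pos hα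
  gcongr

/-- The Neumann series converges uniformly away from 0: k_μ is decreasing for μ ≤ 1, so its value at
t/2 majorises on a neighbourhood of t. -/
theorem continuousOn_resolvent_rlKernel {μ : ℝ} (hμ : 0 < μ) (hμ1 : μ ≤ 1) (L : ℝ) :
    ContinuousOn (volterraResolvent (rlKernel μ) L) (Ioi 0) := by
  intro t ht
  have ht0 : 0 < t := ht
  obtain ⟨C, hC, h⟩ := (powBound_rlKernel hμ).resolventTerm_le hμ L (t + 1)
  have hc : ContinuousOn (volterraResolvent (rlKernel μ) L) (Ioo (t / 2) (t + 1)) := by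
    refine continuousOn_tsum (u := fun n => C * rlKernel μ (t / 2) * (1 / 2) ^ n) (fun n => ?_)
      (summable_half_pow.mul_left _) (fun n s hs => ?_)
    · have h1 : Ioo (t / 2) (t + 1) ⊆ Ioi 0 := fun s hs => (half_pos ht0).trans hs.1
      unfold resolventTerm
      rw [convPow_rlKernel hμ]
      exact ((continuousOn_rlKernel _).mono h1).const_mul _
    · refine (h n s hs.2.le).trans ?_
      have := rlKernel_antitone hμ hμ1 (half_pos ht0) hs.1.le
      gcongr
  exact (hc.continuousAt (Ioo_mem_nhds (by linarith) (by linarith))).continuousWithinAt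

/-- In r = L (k_μ - k_μ * r) the convolution is O(t^(2μ-1)), negligible against k_μ as t → 0. -/
theorem exists_resolvent_rlKernel_pos {μ L : ℝ} (hμ : 0 < μ) (hL : 0 < L) :
    ∃ δ > 0, ∀ t, 0 < t → t < δ → 0 < volterraResolvent (rlKernel μ) L t := by
  have ph := powBound_rlKernel hμ
  obtain ⟨C, hC, h⟩ := (ph.toResolvent hμ L).bound 1
  have hG := Real.Gamma_pos_of_pos hμ
  have hG2 := Real.Gamma_pos_of_pos (add_pos hμ hμ)
  have hlim : Tendsto (fun t : ℝ => C * (t ^ μ / Real.Gamma (μ + μ))) (𝓝[>] 0) (𝓝 0) := by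
    have : Tendsto (fun t : ℝ => t ^ μ) (𝓝 0) (𝓝 0) := by
      simpa [Real.zero_rpow hμ.ne'] using
        (Real.continuousAt_rpow_const 0 μ (Or.inr hμ.le)).tendsto
    simpa using ((this.div_const (Real.Gamma (μ + μ))).const_mul C).mono_left
      nhdsWithin_le_nhds
  have hev := hlim.eventually (gt_mem_nhds (show 0 < 1 / Real.Gamma μ by positivity))
  obtain ⟨δ, hδ, hδ'⟩ := mem_nhdsGT_iff_exists_Ioo_subset.1 hev
  refine ⟨min δ 1, lt_min hδ one_pos, fun t ht htδ => ?_⟩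
  have h1 : C * (t ^ μ / Real.Gamma (μ + μ)) < 1 / Real.Gamma μ :=
    hδ' ⟨ht, htδ.trans_le (min_le_left _ _)⟩
  have h2 := norm_hconv_le hμ hμ (f := rlKernel μ) (F := volterraResolvent (rlKernel μ) L) (b := 1)
    (C := 1) (fun s _ => by rw [abs_of_nonneg (rlKernel_nonneg hμ s), one_mul]) h zero_le_one hC
    zero_le_one (htδ.le.trans (min_le_right _ _))
  rw [Real.norm_eq_abs, one_mul, rlKernel_of_pos ht] at h2
  have h3 := (le_abs_self _).trans h2
  rw [ph.resolvent_eq hμ, ← mul_sub]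
  refine mul_pos hL (sub_pos.2 (h3.trans_lt ?_))
  rw [rlKernel_of_pos ht, show μ + μ - 1 = μ + (μ - 1) by ring, Real.rpow_add ht]
  have h4 := Real.rpow_pos_of_pos ht (μ - 1)
  calc C * (t ^ μ * t ^ (μ - 1) / Real.Gamma (μ + μ))
      = C * (t ^ μ / Real.Gamma (μ + μ)) * t ^ (μ - 1) := by ring
    _ < 1 / Real.Gamma μ * t ^ (μ - 1) := by gcongr
    _ = _ := by ring

theorem integral_rlKernel_sub {μ : ℝ} (hμ : 0 < μ) {t T : ℝ} (htT : t ≤ T) :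
    ∫ s in Ioc t T, rlKernel μ (T - s) = rlKernel (1 + μ) (T - t) := by
  rw [← hconv_rlKernel one_pos hμ, hconv_one_eq (fun s hs => rlKernel_of_nonpos hs),
    ← intervalIntegral.integral_of_le htT, intervalIntegral.integral_comp_sub_left, sub_self,
    intervalIntegral.integral_of_le (by linarith)]

/-- Log-convexity of `rlKernel μ`, `μ ≤ 1`. -/
theorem rlKernel_sub_mul_le {μ s t T : ℝ} (hμ : 0 < μ) (hμ1 : μ ≤ 1) (hs : 0 ≤ s) (hst : s < t)
    (htT : t ≤ T) :
    rlKernel μ (T - s) * rlKernel μ t ≤ rlKernel μ T * rlKernel μ (t - s) := by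
  have ht : 0 < t := hs.trans_lt hst
  have hG := Real.Gamma_pos_of_pos hμ
  rw [rlKernel_of_pos (by linarith), rlKernel_of_pos ht, rlKernel_of_pos (by linarith),
    rlKernel_of_pos (by linarith), div_mul_div_comm, div_mul_div_comm,
    ← Real.mul_rpow (by linarith) (by linarith), ← Real.mul_rpow (by linarith) (by linarith)]
  gcongr ?_ / _
  -- The exponent μ - 1 is nonpositive, so the claim reduces to T(t - s) ≤ (T - s)t, that is s(T -
  -- t) ≥ 0.
  refine Real.rpow_le_rpow_of_nonpos (by nlinarith) ?_ (by linarith)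
  nlinarith

/-- The resolvent of the (log-convex) Riemann–Liouville kernel is positive. -/
theorem resolvent_rlKernel_pos {μ L : ℝ} (hμ : 0 < μ) (hμ1 : μ ≤ 1) (hL : 0 < L) {t : ℝ}
    (ht : 0 < t) : 0 < volterraResolvent (rlKernel μ) L t := by
  -- Let T be the first point where r ≤ 0; the resolvent equation there gives h(T) ≤ (h * r)(T).
  -- Compare with an earlier τ close to T. Log-convexity bounds the part of (h * r)(T) over (0, τ)
  -- by (h(T)/h(τ)) (h * r)(τ), and the resolvent equation at τ evaluates this. What is left must be
  -- made up on (τ, T), where the kernel has too little mass.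
  by_contra hneg
  set h := rlKernel μ with hh
  set r := volterraResolvent h L with hr
  have ph : PowBound μ h := powBound_rlKernel hμ
  have pr : PowBound μ r := ph.toResolvent hμ L
  have hcont : ContinuousOn r (Ioi 0) := continuousOn_resolvent_rlKernel hμ hμ1 L
  obtain ⟨δ, hδ, hpos⟩ := exists_resolvent_rlKernel_pos hμ hL
  set S := {s : ℝ | 0 < s ∧ r s ≤ 0} with hS
  have hne : S.Nonempty := ⟨t, ht, not_lt.1 hneg⟩
  have hlow : ∀ s ∈ S, δ ≤ s := fun s hs => by
    by_contra hlt
    exact (hpos s hs.1 (not_le.1 hlt)).not_ge hs.2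
  have hbdd : BddBelow S := ⟨δ, hlow⟩
  set T := sInf S with hT
  have hT0 : 0 < T := hδ.trans_le (le_csInf hne hlow)
  have hrpos : ∀ s, 0 < s → s < T → 0 < r s := fun s hs hsT => by
    by_contra hle
    exact (csInf_le hbdd ⟨hs, not_lt.1 hle⟩).not_gt hsT
  have hrT : r T ≤ 0 := by
    by_contra hlt
    have hev := (hcont.continuousAt (Ioi_mem_nhds hT0)).eventually (lt_mem_nhds (not_le.1 hlt))
    obtain ⟨ε, hε, hball⟩ := Metric.eventually_nhds_iff.1 hev
    obtain ⟨s, hs, hsT⟩ := exists_lt_of_csInf_lt hne (show sInf S < T + ε by linarith)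
    refine (hball ?_).not_ge hs.2
    rw [Real.dist_eq, abs_lt]
    have := csInf_le hbdd hs
    constructor <;> linarith
  have hh0 : ∀ s, 0 ≤ h s := rlKernel_nonneg hμ
  have hhT : 0 < h T := rlKernel_pos hμ hT0
  -- a left neighbourhood of `T` on which the kernel has little mass
  obtain ⟨η, hη, hηT, hsmall⟩ : ∃ η, 0 < η ∧ η < T / 2 ∧ ∀ s, 0 < s → s ≤ η →
      L * h (T / 2) * rlKernel (1 + μ) s < h T := by
    have hlim : Tendsto (fun s : ℝ => L * h (T / 2) * (s ^ μ / Real.Gamma (1 + μ)))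
        (𝓝[>] 0) (𝓝 0) := by
      have : Tendsto (fun t : ℝ => t ^ μ) (𝓝 0) (𝓝 0) := by
        simpa [Real.zero_rpow hμ.ne'] using
          (Real.continuousAt_rpow_const 0 μ (Or.inr hμ.le)).tendsto
      simpa using ((this.div_const (Real.Gamma (1 + μ))).const_mul (L * h (T / 2))).mono_left
        nhdsWithin_le_nhds
    obtain ⟨η, hη, hη'⟩ := mem_nhdsGT_iff_exists_Ioo_subset.1
      (hlim.eventually (gt_mem_nhds hhT))
    have hη0 : 0 < η := hη
    refine ⟨min (η / 2) (T / 4), by positivity, ?_, fun s hs hsη => ?_⟩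
    · exact (min_le_right _ _).trans_lt (by linarith)
    · rw [rlKernel_of_pos hs, add_sub_cancel_left]
      refine hη' ⟨hs, ?_⟩
      have := hsη.trans (min_le_left _ _)
      linarith
  -- Taking τ to be a maximum point of r on [T - η, T] bounds r on (τ, T) by r(τ), which then
  -- cancels from the final inequality; τ < T because r(T) ≤ 0 < r(T - η).
  obtain ⟨τ, hτ, hmax⟩ := isCompact_Icc.exists_isMaxOn (nonempty_Icc.2 (show T - η ≤ T by linarith))
    (hcont.mono fun s hs => lt_of_lt_of_le (show 0 < T - η by linarith) hs.1)
  have hτ0 : 0 < τ := by linarith [hτ.1]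
  have hr1 : 0 < r (T - η) := hrpos _ (by linarith) (by linarith)
  have hτr : 0 < r τ := hr1.trans_le (hmax ⟨le_rfl, by linarith⟩)
  have hτT : τ < T := lt_of_le_of_ne hτ.2 fun he => by
    rw [he] at hτr
    exact hτr.not_ge hrT
  have hhτ : 0 < h τ := rlKernel_pos hμ hτ0
  have eT := ph.resolvent_eq hμ L T
  have eτ := ph.resolvent_eq hμ L τ
  rw [← hr] at eT eτ
  have hconvT := hconv_eq_integral (fun s => ph.eq_zero) (fun s => pr.eq_zero) T
  have hconvτ := hconv_eq_integral (fun s => ph.eq_zero) (fun s => pr.eq_zero) τ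
  have hiT : IntegrableOn (fun y => h (T - y) • r y) (Ioc 0 T) :=
    (ph.integrable pr hμ hμ T).integrableOn
  have hiτ : IntegrableOn (fun y => h (τ - y) • r y) (Ioc 0 τ) :=
    (ph.integrable pr hμ hμ τ).integrableOn
  rw [← Ioc_union_Ioc_eq_Ioc hτ0.le hτT.le, setIntegral_union (Ioc_disjoint_Ioc_of_le le_rfl)
    measurableSet_Ioc (hiT.mono_set (Ioc_subset_Ioc_right hτT.le))
    (hiT.mono_set (Ioc_subset_Ioc_left hτ0.le))] at hconvT
  have hA : h τ * ∫ y in Ioc 0 τ, h (T - y) • r y ≤ h T * hconv h r τ := by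
    rw [hconvτ, ← integral_const_mul, ← integral_const_mul, integral_Ioc_eq_integral_Ioo,
      integral_Ioc_eq_integral_Ioo]
    refine setIntegral_mono_on ?_ ?_ measurableSet_Ioo fun y hy => ?_
    · exact ((hiT.mono_set (Ioc_subset_Ioc_right hτT.le)).mono_set Ioo_subset_Ioc_self).const_mul _
    · exact (hiτ.mono_set Ioo_subset_Ioc_self).const_mul _
    · have h1 := rlKernel_sub_mul_le hμ hμ1 hy.1.le hy.2 hτT.le
      have h2 := (hrpos y hy.1 (hy.2.trans hτT)).le
      simp only [smul_eq_mul, ← mul_assoc]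
      refine mul_le_mul_of_nonneg_right ?_ h2
      rw [mul_comm (h τ)]
      exact h1
  have hB : ∫ y in Ioc τ T, h (T - y) • r y ≤ r τ * rlKernel (1 + μ) (T - τ) := by
    rw [← integral_rlKernel_sub hμ hτT.le, ← integral_const_mul]
    refine setIntegral_mono_on (hiT.mono_set (Ioc_subset_Ioc_left hτ0.le)) ?_ measurableSet_Ioc
      fun y hy => ?_
    · refine Integrable.const_mul ?_ _
      have : IntegrableOn (fun y => rlKernel 1 y * h (T - y)) (Ioc τ T) := by
        simpa only [mul_comm] using! (integrable_rlKernel_mul hμ one_pos T).integrableOn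
      refine this.congr_fun (fun y hy => ?_) measurableSet_Ioc
      simp only [rlKernel_one (hτ0.trans hy.1), one_mul]
      rfl
    · rw [smul_eq_mul, mul_comm]
      exact mul_le_mul_of_nonneg_right (hmax ⟨hτ.1.trans hy.1.le, hy.2⟩) (hh0 _)
  have h5 : h T ≤ hconv h r T := by
    have : L * (h T - hconv h r T) ≤ 0 := by linarith
    have := nonpos_of_mul_nonpos_right this hL
    linarith
  have h6 := hsmall (T - τ) (by linarith) (by linarith [hτ.1])
  have h7 : h τ ≤ h (T / 2) := rlKernel_antitone hμ hμ1 (by linarith) (by linarith [hτ.1])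
  have h8 : 0 ≤ rlKernel (1 + μ) (T - τ) := rlKernel_nonneg (by linarith) _
  have h9 : L * hconv h r τ = L * h τ - r τ := by linarith
  have h10 : L * (h τ * h T) ≤ h T * (L * h τ - r τ) +
      L * h τ * (r τ * rlKernel (1 + μ) (T - τ)) := by
    rw [← h9]
    have := mul_le_mul_of_nonneg_left h5 hhτ.le
    rw [hconvT, mul_add] at this
    have h11 := mul_le_mul_of_nonneg_left hB hhτ.le
    have h12 : h τ * h T ≤ h T * hconv h r τ + h τ * (r τ * rlKernel (1 + μ) (T - τ)) := by
      linarith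
    have := mul_le_mul_of_nonneg_left h12 hL.le
    linarith
  have h13 : h T * r τ ≤ L * h (T / 2) * rlKernel (1 + μ) (T - τ) * r τ := by
    have : L * h τ * (r τ * rlKernel (1 + μ) (T - τ)) ≤
        L * h (T / 2) * (r τ * rlKernel (1 + μ) (T - τ)) := by gcongr
    linarith
  exact (le_of_mul_le_mul_right h13 hτr).not_gt h6

theorem resolvent_zero (h : ℝ → ℝ) (t : ℝ) : volterraResolvent h 0 t = 0 := by
  simp [volterraResolvent, resolventTerm]

theorem resolvent_rlKernel_nonneg {μ L : ℝ} (hμ : 0 < μ) (hμ1 : μ ≤ 1) (hL : 0 ≤ L) (t : ℝ) :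
    0 ≤ volterraResolvent (rlKernel μ) L t := by
  rcases hL.eq_or_lt with rfl | hL
  · rw [resolvent_zero]
  rcases lt_or_ge 0 t with ht | ht
  · exact (resolvent_rlKernel_pos hμ hμ1 hL ht).le
  · exact (((powBound_rlKernel hμ).toResolvent hμ L).eq_zero ht).ge

/-! ### A Gronwall inequality and resolvent bounds uniform in the frequency. -/

theorem expGrowth_pow {c : ℝ} (hc : 0 ≤ c) : ExpGrowth fun j => c ^ j :=
  ⟨1, c + 1, zero_le_one, by positivity, fun j => by
    rw [one_mul, abs_of_nonneg (by positivity)]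
    exact pow_le_pow_left₀ hc (by linarith) j⟩

/-- A Gronwall inequality for weakly singular kernels. -/
theorem volterra_gronwall {ρ β b A C : ℝ} (hρ : 0 < ρ) (hβ : 0 < β) (hA : 0 ≤ A)
    (hC : 0 ≤ C) {G : ℝ → ℝ} (hG : PowBound β G)
    (h : ∀ t ≤ b, G t ≤ A * rlKernel β t + C * hconv (rlKernel ρ) G t) {t : ℝ} (ht : t ≤ b) :
    G t ≤ A * rlSeries ρ (fun j => C ^ j) β t := by
  set S := rlSeries ρ (fun j => C ^ j) β with hS
  have hg := expGrowth_pow hC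
  have pS : PowBound β S := hg.powBound hρ hβ
  have pk := powBound_rlKernel hρ
  have hS0 : ∀ s, 0 ≤ S s := fun s => tsum_nonneg fun j =>
    mul_nonneg (by positivity) (rlKernel_nonneg (by positivity) s)
  have hSeq : ∀ s, S s = rlKernel β s + C * hconv (rlKernel ρ) S s := fun s => by
    rw [hconv_comm, hconv_rlSeries_rlKernel hρ hβ hρ hg, hS, rlSeries,
      ((hg.summable hρ hβ s).of_norm).tsum_eq_zero_add, rlSeries, ← tsum_mul_left]
    simp only [pow_zero, Nat.cast_zero, mul_zero, zero_add, one_mul]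
    congr 2
    funext j
    rw [pow_succ', mul_assoc]
    congr 3
    push_cast
    ring
  obtain ⟨M, hM, hGM⟩ := hG.bound b
  -- `S` solves the equality case, so each substitution reproduces A S. The crude bound M k_β for
  -- `G` survives only in the remainder, of order ρN + β, which tends to 0.
  have key : ∀ N : ℕ, ∀ s ≤ b, G s ≤ A * S s + C ^ N * M * rlKernel (ρ * N + β) s := by
    intro N
    induction N with
    | zero =>
      intro s hs
      have h1 := (le_abs_self _).trans (hGM s hs)
      simp only [pow_zero, one_mul, Nat.cast_zero, mul_zero, zero_add]
      have := mul_nonneg hA (hS0 s)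
      linarith
    | succ N ih =>
      intro s hs
      have hN : 0 < ρ * (N : ℝ) + β := by positivity
      have pN := (powBound_rlKernel hN).const_mul (C ^ N * M)
      have hm : hconv (rlKernel ρ) G s ≤
          A * hconv (rlKernel ρ) S s + C ^ N * M * rlKernel (ρ * (N + 1 : ℕ) + β) s := by
        have i1 := pk.integrable (pS.const_mul A) hρ hβ s
        have i2 := pk.integrable pN hρ hN s
        have := hconv_mono (t := s) (rlKernel_nonneg hρ) (pk.integrable hG hρ hβ s)
          (by simpa only [smul_add] using! i1.add i2) (fun u hu => ih u (hu.le.trans hs))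
          (fun u hu => rlKernel_of_nonpos hu)
        rw [hconv_add_right i1 i2, hconv_const_mul_right, hconv_const_mul_right,
          hconv_rlKernel hρ hN] at this
        rwa [show ρ * ((N + 1 : ℕ) : ℝ) + β = ρ + (ρ * N + β) by push_cast; ring]
      have := mul_le_mul_of_nonneg_left hm hC
      have h2 := h s hs
      rw [hSeq s, pow_succ']
      linarith
  obtain ⟨D, hD, hgeo⟩ := exists_rlKernel_le_geometric hρ hβ
    (show 0 < 1 / (2 * (C + 1)) by positivity) b
  have hlim : Tendsto (fun N : ℕ => A * S t + M * D * rlKernel β t * (1 / 2) ^ N) atTop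
      (𝓝 (A * S t)) := by
    simpa using ((tendsto_pow_atTop_nhds_zero_of_lt_one (show (0 : ℝ) ≤ 1 / 2 by norm_num)
      (by norm_num)).const_mul (M * D * rlKernel β t)).const_add (A * S t)
  refine ge_of_tendsto' hlim fun N => (key N t ht).trans ?_
  have hk := rlKernel_nonneg hβ t
  refine add_le_add le_rfl ?_
  calc C ^ N * M * rlKernel (ρ * N + β) t
      ≤ C ^ N * M * (D * (1 / (2 * (C + 1))) ^ N * rlKernel β t) := by
        gcongr
        exact hgeo N t ht
    _ = M * D * rlKernel β t * (C * (1 / (2 * (C + 1)))) ^ N := by rw [mul_pow]; ring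
    _ ≤ _ := by
        gcongr
        rw [mul_one_div, div_le_div_iff₀ (by positivity) (by positivity)]
        linarith

/-- Convolve the resolvent equation with k and use k * h = 1. The factor 1 - 1 * r is the relaxation
function of the mode with parameter L. -/
theorem hconv_resolvent_of_dual {α β : ℝ} (hα : 0 < α) (hβ : 0 < β) {h k : ℝ → ℝ}
    (hh : PowBound α h) (hk : PowBound β k) (hkh : ∀ t, hconv k h t = rlKernel 1 t) (L t : ℝ) :
    hconv k (volterraResolvent h L) t =
      L * (rlKernel 1 t - hconv (rlKernel 1) (volterraResolvent h L) t) := by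
  have pr := hh.toResolvent hα L
  have phr : PowBound (α + α) (hconv h (volterraResolvent h L)) := hh.toHconv pr hα hα
  have e : volterraResolvent h L =
      fun s => L * h s - L * hconv h (volterraResolvent h L) s := funext (hh.resolvent_eq hα L)
  conv_lhs => rw [e]
  rw [hconv_sub_right (hk.integrable (hh.const_mul L) hβ hα t)
    (hk.integrable (phr.const_mul L) hβ (add_pos hα hα) t), hconv_const_mul_right,
    hconv_const_mul_right, hkh, PowBound.hconv_assoc hβ hα hα hk hh pr,
    show hconv k h = rlKernel 1 from funext hkh, mul_sub]

/-- A bound for `k_{1-μ} * r` that is uniform in `L`, for the unperturbed kernel. -/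
theorem hconv_resolvent_rlKernel_le {μ L : ℝ} (hμ : 0 < μ) (hμ1 : μ < 1) (hL : 0 ≤ L) (t : ℝ) :
    hconv (rlKernel (1 - μ)) (volterraResolvent (rlKernel μ) L) t ≤
      Real.Gamma (μ + 1) * Real.Gamma (1 - μ) * rlKernel (1 - μ) t := by
  have hμ' : 0 < 1 - μ := by linarith
  rcases le_or_gt t 0 with ht | ht
  · rw [((powBound_rlKernel hμ').toHconv ((powBound_rlKernel hμ).toResolvent hμ L) hμ' hμ).eq_zero
      ht, rlKernel_of_nonpos ht, mul_zero]
  set r := volterraResolvent (rlKernel μ) L with hr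
  have pr : PowBound μ r := (powBound_rlKernel hμ).toResolvent hμ L
  have hr0 : ∀ s, 0 ≤ r s := resolvent_rlKernel_nonneg hμ hμ1.le hL
  set P := hconv (rlKernel (1 - μ)) r with hP
  have pP : PowBound (1 - μ + μ) P := (powBound_rlKernel hμ').toHconv pr hμ' hμ
  have hμμ : 0 < 1 - μ + μ := by linarith
  have hP0 : ∀ s, 0 ≤ P s := hconv_nonneg (rlKernel_nonneg hμ') hr0
  have hdual : ∀ s, P s = L * (rlKernel 1 s - hconv (rlKernel 1) r s) :=
    hconv_resolvent_of_dual hμ hμ' (powBound_rlKernel hμ) (powBound_rlKernel hμ')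
      (fun s => by rw [hconv_rlKernel hμ' hμ, sub_add_cancel]) L
  -- P = L (1 - 1 * r) is nonincreasing because r ≥ 0. Hence P(t) k_{μ+1}(t) = P(t) (k_μ * 1)(t) ≤
  -- (k_μ * P)(t) = (1 * r)(t), and this is at most 1 because P ≥ 0 (for L = 0, P itself is 0). No L
  -- is left in the bound.
  have hanti : ∀ s, 0 < s → s ≤ t → P t ≤ P s := fun s hs hst => by
    rw [hdual, hdual, rlKernel_one ht, rlKernel_one hs]
    refine mul_le_mul_of_nonneg_left (sub_le_sub_left ?_ _) hL
    rw [hconv_one_eq (fun _ => pr.eq_zero), hconv_one_eq (fun _ => pr.eq_zero)]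
    exact setIntegral_mono_set ((pr.integrableOn hμ t).mono_set Ioc_subset_Iic_self)
      (Eventually.of_forall hr0) (Ioc_subset_Ioc_right hst).eventuallyLE
  have h1 : hconv (rlKernel μ) P t = hconv (rlKernel 1) r t := by
    rw [hP, PowBound.hconv_assoc hμ hμ' hμ (powBound_rlKernel hμ) (powBound_rlKernel hμ') pr,
      show hconv (rlKernel μ) (rlKernel (1 - μ)) = rlKernel 1 from funext fun s => by
        rw [hconv_rlKernel hμ hμ', add_sub_cancel]]
  have h2 : P t * rlKernel (μ + 1) t ≤ hconv (rlKernel μ) P t := by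
    rw [← hconv_rlKernel hμ one_pos, ← hconv_const_mul_right]
    refine hconv_mono (rlKernel_nonneg hμ)
      ((powBound_rlKernel hμ).integrable ((powBound_rlKernel one_pos).const_mul _) hμ one_pos t)
      ((powBound_rlKernel hμ).integrable pP hμ hμμ t) (fun s hs => ?_)
      (fun s hs => rlKernel_of_nonpos hs)
    rcases le_or_gt s 0 with h0 | h0
    · rw [rlKernel_of_nonpos h0, mul_zero]
      exact hP0 s
    · rw [rlKernel_one h0, mul_one]
      exact hanti s h0 hs.le
  have h3 : P t * rlKernel (μ + 1) t ≤ 1 := by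
    rcases hL.eq_or_lt with h0 | h0
    · rw [hdual, ← h0, zero_mul, zero_mul]
      exact zero_le_one
    · have := hP0 t
      rw [hdual, rlKernel_one ht] at this
      have := nonneg_of_mul_nonneg_right this h0
      rw [h1] at h2
      linarith
  have hG1 := Real.Gamma_pos_of_pos (show 0 < μ + 1 by linarith)
  have hG2 := Real.Gamma_pos_of_pos hμ'
  have hx := Real.rpow_pos_of_pos ht μ
  rw [rlKernel_of_pos ht, add_sub_cancel_right] at h3
  rw [rlKernel_of_pos ht, show 1 - μ - 1 = -μ by ring, Real.rpow_neg ht.le]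
  have h4 : P t * (t ^ μ / Real.Gamma (μ + 1)) * (Real.Gamma (μ + 1) * (t ^ μ)⁻¹) = P t := by
    field_simp
  rw [← h4]
  calc _ ≤ 1 * (Real.Gamma (μ + 1) * (t ^ μ)⁻¹) := by gcongr
    _ = _ := by field_simp

/-- A bound for `k_{1-μ} * |r|` that is uniform in `L`, for the Prabhakar kernel. -/
theorem exists_hconv_abs_resolvent_le {ρ μ : ℝ} (ω γ : ℝ) (hρ : 0 < ρ) (hμ : 0 < μ)
    (hμ1 : μ < 1) (b : ℝ) : ∃ D, 0 ≤ D ∧ ∀ L, 0 ≤ L → ∀ t ≤ b,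
      hconv (rlKernel (1 - μ)) (fun s => |volterraResolvent (prabhakarSeries ρ ω μ γ) L s|) t ≤
        D * rlKernel (1 - μ) t := by
  wlog hb : 0 ≤ b generalizing b
  · obtain ⟨D, hD, h⟩ := this 0 le_rfl
    exact ⟨D, hD, fun L hL t ht => h L hL t (by linarith)⟩
  have hμ' : 0 < 1 - μ := by linarith
  set k₀ := rlKernel (1 - μ) with hk₀
  set Q := prabhakarTail ρ ω γ with hQ
  set C₀ := Real.Gamma (μ + 1) * Real.Gamma (1 - μ) with hC₀
  have hC₀0 : 0 ≤ C₀ := mul_nonneg (Real.Gamma_pos_of_pos (by linarith)).le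
    (Real.Gamma_pos_of_pos hμ').le
  have pQ : PowBound ρ Q := powBound_prabhakarTail ω γ hρ
  have pk : PowBound (1 - μ) k₀ := powBound_rlKernel hμ'
  have hk0 : ∀ s, 0 ≤ k₀ s := rlKernel_nonneg hμ'
  obtain ⟨Cq, hCq, hQb⟩ := pQ.bound b
  obtain ⟨C₁, hC₁, hkb⟩ := rlKernel_le_mul hμ' (show 1 - μ ≤ 1 - μ + ρ by linarith) b
  set A := C₀ + C₀ * (Cq * C₁) with hA
  set C := C₀ * Cq with hC
  have hA0 : 0 ≤ A := by positivity
  have hC0 : 0 ≤ C := by positivity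
  obtain ⟨D, hD, hDb⟩ := ((expGrowth_pow hC0).powBound hρ hμ').bound b
  refine ⟨A * D, by positivity, fun L hL t ht => ?_⟩
  set r := volterraResolvent (prabhakarSeries ρ ω μ γ) L with hr
  set r₀ := volterraResolvent (rlKernel μ) L with hr₀
  have ph := powBound_prabhakarSeries (ω := ω) γ hρ hμ
  have pr : PowBound μ r := ph.toResolvent hμ L
  have pr₀ : PowBound μ r₀ := (powBound_rlKernel hμ).toResolvent hμ L
  have hr₀0 : ∀ s, 0 ≤ r₀ s := resolvent_rlKernel_nonneg hμ hμ1.le hL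
  have hρμ := add_pos hρ hμ
  have hμρ := add_pos hμ hρ
  have hk₀μ := add_pos hμ' hμ
  have hk₀ρ := add_pos hμ' hρ
  have hμρμ := add_pos hμ hρμ
  have pQr : PowBound (ρ + μ) (hconv (fun s => |Q s|) (fun s => |r s|)) :=
    pQ.abs.toHconv pr.abs hρ hμ
  have pQr' : PowBound (ρ + μ) (hconv Q r) := pQ.toHconv pr hρ hμ
  have hQr0 : ∀ s, 0 ≤ hconv (fun s => |Q s|) (fun s => |r s|) s :=
    hconv_nonneg (fun _ => abs_nonneg _) (fun _ => abs_nonneg _)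
  -- Convolve |r| ≤ r₀ + r₀ * |Q| + r₀ * |Q| * |r| with k₀. In each term k₀ * r₀ ≤ C₀ k₀, and the
  -- last term becomes C₀ |Q| * G with |Q| ≤ Cq k_ρ. So G ≤ A k₀ + C k_ρ * G with A and C
  -- independent of L, which calls for Gronwall.
  set G := hconv k₀ (fun s => |r s|) with hG
  have pG : PowBound (1 - μ + μ) G := pk.toHconv pr.abs hμ' hμ
  have pG' : PowBound (1 - μ) G := pG.mono hμ' (by linarith)
  have hG0 : ∀ s, 0 ≤ G s := hconv_nonneg hk0 fun _ => abs_nonneg _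
  have p₁ : PowBound (μ + ρ) (hconv r₀ (fun s => |Q s|)) := pr₀.toHconv pQ.abs hμ hρ
  have p₂ : PowBound (μ + (ρ + μ)) (hconv r₀ (hconv (fun s => |Q s|) (fun s => |r s|))) :=
    pr₀.toHconv pQr hμ hρμ
  have habs : ∀ s, |r s| ≤ r₀ s + hconv r₀ (fun s => |Q s|) s +
      hconv r₀ (hconv (fun s => |Q s|) (fun s => |r s|)) s := by
    intro s
    rw [hr, resolvent_perturbation hμ hρ ph (powBound_rlKernel hμ) pQ
      (prabhakarSeries_eq_add_hconv_tail γ hρ hμ) L s, ← hr, ← hr₀]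
    have e1 := norm_hconv_le_hconv r₀ Q s
    have e2 := norm_hconv_le_hconv r₀ (hconv Q r) s
    have e3 : hconv r₀ (fun u => ‖hconv Q r u‖) s ≤
        hconv r₀ (hconv (fun s => |Q s|) (fun s => |r s|)) s :=
      hconv_mono hr₀0 (pr₀.integrable pQr'.norm hμ hρμ s) (pr₀.integrable pQr hμ hρμ s)
        (fun u _ => norm_hconv_le_hconv Q r u) (fun u hu => pr₀.eq_zero hu)
    have e0 : (fun s => |r₀ s|) = r₀ := funext fun s => abs_of_nonneg (hr₀0 s)
    rw [e0] at e1 e2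
    simp only [Real.norm_eq_abs] at e1 e2 e3
    have e4 := abs_sub (r₀ s + hconv r₀ Q s) (hconv r₀ (hconv Q r) s)
    have e5 := abs_add_le (r₀ s) (hconv r₀ Q s)
    rw [abs_of_nonneg (hr₀0 s)] at e5
    linarith
  have hkr₀ : ∀ s, hconv k₀ r₀ s ≤ C₀ * k₀ s := hconv_resolvent_rlKernel_le hμ hμ1 hL
  have left : ∀ {α : ℝ} {g : ℝ → ℝ}, 0 < α → PowBound α g → (∀ s, 0 ≤ g s) → ∀ s,
      hconv k₀ (hconv r₀ g) s ≤ C₀ * hconv k₀ g s := by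
    intro α g hα pg hg s
    rw [PowBound.hconv_assoc hμ' hμ hα pk pr₀ pg, hconv_comm, hconv_comm k₀ g,
      ← hconv_const_mul_right]
    exact hconv_mono hg (pg.integrable (pk.toHconv pr₀ hμ' hμ) hα hk₀μ s)
      (pg.integrable (pk.const_mul C₀) hα hμ' s) (fun u _ => hkr₀ u) (fun u hu => pg.eq_zero hu)
  have hineq : ∀ s ≤ b, G s ≤ A * k₀ s + C * hconv (rlKernel ρ) G s := by
    intro s hs
    have i0 := pk.integrable pr₀ hμ' hμ s
    have i1 := pk.integrable p₁ hμ' hμρ s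
    have i2 := pk.integrable p₂ hμ' hμρμ s
    have i01 : Integrable fun y => k₀ (s - y) • (r₀ y + hconv r₀ (fun s => |Q s|) y) := by
      simpa only [smul_add] using! i0.add i1
    have e1 : G s ≤ hconv k₀ r₀ s + hconv k₀ (hconv r₀ (fun s => |Q s|)) s +
        hconv k₀ (hconv r₀ (hconv (fun s => |Q s|) (fun s => |r s|))) s := by
      rw [← hconv_add_right i0 i1, ← hconv_add_right i01 i2]
      exact hconv_mono hk0 (pk.integrable pr.abs hμ' hμ s)
        (by simpa only [smul_add] using! i01.add i2) (fun u _ => habs u)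
        (fun u hu => pk.eq_zero hu)
    have e2 := left hρ pQ.abs (fun _ => abs_nonneg _) s
    have e3 := left hρμ pQr hQr0 s
    have e4 : hconv k₀ (fun s => |Q s|) s ≤ Cq * C₁ * k₀ s := by
      have := norm_hconv_le hμ' hρ (f := k₀) (F := fun s => |Q s|) (C := 1) (b := b)
        (fun u _ => by rw [abs_of_nonneg (hk0 u), one_mul])
        (fun u hu => by rw [Real.norm_eq_abs, abs_abs]; exact hQb u hu) zero_le_one hCq hb hs
      rw [one_mul] at this
      refine ((le_abs_self _).trans this).trans ?_
      rw [mul_assoc]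
      exact mul_le_mul_of_nonneg_left (hkb s hs) hCq
    have e5 : hconv k₀ (hconv (fun s => |Q s|) (fun s => |r s|)) s ≤
        Cq * hconv (rlKernel ρ) G s := by
      rw [PowBound.hconv_assoc hμ' hρ hμ pk pQ.abs pr.abs,
        show hconv k₀ (fun s => |Q s|) = hconv (fun s => |Q s|) k₀ from
          funext (hconv_comm k₀ _),
        ← PowBound.hconv_assoc hρ hμ' hμ pQ.abs pk pr.abs, hconv_comm,
        hconv_comm (rlKernel ρ), ← hconv_const_mul_right]
      exact hconv_mono hG0 (pG.integrable pQ.abs hk₀μ hρ s)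
        (pG.integrable ((powBound_rlKernel hρ).const_mul Cq) hk₀μ hρ s)
        (fun u hu => hQb u (by linarith)) (fun u hu => pG.eq_zero hu)
    have e6 := hkr₀ s
    have e7 := mul_le_mul_of_nonneg_left e4 hC₀0
    have e8 := mul_le_mul_of_nonneg_left e5 hC₀0
    rw [hA, hC]
    linarith
  refine (volterra_gronwall hρ hμ' hA0 hC0 pG' hineq ht).trans ?_
  rw [mul_assoc]
  exact mul_le_mul_of_nonneg_left ((le_abs_self _).trans (hDb t ht)) hA0

/-! ### The relaxation function of a Fourier mode. -/

theorem prabhakarML_zero {ρ : ℝ} (z : ℝ) : prabhakarML ρ 1 0 z = 1 := by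
  rw [prabhakarML, tsum_eq_single 0]
  · simp
  · intro k hk
    simp [hk]

theorem symbolTerm_zero (ρ ω γ μ K p t : ℝ) : symbolTerm ρ ω γ μ K p t 0 = 1 := by
  simp [symbolTerm, prabhakarML_zero]

/-- By the semigroup law the (n+1)-fold convolution power of the kernel is again a Prabhakar kernel;
one integration turns it into the time factor of the series term of index n + 1. -/
theorem hconv_one_convPow {ρ ω μ γ : ℝ} (hρ : 0 < ρ) (hμ : 0 < μ) (n : ℕ) (t : ℝ) :
    hconv (rlKernel 1) (convPow (prabhakarSeries ρ ω μ γ) n) t =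
      prabhakarSeries ρ ω (((n + 1 : ℕ) : ℝ) * μ + 1) (((n + 1 : ℕ) : ℝ) * γ) t := by
  rw [← show prabhakarSeries ρ ω 1 0 = rlKernel 1 from funext (prabhakarSeries_zero ρ ω 1),
    convPow_prabhakarSeries hρ hμ, hconv_prabhakarSeries hρ one_pos (by positivity), zero_add]
  congr 1
  push_cast
  ring

theorem symbolTerm_succ {ρ ω μ γ : ℝ} (hρ : 0 < ρ) (hμ : 0 < μ) (K p : ℝ) (n : ℕ) {t : ℝ}
    (ht : 0 < t) : symbolTerm ρ ω γ μ K p t (n + 1) =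
      -((-1) ^ n * (K * p ^ 2) ^ (n + 1) *
        hconv (rlKernel 1) (convPow (prabhakarSeries ρ ω μ γ) n) t) := by
  rw [hconv_one_convPow hρ hμ, ← prabhakarKernel_eq_series _ _ _ ht, prabhakarKernel,
    add_sub_cancel_right, symbolTerm, pow_mul, neg_pow K, mul_pow]
  ring

/-- The Neumann series sums to the relaxation function `1 - 1 * r`. -/
theorem hasSum_symbolTerm {ρ μ : ℝ} (ω γ : ℝ) (hρ : 0 < ρ) (hμ : 0 < μ) (K p : ℝ) {t : ℝ}
    (ht : 0 < t) : HasSum (symbolTerm ρ ω γ μ K p t)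
      (1 - hconv (rlKernel 1) (volterraResolvent (prabhakarSeries ρ ω μ γ) (K * p ^ 2)) t) := by
  have h := (powBound_prabhakarSeries (ω := ω) γ hρ hμ).hasSum_resolvent_hconv hμ
    (powBound_rlKernel one_pos) one_pos (K * p ^ 2) t
  have h1 := h.neg
  rw [← hasSum_nat_add_iff' 1, Finset.sum_range_one, symbolTerm_zero]
  convert h1 using 1
  · funext n
    exact symbolTerm_succ hρ hμ K p n ht
  · ring

theorem symbolTerm_at_zero {ρ μ : ℝ} (ω γ K p : ℝ) (hμ : 0 < μ) (n : ℕ) :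
    symbolTerm ρ ω γ μ K p 0 (n + 1) = 0 := by
  rw [symbolTerm, Real.zero_rpow (by positivity)]
  simp

theorem hasSum_symbolTerm_at_zero {ρ μ : ℝ} (ω γ K p : ℝ) (hμ : 0 < μ) :
    HasSum (symbolTerm ρ ω γ μ K p 0) 1 := by
  have := hasSum_single (f := symbolTerm ρ ω γ μ K p 0) 0 fun n hn => by
    obtain ⟨k, rfl⟩ := Nat.exists_eq_succ_of_ne_zero hn
    exact symbolTerm_at_zero ω γ K p hμ k
  rwa [symbolTerm_zero] at this

/-- The relaxation function of the Fourier mode of frequency `p`. -/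
noncomputable def relaxation (ρ ω γ μ K p t : ℝ) : ℝ := ∑' n, symbolTerm ρ ω γ μ K p t n

/-- The kernel of the Riemann–Liouville-type integral that inverts the derivative `ᶜ𝐃`, resolved at
the frequency `p`; it equals `-∂ₜ relaxation`. -/
noncomputable def relaxationRate (ρ ω γ μ K p t : ℝ) : ℝ :=
  volterraResolvent (prabhakarSeries ρ ω μ γ) (K * p ^ 2) t

section

variable {ρ ω γ μ K : ℝ}

theorem powBound_relaxationRate (hρ : 0 < ρ) (hμ : 0 < μ) (p : ℝ) :
    PowBound μ (relaxationRate ρ ω γ μ K p) :=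
  (powBound_prabhakarSeries γ hρ hμ).toResolvent hμ _

theorem measurable_relaxationRate (hρ : 0 < ρ) (hμ : 0 < μ) :
    Measurable fun q : ℝ × ℝ => relaxationRate ρ ω γ μ K q.1 q.2 :=
  ((powBound_prabhakarSeries γ hρ hμ).measurable_resolvent hμ).comp
    (((measurable_fst.pow_const 2).const_mul K).prodMk measurable_snd)

theorem measurable_relaxationRate_swap (hρ : 0 < ρ) (hμ : 0 < μ) :
    Measurable fun q : ℝ × ℝ => relaxationRate ρ ω γ μ K q.2 q.1 :=
  ((powBound_prabhakarSeries γ hρ hμ).measurable_resolvent hμ).comp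
    (((measurable_snd.pow_const 2).const_mul K).prodMk measurable_fst)

theorem relaxation_eq (hρ : 0 < ρ) (hμ : 0 < μ) (p : ℝ) {t : ℝ} (ht : 0 < t) :
    relaxation ρ ω γ μ K p t = 1 - hconv (rlKernel 1) (relaxationRate ρ ω γ μ K p) t :=
  (hasSum_symbolTerm ω γ hρ hμ K p ht).tsum_eq

theorem relaxation_at_zero (hμ : 0 < μ) (p : ℝ) : relaxation ρ ω γ μ K p 0 = 1 :=
  (hasSum_symbolTerm_at_zero ω γ K p hμ).tsum_eq

/-- `k * e = 1` for the kernel `k` of `ᶜ𝐃`. -/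
theorem hconv_prabhakar_dual (hρ : 0 < ρ) (hμ : 0 < μ) (hμ1 : μ < 1) (t : ℝ) :
    hconv (prabhakarSeries ρ ω (1 - μ) (-γ)) (prabhakarSeries ρ ω μ γ) t = rlKernel 1 t := by
  rw [hconv_prabhakarSeries hρ (by linarith) hμ, sub_add_cancel, neg_add_cancel,
    prabhakarSeries_zero]

/-- As the rate is minus the time derivative, this is the equation for a single mode: ᶜ𝐃 multiplies
the relaxation function by -K p². -/
theorem hconv_relaxationRate (hρ : 0 < ρ) (hμ : 0 < μ) (hμ1 : μ < 1) (p : ℝ) {t : ℝ}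
    (ht : 0 < t) : hconv (prabhakarSeries ρ ω (1 - μ) (-γ)) (relaxationRate ρ ω γ μ K p) t =
      K * p ^ 2 * relaxation ρ ω γ μ K p t := by
  have hμ' : 0 < 1 - μ := by linarith
  have h := hconv_resolvent_of_dual hμ hμ' (powBound_prabhakarSeries (ω := ω) γ hρ hμ)
    (powBound_prabhakarSeries (-γ) hρ hμ') (hconv_prabhakar_dual hρ hμ hμ1) (K * p ^ 2) t
  rw [rlKernel_one ht] at h
  rw [relaxation_eq hρ hμ p ht]
  exact h

theorem exists_hconv_rlKernel_relaxationRate_le (ω γ : ℝ) (hρ : 0 < ρ) (hμ : 0 < μ)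
    (hμ1 : μ < 1) (hK : 0 < K) (b : ℝ) : ∃ D, 0 ≤ D ∧ ∀ p, ∀ t ≤ b,
      hconv (rlKernel (1 - μ)) (fun s => |relaxationRate ρ ω γ μ K p s|) t ≤
        D * rlKernel (1 - μ) t := by
  obtain ⟨D, hD, h⟩ := exists_hconv_abs_resolvent_le ω γ hρ hμ hμ1 b
  exact ⟨D, hD, fun p t ht => h (K * p ^ 2) (by positivity) t ht⟩

/-- Since 1 = k_μ * k_{1-μ} on t > 0, the bound for k_{1-μ} * |r| gives 1 * |r| ≤ D k_μ * k_{1-μ} ≤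
D. -/
theorem exists_hconv_one_relaxationRate_le (ω γ : ℝ) (hρ : 0 < ρ) (hμ : 0 < μ)
    (hμ1 : μ < 1) (hK : 0 < K) (b : ℝ) : ∃ D, 0 ≤ D ∧ ∀ p, ∀ t ≤ b,
      hconv (fun s => |rlKernel 1 s|) (fun s => |relaxationRate ρ ω γ μ K p s|) t ≤ D := by
  obtain ⟨D, hD, h⟩ := exists_hconv_rlKernel_relaxationRate_le ω γ hρ hμ hμ1 hK b
  refine ⟨D, hD, fun p t ht => ?_⟩
  have hμ' : 0 < 1 - μ := by linarith
  have pr := (powBound_relaxationRate (ω := ω) (γ := γ) (K := K) hρ hμ p).abs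
  have pk := powBound_rlKernel hμ'
  have ph := powBound_rlKernel hμ
  rw [show (fun s => |rlKernel 1 s|) = hconv (rlKernel μ) (rlKernel (1 - μ)) from funext fun s => by
      rw [hconv_rlKernel hμ hμ', add_sub_cancel, abs_of_nonneg (rlKernel_nonneg one_pos s)],
    ← PowBound.hconv_assoc hμ hμ' hμ ph pk pr]
  have h1 : hconv (rlKernel μ)
      (hconv (rlKernel (1 - μ)) fun s => |relaxationRate ρ ω γ μ K p s|) t ≤
      hconv (rlKernel μ) (fun s => D * rlKernel (1 - μ) s) t :=
    hconv_mono (rlKernel_nonneg hμ) (ph.integrable (pk.toHconv pr hμ' hμ) hμ (by linarith) t)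
      (ph.integrable (pk.const_mul D) hμ hμ' t) (fun s hs => h p s (hs.le.trans ht))
      (fun s hs => ph.eq_zero hs)
  refine h1.trans ?_
  rw [hconv_const_mul_right, hconv_rlKernel hμ hμ', add_sub_cancel]
  rcases lt_or_ge 0 t with h0 | h0
  · rw [rlKernel_one h0, mul_one]
  · rw [rlKernel_of_nonpos h0, mul_zero]
    exact hD

theorem exists_hconv_prabhakar_relaxationRate_le (ω γ : ℝ) (hρ : 0 < ρ) (hμ : 0 < μ)
    (hμ1 : μ < 1) (hK : 0 < K) (t : ℝ) : ∃ D, 0 ≤ D ∧ ∀ p,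
      hconv (fun s => |prabhakarSeries ρ ω (1 - μ) (-γ) s|)
        (fun s => |relaxationRate ρ ω γ μ K p s|) t ≤ D := by
  have hμ' : 0 < 1 - μ := by linarith
  obtain ⟨D, hD, h⟩ := exists_hconv_rlKernel_relaxationRate_le ω γ hρ hμ hμ1 hK t
  have pk := powBound_prabhakarSeries (ω := ω) (-γ) hρ hμ'
  obtain ⟨C, hC, hk⟩ := pk.bound t
  have hk0 := rlKernel_nonneg hμ' t
  refine ⟨C * (D * rlKernel (1 - μ) t), by positivity, fun p => ?_⟩
  have pr := (powBound_relaxationRate (ω := ω) (γ := γ) (K := K) hρ hμ p).abs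
  refine le_trans ?_ (mul_le_mul_of_nonneg_left (h p t le_rfl) hC)
  rw [hconv_comm, hconv_comm (rlKernel (1 - μ)), ← hconv_const_mul_right]
  exact hconv_mono (fun _ => abs_nonneg _) (pr.integrable pk.abs hμ hμ' t)
    (pr.integrable ((powBound_rlKernel hμ').const_mul C) hμ hμ' t) (fun s hs => hk s hs.le)
    (fun s hs => pr.eq_zero hs)

theorem abs_hconv_le_hconv_abs (f g : ℝ → ℝ) (t : ℝ) :
    |hconv f g t| ≤ hconv (fun s => |f s|) (fun s => |g s|) t := norm_hconv_le_hconv f g t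

/-- Both the relaxation function w and K p² w = k * r are bounded uniformly in p. This quadratic
decay is exactly what two x-derivatives under the frequency integral cost. -/
theorem exists_abs_relaxation_le (ω γ : ℝ) (hρ : 0 < ρ) (hμ : 0 < μ) (hμ1 : μ < 1) (hK : 0 < K)
    {t : ℝ} (ht : 0 < t) :
    ∃ D, 0 ≤ D ∧ ∀ p, |relaxation ρ ω γ μ K p t| ≤ D * (1 + p ^ 2)⁻¹ := by
  obtain ⟨D, hD, h⟩ := exists_hconv_one_relaxationRate_le ω γ hρ hμ hμ1 hK t
  obtain ⟨D', hD', h'⟩ := exists_hconv_prabhakar_relaxationRate_le ω γ hρ hμ hμ1 hK t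
  refine ⟨1 + D + D' / K, by positivity, fun p => ?_⟩
  have h1 : |relaxation ρ ω γ μ K p t| ≤ 1 + D := by
    rw [relaxation_eq hρ hμ p ht]
    refine (abs_sub _ _).trans ?_
    rw [abs_one]
    exact add_le_add le_rfl ((abs_hconv_le_hconv_abs _ _ _).trans (h p t le_rfl))
  have h2 : K * p ^ 2 * |relaxation ρ ω γ μ K p t| ≤ D' := by
    have := (abs_hconv_le_hconv_abs _ _ t).trans (h' p)
    rwa [hconv_relaxationRate hρ hμ hμ1 p ht, abs_mul, abs_of_nonneg (by positivity)] at this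
  have h3 : p ^ 2 * |relaxation ρ ω γ μ K p t| ≤ D' / K := by
    rw [le_div_iff₀ hK]
    linarith
  rw [← div_eq_mul_inv, le_div_iff₀ (by positivity)]
  linarith

theorem measurable_relaxation (hρ : 0 < ρ) (hμ : 0 < μ) {t : ℝ} (ht : 0 < t) :
    Measurable fun p => relaxation ρ ω γ μ K p t := by
  simp_rw [fun p => relaxation_eq (ω := ω) (γ := γ) (K := K) hρ hμ p ht]
  refine measurable_const.sub (StronglyMeasurable.integral_prod_right'
    (f := fun q : ℝ × ℝ => rlKernel 1 (t - q.2) • relaxationRate ρ ω γ μ K q.1 q.2) ?_).measurable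
  exact (((measurable_rlKernel 1).comp (measurable_const.sub measurable_snd)).smul
    (measurable_relaxationRate hρ hμ)).stronglyMeasurable

/-- Weighted superpositions of Fourier modes are absolutely convergent. -/
theorem integrable_superposition (hρ : 0 < ρ) (hμ : 0 < μ) {β : ℝ} (hβ : 0 < β) {f : ℝ → ℝ}
    (hf : PowBound β f) {t B : ℝ}
    (hB : ∀ p, hconv (fun s => |f s|) (fun s => |relaxationRate ρ ω γ μ K p s|) t ≤ B)
    {H : ℝ → ℂ} (hH : Integrable H) :
    Integrable (fun q : ℝ × ℝ => (f (t - q.1) * relaxationRate ρ ω γ μ K q.2 q.1) • H q.2)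
      (volume.prod volume) := by
  have hw : Measurable fun q : ℝ × ℝ => relaxationRate ρ ω γ μ K q.2 q.1 :=
    measurable_relaxationRate_swap hρ hμ
  have hm : Measurable fun q : ℝ × ℝ => f (t - q.1) * relaxationRate ρ ω γ μ K q.2 q.1 :=
    (hf.meas.measurable.comp (measurable_const.sub measurable_fst)).mul hw
  have hm' : AEStronglyMeasurable (fun q : ℝ × ℝ =>
      (f (t - q.1) * relaxationRate ρ ω γ μ K q.2 q.1) • H q.2) (volume.prod volume) :=
    hm.aestronglyMeasurable.smul hH.aestronglyMeasurable.comp_snd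
  rw [integrable_prod_iff' hm']
  have hpr := fun p => powBound_relaxationRate (ω := ω) (γ := γ) (K := K) hρ hμ p
  refine ⟨Eventually.of_forall fun p =>
    (hf.integrable (hpr p) hβ hμ t).smul_const (H p), ?_⟩
  have e : ∀ p, ∫ s, ‖(f (t - s) * relaxationRate ρ ω γ μ K p s) • H p‖ =
      hconv (fun s => |f s|) (fun s => |relaxationRate ρ ω γ μ K p s|) t * ‖H p‖ := by
    intro p
    simp_rw [norm_smul, integral_mul_const, norm_mul, Real.norm_eq_abs]
    rfl
  refine (hH.norm.const_mul B).mono' ?_ (Eventually.of_forall fun p => ?_)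
  · exact hm'.norm.prod_swap.integral_prod_right'
  · rw [Real.norm_of_nonneg (integral_nonneg fun _ => norm_nonneg _)]
    dsimp only
    rw [e]
    exact mul_le_mul_of_nonneg_right (hB p) (norm_nonneg _)

theorem integrable_mul_relaxation (hρ : 0 < ρ) (hμ : 0 < μ) (hμ1 : μ < 1) (hK : 0 < K) {t : ℝ}
    (ht : 0 < t) {H : ℝ → ℂ} (hH : AEStronglyMeasurable H) {M : ℝ} (hM : ∀ p, ‖H p‖ ≤ M) :
    Integrable fun p => H p * (relaxation ρ ω γ μ K p t : ℂ) := by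
  obtain ⟨D, hD, h⟩ := exists_abs_relaxation_le ω γ hρ hμ hμ1 hK ht
  refine (integrable_inv_one_add_sq.const_mul (M * D)).mono' ?_ (Eventually.of_forall fun p => ?_)
  · exact hH.mul
      (Complex.measurable_ofReal.comp (measurable_relaxation hρ hμ ht)).aestronglyMeasurable
  · rw [norm_mul, Complex.norm_real, Real.norm_eq_abs, mul_assoc]
    exact mul_le_mul (hM p) (h p) (abs_nonneg _) ((norm_nonneg _).trans (hM p))

/-- Multiplication by `1 + p²` times the relaxation function preserves integrability. -/
theorem integrable_pow_mul_relaxation (hρ : 0 < ρ) (hμ : 0 < μ) (hμ1 : μ < 1) (hK : 0 < K) {t : ℝ}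
    (ht : 0 < t) {H : ℝ → ℂ} (hH : Integrable H) {c : ℝ → ℂ} (hc : Measurable c)
    (hcb : ∀ p, ‖c p‖ ≤ 1 + p ^ 2) :
    Integrable fun p => c p * (H p * (relaxation ρ ω γ μ K p t : ℂ)) := by
  obtain ⟨D, hD, h⟩ := exists_abs_relaxation_le ω γ hρ hμ hμ1 hK ht
  refine (hH.norm.const_mul D).mono' ?_ (Eventually.of_forall fun p => ?_)
  · exact hc.aestronglyMeasurable.mul (hH.aestronglyMeasurable.mul
      (Complex.measurable_ofReal.comp (measurable_relaxation hρ hμ ht)).aestronglyMeasurable)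
  · rw [norm_mul, norm_mul, Complex.norm_real, Real.norm_eq_abs]
    calc ‖c p‖ * (‖H p‖ * |relaxation ρ ω γ μ K p t|)
        ≤ (1 + p ^ 2) * (‖H p‖ * (D * (1 + p ^ 2)⁻¹)) := by
          have := hcb p
          have := h p
          gcongr
      _ = D * ‖H p‖ * ((1 + p ^ 2) * (1 + p ^ 2)⁻¹) := by ring
      _ = D * ‖H p‖ := by rw [mul_inv_cancel₀ (by positivity), mul_one]

end

/-! ### Absolute continuity of primitives. -/

theorem AbsolutelyContinuousOnInterval.of_dist_le {X Y : Type*} [PseudoMetricSpace X]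
    [PseudoMetricSpace Y] {f : ℝ → X} {g : ℝ → Y} {a b : ℝ}
    (hg : AbsolutelyContinuousOnInterval g a b)
    (h : ∀ x ∈ uIcc a b, ∀ y ∈ uIcc a b, dist (f x) (f y) ≤ dist (g x) (g y)) :
    AbsolutelyContinuousOnInterval f a b := by
  rw [absolutelyContinuousOnInterval_iff] at hg ⊢
  intro ε hε
  obtain ⟨δ, hδ, h'⟩ := hg ε hε
  refine ⟨δ, hδ, fun E hE hEδ => lt_of_le_of_lt ?_ (h' E hE hEδ)⟩
  exact Finset.sum_le_sum fun i hi => h _ (hE.1 i hi).1 _ (hE.1 i hi).2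

theorem absolutelyContinuousOnInterval_of_eq_integral {F V : ℝ → ℂ} {c : ℂ} {b : ℝ}
    (hb : 0 ≤ b) (hV : IntervalIntegrable V volume 0 b)
    (h : ∀ t, 0 ≤ t → F t = c + ∫ s in (0 : ℝ)..t, V s) :
    AbsolutelyContinuousOnInterval F 0 b := by
  refine AbsolutelyContinuousOnInterval.of_dist_le
    (hV.norm.absolutelyContinuousOnInterval_intervalIntegral (c := 0) left_mem_uIcc) ?_
  rw [uIcc_of_le hb]
  have key : ∀ x ∈ Icc 0 b, ∀ y ∈ Icc 0 b, x ≤ y → dist (F y) (F x) ≤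
      dist (∫ s in (0 : ℝ)..y, ‖V s‖) (∫ s in (0 : ℝ)..x, ‖V s‖) := by
    intro x hx y hy hxy
    have hVx : IntervalIntegrable V volume 0 x :=
      hV.mono_set (by rw [uIcc_of_le hx.1, uIcc_of_le hb]; exact Icc_subset_Icc_right hx.2)
    have hVy : IntervalIntegrable V volume 0 y :=
      hV.mono_set (by rw [uIcc_of_le hy.1, uIcc_of_le hb]; exact Icc_subset_Icc_right hy.2)
    rw [h x hx.1, h y hy.1, dist_add_left, dist_eq_norm,
      intervalIntegral.integral_interval_sub_left hVy hVx, Real.dist_eq,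
      intervalIntegral.integral_interval_sub_left hVy.norm hVx.norm]
    exact (intervalIntegral.norm_integral_le_integral_norm hxy).trans (le_abs_self _)
  intro x hx y hy
  rcases le_total x y with hxy | hxy
  · rw [dist_comm, dist_comm (∫ s in (0 : ℝ)..x, ‖V s‖)]
    exact key x hx y hy hxy
  · exact key y hy x hx hxy

/-- Lebesgue differentiation. Nothing is known for t < 0, so the identity is used on the
neighbourhood (0, ∞) of a positive time. -/
theorem ae_deriv_eq_of_eq_integral {F V : ℝ → ℂ} {c : ℂ} {b : ℝ}
    (hb : 0 ≤ b) (hV : IntervalIntegrable V volume 0 b)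
    (h : ∀ t, 0 ≤ t → F t = c + ∫ s in (0 : ℝ)..t, V s) :
    ∀ᵐ t, t ∈ Ioc 0 b → deriv F t = V t := by
  filter_upwards [hV.ae_hasDerivAt_integral] with t ht htb
  rw [uIcc_of_le hb] at ht
  have h1 := (ht (Ioc_subset_Icc_self htb) 0 (left_mem_Icc.2 hb)).const_add c
  refine (h1.congr_of_eventuallyEq ?_).deriv
  filter_upwards [Ioi_mem_nhds htb.1] with s hs
  exact h s (le_of_lt hs)

/-! ### Fourier transforms in the angular-frequency normalisation. -/

theorem norm_exp_I_mul (p x : ℝ) : ‖Complex.exp (Complex.I * p * x)‖ = 1 := by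
  rw [mul_assoc, ← Complex.ofReal_mul, mul_comm, Complex.norm_exp_ofReal_mul_I]

theorem norm_exp_neg_I_mul (p x : ℝ) : ‖Complex.exp (-(Complex.I * p * x))‖ = 1 := by
  have := norm_exp_I_mul p (-x)
  rwa [Complex.ofReal_neg, mul_neg] at this

theorem fourierHat_eq (g : ℝ → ℂ) (p : ℝ) :
    fourierHat g p = FourierTransform.fourier g (p / (2 * Real.pi)) := by
  rw [Real.fourier_real_eq_integral_exp_smul, fourierHat]
  congr 1
  funext x
  rw [smul_eq_mul]
  congr 2
  have : (Real.pi : ℂ) ≠ 0 := by exact_mod_cast Real.pi_ne_zero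
  push_cast
  field_simp

theorem norm_fourierHat_le (g : ℝ → ℂ) (p : ℝ) : ‖fourierHat g p‖ ≤ ∫ x, ‖g x‖ := by
  refine (norm_integral_le_integral_norm _).trans_eq ?_
  simp only [norm_mul, norm_exp_neg_I_mul, one_mul]

theorem continuous_fourierHat {g : ℝ → ℂ} (hg : Integrable g) : Continuous (fourierHat g) := by
  have h := VectorFourier.fourierIntegral_continuous (e := Real.fourierChar) (μ := volume)
    (L := innerₗ ℝ) Real.continuous_fourierChar (by exact continuous_inner) hg
  have : fourierHat g = (FourierTransform.fourier g) ∘ fun p => p / (2 * Real.pi) :=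
    funext (fourierHat_eq g)
  rw [this]
  exact Continuous.comp h (continuous_id.div_const _)

theorem fourierInvHat_eq (h : ℝ → ℂ) (x : ℝ) :
    fourierInvHat h x = FourierTransformInv.fourierInv (fun v => h (2 * Real.pi * v)) x := by
  rw [Real.fourierInv_eq', fourierInvHat]
  have := Measure.integral_comp_mul_left
    (fun p : ℝ => Complex.exp (Complex.I * p * x) * h p) (2 * Real.pi)
  have hpi : 0 < 2 * Real.pi := by positivity
  rw [abs_of_pos (by positivity), Complex.real_smul] at this
  push_cast at this
  rw [one_div, ← this]
  congr 1
  funext v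
  rw [smul_eq_mul]
  congr 2
  simp only [RCLike.inner_apply, conj_trivial]
  push_cast
  ring

theorem fourierInvHat_fourierHat {g : ℝ → ℂ} (hc : Continuous g) (hg : Integrable g)
    (hg' : Integrable (fourierHat g)) (x : ℝ) : fourierInvHat (fourierHat g) x = g x := by
  have hpi : (2 * Real.pi) ≠ 0 := by positivity
  have e : (fun v => fourierHat g (2 * Real.pi * v)) = FourierTransform.fourier g := by
    funext v
    rw [fourierHat_eq, mul_div_cancel_left₀ _ hpi]
  have hi : Integrable (FourierTransform.fourier g) := by
    rw [← e]
    exact hg'.comp_mul_left' hpi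
  rw [fourierInvHat_eq, e, hc.fourierInv_fourier_eq hg hi]

/-- Riemann–Lebesgue. For a non-integrable `h` the Bochner integral is 0, so the conclusion still
holds. -/
theorem tendsto_fourierInvHat_cocompact (h : ℝ → ℂ) :
    Tendsto (fourierInvHat h) (cocompact ℝ) (𝓝 0) := by
  have h0 := Real.zero_at_infty_fourier (fun v => h (2 * Real.pi * v))
  have h1 : Tendsto (fun x : ℝ => -x) (cocompact ℝ) (cocompact ℝ) :=
    (Homeomorph.neg ℝ).isClosedEmbedding.tendsto_cocompact
  refine (h0.comp h1).congr fun x => ?_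
  rw [fourierInvHat_eq, Real.fourierInv_eq_fourier_neg]
  rfl

theorem hasDerivAt_fourierInvHat {h : ℝ → ℂ} (hh : Integrable h)
    (hh' : Integrable fun p : ℝ => Complex.I * p * h p) (x : ℝ) :
    HasDerivAt (fourierInvHat h) (fourierInvHat (fun p => Complex.I * p * h p) x) x := by
  unfold fourierInvHat
  refine HasDerivAt.const_mul _ ?_
  have hexp : ∀ x : ℝ, Continuous fun p : ℝ => Complex.exp (Complex.I * p * x) := fun x => by
    fun_prop
  refine (hasDerivAt_integral_of_dominated_loc_of_deriv_le (s := univ) (μ := volume)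
    (F := fun (x : ℝ) (p : ℝ) => Complex.exp (Complex.I * p * x) * h p)
    (F' := fun (x : ℝ) (p : ℝ) => Complex.exp (Complex.I * p * x) * (Complex.I * p * h p))
    (bound := fun p => ‖Complex.I * p * h p‖) univ_mem ?_ ?_ ?_ ?_ hh'.norm ?_).2
  · exact Eventually.of_forall fun x =>
      (hexp x).aestronglyMeasurable.mul hh.aestronglyMeasurable
  · refine hh.norm.mono' ((hexp x).aestronglyMeasurable.mul hh.aestronglyMeasurable) ?_
    exact Eventually.of_forall fun p => by rw [norm_mul, norm_exp_I_mul, one_mul]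
  · exact (hexp x).aestronglyMeasurable.mul hh'.aestronglyMeasurable
  · exact Eventually.of_forall fun p x _ => by rw [norm_mul, norm_exp_I_mul, one_mul]
  · refine Eventually.of_forall fun p x _ => ?_
    have h1 : HasDerivAt (fun y : ℝ => Complex.exp (Complex.I * p * y))
        (Complex.exp (Complex.I * p * x) * (Complex.I * p)) x := by
      have h2 : HasDerivAt (fun y : ℝ => Complex.I * p * (y : ℂ)) (Complex.I * p) x := by
        simpa using (Complex.ofRealCLM.hasDerivAt (x := x)).const_mul (Complex.I * p)
      exact h2.cexp
    have := h1.mul_const (h p)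
    rwa [mul_assoc] at this

theorem fourierInvHat_const_mul (c : ℂ) (h : ℝ → ℂ) (x : ℝ) :
    fourierInvHat (fun p => c * h p) x = c * fourierInvHat h x := by
  simp only [fourierInvHat]
  rw [mul_left_comm c, ← integral_const_mul c]
  congr 2
  funext p
  ring

/-! ### Existence: superposition of the relaxing modes. -/

section

variable {ρ ω γ μ K : ℝ} {G : ℝ → ℂ}

/-- The time derivative of the superposition of relaxing Fourier modes with amplitudes `G`. -/
noncomputable def superpositionRate (ρ ω γ μ K : ℝ) (G : ℝ → ℂ) (x t : ℝ) : ℂ :=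
  fourierInvHat (fun p => G p * (-(relaxationRate ρ ω γ μ K p t) : ℝ)) x

theorem superpositionRate_of_nonpos (hρ : 0 < ρ) (hμ : 0 < μ) (x : ℝ) {t : ℝ} (ht : t ≤ 0) :
    superpositionRate ρ ω γ μ K G x t = 0 := by
  have : ∀ p, relaxationRate ρ ω γ μ K p t = 0 := fun p =>
    (powBound_relaxationRate hρ hμ p).eq_zero ht
  simp [superpositionRate, fourierInvHat, this]

/-- Fubini over time and frequency: a time convolution acts on each mode separately. The third
integrand does not involve x, and the dominating function for ∂u/∂t is built from it. -/
theorem hconv_superpositionRate (hρ : 0 < ρ) (hμ : 0 < μ) {β : ℝ} (hβ : 0 < β) {f : ℝ → ℝ}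
    (hf : PowBound β f) {t B : ℝ}
    (hB : ∀ p, hconv (fun s => |f s|) (fun s => |relaxationRate ρ ω γ μ K p s|) t ≤ B)
    (hG : Integrable G) (x : ℝ) :
    Integrable (fun s => f (t - s) • superpositionRate ρ ω γ μ K G x s) ∧
    hconv f (superpositionRate ρ ω γ μ K G x) t = fourierInvHat
      (fun p => G p * (-(hconv f (relaxationRate ρ ω γ μ K p) t) : ℝ)) x ∧
    Integrable fun s => |f (t - s)| * ∫ p, ‖G p‖ * |relaxationRate ρ ω γ μ K p s| := by
  set H : ℝ → ℂ := fun p => (1 / (2 * Real.pi) : ℂ) * (-(Complex.exp (Complex.I * p * x) * G p))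
    with hH
  have hexp : Continuous fun p : ℝ => Complex.exp (Complex.I * p * x) := by fun_prop
  have hHi : Integrable H := by
    refine Integrable.const_mul (Integrable.neg ?_) _
    refine hG.norm.mono' (hexp.aestronglyMeasurable.mul hG.aestronglyMeasurable) ?_
    exact Eventually.of_forall fun p => by rw [norm_mul, norm_exp_I_mul, one_mul]
  have hI := integrable_superposition hρ hμ hβ hf hB hHi
  have e1 : ∀ s, f (t - s) • superpositionRate ρ ω γ μ K G x s =
      ∫ p, (f (t - s) * relaxationRate ρ ω γ μ K p s) • H p := by
    intro s
    rw [superpositionRate, fourierInvHat, ← integral_const_mul, ← integral_smul]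
    congr 1
    funext p
    simp only [hH, Complex.real_smul]
    push_cast
    ring
  refine ⟨?_, ?_, ?_⟩
  · simp_rw [e1]
    exact hI.integral_prod_left
  · simp only [hconv, e1]
    rw [integral_integral_swap hI, fourierInvHat, ← integral_const_mul]
    congr 1
    funext p
    rw [integral_smul_const]
    simp only [hH, Complex.real_smul, smul_eq_mul]
    push_cast
    ring
  · have hI' := (integrable_superposition hρ hμ hβ hf hB hG).norm.integral_prod_left
    refine hI'.congr (Eventually.of_forall fun s => ?_)
    dsimp only
    rw [← integral_const_mul]
    congr 1
    funext p
    rw [norm_smul, norm_mul, Real.norm_eq_abs, Real.norm_eq_abs]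
    ring

theorem norm_superpositionRate_le (x t : ℝ) : ‖superpositionRate ρ ω γ μ K G x t‖ ≤
    1 / (2 * Real.pi) * ∫ p, ‖G p‖ * |relaxationRate ρ ω γ μ K p t| := by
  rw [superpositionRate, fourierInvHat, norm_mul]
  have : ‖(1 / (2 * Real.pi) : ℂ)‖ = 1 / (2 * Real.pi) := by
    rw [show (1 / (2 * Real.pi) : ℂ) = ((1 / (2 * Real.pi) : ℝ) : ℂ) by push_cast; rfl,
      Complex.norm_real, Real.norm_of_nonneg (by positivity)]
  rw [this]
  refine mul_le_mul_of_nonneg_left ((norm_integral_le_integral_norm _).trans_eq ?_)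
    (by positivity)
  congr 1
  funext p
  rw [norm_mul, norm_mul, norm_exp_I_mul, one_mul, Complex.norm_real, norm_neg, Real.norm_eq_abs]

end

theorem integrable_exp_mul {h : ℝ → ℂ} (hh : Integrable h) (x : ℝ) :
    Integrable fun p : ℝ => Complex.exp (Complex.I * p * x) * h p := by
  have hexp : Continuous fun p : ℝ => Complex.exp (Complex.I * p * x) := by fun_prop
  refine hh.norm.mono' (hexp.aestronglyMeasurable.mul hh.aestronglyMeasurable) ?_
  exact Eventually.of_forall fun p => by rw [norm_mul, norm_exp_I_mul, one_mul]

theorem fourierInvHat_add {h h' : ℝ → ℂ} (hh : Integrable h) (hh' : Integrable h') (x : ℝ) :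
    fourierInvHat (fun p => h p + h' p) x = fourierInvHat h x + fourierInvHat h' x := by
  simp only [fourierInvHat, mul_add]
  rw [integral_add (integrable_exp_mul hh x) (integrable_exp_mul hh' x), mul_add]

section

variable {ρ ω γ μ K : ℝ} {g : ℝ → ℂ}

/-- The case f = k_1, t = b of the convolution statement, where the kernel equals 1 throughout (0,
b). -/
theorem integrableOn_superpositionRate (hρ : 0 < ρ) (hμ : 0 < μ) (hμ1 : μ < 1) (hK : 0 < K)
    {G : ℝ → ℂ} (hG : Integrable G) (x b : ℝ) :
    IntegrableOn (superpositionRate ρ ω γ μ K G x) (Ioo 0 b) ∧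
    IntegrableOn (fun s => 1 / (2 * Real.pi) * ∫ p, ‖G p‖ * |relaxationRate ρ ω γ μ K p s|)
      (Ioo 0 b) := by
  obtain ⟨D, hD, hB⟩ := exists_hconv_one_relaxationRate_le ω γ hρ hμ hμ1 hK b
  obtain ⟨h1, -, h2⟩ := hconv_superpositionRate hρ hμ one_pos (powBound_rlKernel one_pos)
    (fun p => hB p b le_rfl) hG x
  constructor
  · refine h1.integrableOn.congr_fun (fun s hs => ?_) measurableSet_Ioo
    dsimp only
    rw [rlKernel_one (sub_pos.2 hs.2), one_smul]
  · refine Integrable.const_mul (h2.integrableOn.congr_fun (fun s hs => ?_) measurableSet_Ioo) _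
    dsimp only
    rw [rlKernel_one (sub_pos.2 hs.2), abs_one, one_mul]

theorem diffusionFormula_eq (g : ℝ → ℂ) (x t : ℝ) : diffusionFormula ρ ω γ μ K g x t =
    fourierInvHat (fun p => fourierHat g p * (relaxation ρ ω γ μ K p t : ℂ)) x := rfl

theorem integrable_fourierHat_mul_relaxation (hρ : 0 < ρ) (hμ : 0 < μ) (hμ1 : μ < 1) (hK : 0 < K)
    (hg : Integrable g) {t : ℝ} (ht : 0 < t) :
    Integrable fun p => fourierHat g p * (relaxation ρ ω γ μ K p t : ℂ) :=
  integrable_mul_relaxation hρ hμ hμ1 hK ht (continuous_fourierHat hg).aestronglyMeasurable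
    (norm_fourierHat_le g)

/-- Superpose w = 1 - 1 * r: the constant 1 contributes g by Fourier inversion, and the rest is the
time integral of the rate. -/
theorem diffusionFormula_eq_integral (hρ : 0 < ρ) (hμ : 0 < μ) (hμ1 : μ < 1) (hK : 0 < K)
    (hc : Continuous g) (hg : Integrable g) (hg' : Integrable (fourierHat g)) (x : ℝ) {t : ℝ}
    (ht : 0 ≤ t) : diffusionFormula ρ ω γ μ K g x t =
      g x + ∫ s in (0 : ℝ)..t, superpositionRate ρ ω γ μ K (fourierHat g) x s := by
  rw [diffusionFormula_eq]
  rcases ht.eq_or_lt with rfl | ht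
  · simp only [relaxation_at_zero hμ, Complex.ofReal_one, mul_one,
      intervalIntegral.integral_same, add_zero]
    exact fourierInvHat_fourierHat hc hg hg' x
  · obtain ⟨D, hD, hB⟩ := exists_hconv_one_relaxationRate_le ω γ hρ hμ hμ1 hK t
    obtain ⟨-, h1, -⟩ := hconv_superpositionRate hρ hμ one_pos (powBound_rlKernel one_pos)
      (fun p => hB p t le_rfl) hg' x
    rw [hconv_one_eq (fun s hs => superpositionRate_of_nonpos hρ hμ x hs),
      ← intervalIntegral.integral_of_le ht.le] at h1
    rw [h1, ← fourierInvHat_fourierHat hc hg hg' x]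
    have e : ∀ p, fourierHat g p *
        ((-hconv (rlKernel 1) (relaxationRate ρ ω γ μ K p) t : ℝ) : ℂ) =
        fourierHat g p * (relaxation ρ ω γ μ K p t : ℂ) - fourierHat g p := by
      intro p
      rw [relaxation_eq hρ hμ p ht]
      push_cast
      ring
    rw [← fourierInvHat_add hg']
    · congr 1
      funext p
      rw [e]
      ring
    · simp_rw [e]
      exact (integrable_fourierHat_mul_relaxation hρ hμ hμ1 hK hg ht).sub hg'

theorem intervalIntegrable_superpositionRate (hρ : 0 < ρ) (hμ : 0 < μ) (hμ1 : μ < 1) (hK : 0 < K)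
    {G : ℝ → ℂ} (hG : Integrable G) (x : ℝ) {b : ℝ} (hb : 0 ≤ b) :
    IntervalIntegrable (superpositionRate ρ ω γ μ K G x) volume 0 b :=
  (intervalIntegrable_iff_integrableOn_Ioo_of_le hb).2
    (integrableOn_superpositionRate hρ hμ hμ1 hK hG x b).1

/-- The pointwise `a.e.` form of the integrand of `ᶜ𝐃` in terms of the extended kernel. -/
theorem prabhakarKernel_mul_deriv_ae_eq {u V : ℝ → ℂ} {t : ℝ}
    (h : ∀ᵐ s, s ∈ Ioc 0 t → deriv u s = V s) :
    (fun y => (prabhakarKernel ρ (1 - μ) ω (-γ) (t - y) : ℂ) * deriv u y)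
      =ᵐ[volume.restrict (Ioc 0 t)]
    fun y => prabhakarSeries ρ ω (1 - μ) (-γ) (t - y) • V y := by
  have h0 : ∀ᵐ y : ℝ, y ≠ t := by simp [ae_iff, measure_singleton]
  refine (ae_restrict_iff' measurableSet_Ioc).2 ?_
  filter_upwards [h, h0] with y hy hyt hm
  rw [hy hm, prabhakarKernel_eq_series _ _ _ (sub_pos.2 (lt_of_le_of_ne hm.2 hyt)),
    Complex.real_smul]

/-- In time the formula is a primitive of `V`, hence absolutely continuous. Convolving `V` with the
kernel of ᶜ𝐃 multiplies the amplitude of the formula by -K p² = K (ip)², as K ∂²/∂x² does. Decay in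
x is the Riemann–Lebesgue lemma. -/
theorem isDiffusionSolution_diffusionFormula (hρ : 0 < ρ) (hμ : 0 < μ) (hμ1 : μ < 1) (hK : 0 < K)
    (hc : Continuous g) (hg : Integrable g) (hg' : Integrable (fourierHat g)) :
    IsDiffusionSolution ρ ω γ μ K g (diffusionFormula ρ ω γ μ K g) := by
  set U := diffusionFormula ρ ω γ μ K g with hU
  set V := superpositionRate ρ ω γ μ K (fourierHat g) with hV
  have hUV : ∀ x t, 0 ≤ t → U x t = g x + ∫ s in (0 : ℝ)..t, V x s := fun x t ht =>
    diffusionFormula_eq_integral hρ hμ hμ1 hK hc hg hg' x ht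
  have hVi : ∀ x b, 0 ≤ b → IntervalIntegrable (V x) volume 0 b := fun x b hb =>
    intervalIntegrable_superpositionRate hρ hμ hμ1 hK hg' x hb
  have hderiv : ∀ x b, 0 ≤ b → ∀ᵐ s, s ∈ Ioc 0 b → deriv (U x) s = V x s := fun x b hb =>
    ae_deriv_eq_of_eq_integral hb (hVi x b hb) (hUV x)
  have hac : ∀ x b, 0 < b → AbsolutelyContinuousOnInterval (U x) 0 b := fun x b hb =>
    absolutelyContinuousOnInterval_of_eq_integral hb.le (hVi x b hb.le) (hUV x)
  have hμ' : 0 < 1 - μ := by linarith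
  have pk := powBound_prabhakarSeries (ω := ω) (-γ) hρ hμ'
  choose D _ hB using exists_hconv_prabhakar_relaxationRate_le ω γ hρ hμ hμ1 hK
  have hconvV := fun (x t : ℝ) => hconv_superpositionRate hρ hμ hμ' pk (hB t) hg' x
  have hint : ∀ t, 0 < t → ∀ c : ℝ → ℂ, Measurable c → (∀ p, ‖c p‖ ≤ 1 + p ^ 2) →
      Integrable fun p => c p * (fourierHat g p * (relaxation ρ ω γ μ K p t : ℂ)) :=
    fun t ht c hcm hcb => integrable_pow_mul_relaxation hρ hμ hμ1 hK ht hg' hcm hcb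
  have i0 : ∀ t, 0 < t →
      Integrable fun p => fourierHat g p * (relaxation ρ ω γ μ K p t : ℂ) := fun t ht =>
    integrable_fourierHat_mul_relaxation hρ hμ hμ1 hK hg ht
  have i1 : ∀ t, 0 < t → Integrable fun p : ℝ =>
      Complex.I * p * (fourierHat g p * (relaxation ρ ω γ μ K p t : ℂ)) := fun t ht =>
    hint t ht (fun p => Complex.I * p) (by fun_prop) fun p => by
      simp only [norm_mul, Complex.norm_I, Complex.norm_real, Real.norm_eq_abs, one_mul]
      nlinarith [sq_abs p, sq_nonneg (|p| - 1), abs_nonneg p]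
  have i2 : ∀ t, 0 < t → Integrable fun p : ℝ => Complex.I * p *
      (Complex.I * p * (fourierHat g p * (relaxation ρ ω γ μ K p t : ℂ))) := fun t ht => by
    have := hint t ht (fun p => (Complex.I * p) * (Complex.I * p)) (by fun_prop) fun p => by
      simp only [norm_mul, Complex.norm_I, Complex.norm_real, Real.norm_eq_abs, one_mul]
      nlinarith [sq_abs p]
    simpa only [mul_assoc] using! this
  have d1 : ∀ t, 0 < t → ∀ x, HasDerivAt (fun x => U x t) (fourierInvHat (fun p : ℝ =>
      Complex.I * p * (fourierHat g p * (relaxation ρ ω γ μ K p t : ℂ))) x) x := fun t ht x =>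
    hasDerivAt_fourierInvHat (i0 t ht) (i1 t ht) x
  have d1' : ∀ t, 0 < t → deriv (fun x => U x t) = fourierInvHat (fun p : ℝ =>
      Complex.I * p * (fourierHat g p * (relaxation ρ ω γ μ K p t : ℂ))) := fun t ht =>
    funext fun x => (d1 t ht x).deriv
  have d2 : ∀ t, 0 < t → ∀ x, HasDerivAt (deriv fun x => U x t) (fourierInvHat (fun p : ℝ =>
      Complex.I * p * (Complex.I * p *
        (fourierHat g p * (relaxation ρ ω γ μ K p t : ℂ)))) x) x := fun t ht x => by
    rw [d1' t ht]
    exact hasDerivAt_fourierInvHat (i1 t ht) (i2 t ht) x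
  refine
    { absCont := fun x b hb => hac x b hb
      converges := fun x t ht => ?_
      diff := fun t ht x => (d1 t ht x).differentiableAt
      diff_two := fun t ht x => (d2 t ht x).differentiableAt
      equation := fun x t ht => ?_
      initial := fun x => ?_
      decay_top := fun t ht => ?_
      decay_bot := fun t ht => ?_ }
  · rw [intervalIntegrable_iff_integrableOn_Ioc_of_le ht.le]
    exact (hconvV x t).1.integrableOn.congr
      (prabhakarKernel_mul_deriv_ae_eq (hderiv x t ht.le)).symm
  · rw [(d2 t ht x).deriv, regHilferPrabhakarDeriv, prabhakarIntegral,
      intervalIntegral.integral_of_le ht.le,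
      integral_congr_ae (prabhakarKernel_mul_deriv_ae_eq (hderiv x t ht.le)),
      ← hconv_eq_integral (fun s hs => pk.eq_zero hs)
        (fun s hs => superpositionRate_of_nonpos hρ hμ x hs), (hconvV x t).2.1,
      ← fourierInvHat_const_mul]
    congr 1
    funext p
    rw [hconv_relaxationRate hρ hμ hμ1 p ht]
    push_cast
    have := Complex.I_sq
    linear_combination (-(K * fourierHat g p * p ^ 2 * relaxation ρ ω γ μ K p t : ℂ)) * this
  · have hcont := (hac x 1 one_pos).continuousOn
    rw [uIcc_of_le zero_le_one] at hcont
    have h0 : U x 0 = g x := by simp [hUV x 0 le_rfl]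
    have := (hcont 0 (left_mem_Icc.2 zero_le_one)).tendsto
    rw [h0] at this
    exact this.mono_left (nhdsWithin_le_iff.2 (Icc_mem_nhdsGT_of_mem ⟨le_rfl, one_pos⟩))
  · exact (tendsto_fourierInvHat_cocompact _).mono_left atTop_le_cocompact
  · exact (tendsto_fourierInvHat_cocompact _).mono_left atBot_le_cocompact

theorem hasDominatedTimeDeriv_diffusionFormula (hρ : 0 < ρ) (hμ : 0 < μ) (hμ1 : μ < 1)
    (hK : 0 < K) (hc : Continuous g) (hg : Integrable g) (hg' : Integrable (fourierHat g)) :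
    HasDominatedTimeDeriv (diffusionFormula ρ ω γ μ K g) := by
  intro b hb
  refine ⟨_, (integrableOn_superpositionRate (ω := ω) (γ := γ) hρ hμ hμ1 hK hg' 0 b).2,
    fun x => ?_⟩
  refine (ae_restrict_iff' measurableSet_Ioo).2 ?_
  filter_upwards [ae_deriv_eq_of_eq_integral hb.le
    (intervalIntegrable_superpositionRate hρ hμ hμ1 hK hg' x hb.le)
    (fun t ht => diffusionFormula_eq_integral (ω := ω) (γ := γ) hρ hμ hμ1 hK hc hg hg' x ht)]
    with t ht htb
  rw [ht (Ioo_subset_Ioc_self htb)]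
  exact norm_superpositionRate_le x t

end

/-! ### Bounds in space and integration by parts. -/

theorem AbsolutelyContinuousOnInterval.integral_deriv_complex {f : ℝ → ℂ} {a b : ℝ}
    (hf : AbsolutelyContinuousOnInterval f a b) :
    IntervalIntegrable (deriv f) volume a b ∧ ∫ x in a..b, deriv f x = f b - f a := by
  have hre : AbsolutelyContinuousOnInterval (fun x => (f x).re) a b :=
    hf.of_dist_le fun x _ y _ => by
      rw [Real.dist_eq, dist_eq_norm, ← Complex.sub_re]
      exact Complex.abs_re_le_norm _
  have him : AbsolutelyContinuousOnInterval (fun x => (f x).im) a b :=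
    hf.of_dist_le fun x _ y _ => by
      rw [Real.dist_eq, dist_eq_norm, ← Complex.sub_im]
      exact Complex.abs_im_le_norm _
  have e : ∀ᵐ x, x ∈ uIcc a b → deriv f x =
      ((deriv (fun x => (f x).re) x : ℝ) : ℂ) + ((deriv (fun x => (f x).im) x : ℝ) : ℂ) * Complex.I := by
    filter_upwards [hf.boundedVariationOn.ae_differentiableAt_of_mem_uIcc] with x hx hxm
    have h1 := (hx hxm).hasDerivAt
    have h2 : HasDerivAt (fun x => (f x).re) (deriv f x).re x :=
      (Complex.reCLM.hasFDerivAt.comp_hasDerivAt x h1)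
    have h3 : HasDerivAt (fun x => (f x).im) (deriv f x).im x :=
      (Complex.imCLM.hasFDerivAt.comp_hasDerivAt x h1)
    rw [h2.deriv, h3.deriv, Complex.re_add_im]
  have e' : ∀ᵐ x, x ∈ uIoc a b → ((deriv (fun x => (f x).re) x : ℝ) : ℂ) +
      ((deriv (fun x => (f x).im) x : ℝ) : ℂ) * Complex.I = deriv f x := by
    filter_upwards [e] with x hx hxm
    exact (hx (uIoc_subset_uIcc hxm)).symm
  have i1 : IntervalIntegrable (fun x => ((deriv (fun x => (f x).re) x : ℝ) : ℂ)) volume a b :=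
    ⟨hre.intervalIntegrable_deriv.1.ofReal, hre.intervalIntegrable_deriv.2.ofReal⟩
  have i2 : IntervalIntegrable (fun x => ((deriv (fun x => (f x).im) x : ℝ) : ℂ) * Complex.I)
      volume a b :=
    IntervalIntegrable.mul_const
      ⟨him.intervalIntegrable_deriv.1.ofReal, him.intervalIntegrable_deriv.2.ofReal⟩ _
  refine ⟨(i1.add i2).congr_ae ((ae_restrict_iff' measurableSet_uIoc).2 e'), ?_⟩
  rw [← intervalIntegral.integral_congr_ae e', intervalIntegral.integral_add i1 i2,
    intervalIntegral.integral_mul_const, intervalIntegral.integral_ofReal,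
    intervalIntegral.integral_ofReal, hre.integral_deriv_eq_sub, him.integral_deriv_eq_sub]
  apply Complex.ext <;> simp

theorem exists_norm_le_of_tendsto_zero {w : ℝ → ℂ} (hw : Continuous w)
    (ht : Tendsto w atTop (𝓝 0)) (hb : Tendsto w atBot (𝓝 0)) : ∃ B, 0 ≤ B ∧ ∀ x, ‖w x‖ ≤ B := by
  have h : Tendsto w (cocompact ℝ) (𝓝 0) := by
    rw [cocompact_eq_atBot_atTop]
    exact hb.sup ht
  obtain ⟨C, hC⟩ := (ZeroAtInftyContinuousMap.isBounded_range
    (⟨⟨w, hw⟩, h⟩ : ZeroAtInftyContinuousMap ℝ ℂ)).exists_norm_le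
  exact ⟨C, (norm_nonneg _).trans (hC _ (mem_range_self 0)), fun x => hC _ (mem_range_self x)⟩

/-- Landau's argument: over a unit step w(x + 1) - w(x) differs from w'(x) by at most N. -/
theorem norm_deriv_le_of_norm_deriv_deriv_le {w : ℝ → ℂ} (hw : Differentiable ℝ w)
    (hw' : Differentiable ℝ (deriv w)) {B N : ℝ} (hB : ∀ x, ‖w x‖ ≤ B)
    (hN : ∀ x, ‖deriv (deriv w) x‖ ≤ N) (x : ℝ) : ‖deriv w x‖ ≤ 2 * B + N := by
  have h1 : ∀ y ∈ Icc x (x + 1), ‖deriv w y - deriv w x‖ ≤ N := by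
    intro y hy
    have := (convex_univ (𝕜 := ℝ)).norm_image_sub_le_of_norm_deriv_le
      (fun z _ => hw' z) (fun z _ => hN z) (mem_univ x) (mem_univ y)
    refine this.trans ?_
    have hN0 : 0 ≤ N := (norm_nonneg _).trans (hN 0)
    rw [Real.norm_of_nonneg (by linarith [hy.1])]
    nlinarith [hy.2]
  have hd : ∀ y, HasDerivAt (fun y : ℝ => w y - (y : ℂ) * deriv w x) (deriv w y - deriv w x) y := by
    intro y
    have := (hw y).hasDerivAt.sub ((Complex.ofRealCLM.hasDerivAt (x := y)).mul_const (deriv w x))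
    simpa using! this
  have h2 := (convex_Icc x (x + 1)).norm_image_sub_le_of_norm_deriv_le
    (f := fun y : ℝ => w y - (y : ℂ) * deriv w x) (fun y _ => (hd y).differentiableAt)
    (fun y hy => by rw [(hd y).deriv]; exact h1 y hy)
    (left_mem_Icc.2 (by linarith)) (right_mem_Icc.2 (by linarith))
  have e : deriv w x = (w (x + 1) - w x) -
      ((w (x + 1) - ((x + 1 : ℝ) : ℂ) * deriv w x) - (w x - (x : ℂ) * deriv w x)) := by
    push_cast
    ring
  rw [e]
  refine (norm_sub_le _ _).trans ?_
  have h3 := (norm_sub_le (w (x + 1)) (w x)).trans (add_le_add (hB _) (hB _))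
  simp only [add_sub_cancel_left, norm_one, mul_one] at h2
  linarith

/-- Two integrations by parts on the line, without boundary terms because the products are
integrable; the middle ones need the bound on w' interpolated from w and w''. -/
theorem integral_mul_deriv_deriv_eq {φ φ' φ'' w : ℝ → ℂ} (hφ : ∀ x, HasDerivAt φ (φ' x) x)
    (hφ' : ∀ x, HasDerivAt φ' (φ'' x) x) (i0 : Integrable φ) (i1 : Integrable φ')
    (i2 : Integrable φ'') (hw : Differentiable ℝ w) (hw' : Differentiable ℝ (deriv w)) {B N : ℝ}
    (hB : ∀ x, ‖w x‖ ≤ B) (hN : ∀ x, ‖deriv (deriv w) x‖ ≤ N) :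
    ∫ x, φ x * deriv (deriv w) x = ∫ x, φ'' x * w x := by
  have hD := norm_deriv_le_of_norm_deriv_deriv_le hw hw' hB hN
  have m0 : AEStronglyMeasurable w := hw.continuous.aestronglyMeasurable
  have m1 : AEStronglyMeasurable (deriv w) := hw'.continuous.aestronglyMeasurable
  have m2 : AEStronglyMeasurable (deriv (deriv w)) := aestronglyMeasurable_deriv _ _
  have a : ∫ x, φ x * deriv (deriv w) x = -∫ x, φ' x * deriv w x :=
    integral_mul_deriv_eq_deriv_mul_of_integrable (fun x _ => hφ x) (fun x _ => (hw' x).hasDerivAt)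
      (i0.mul_bdd m2 (Eventually.of_forall hN)) (i1.mul_bdd m1 (Eventually.of_forall hD))
      (i0.mul_bdd m1 (Eventually.of_forall hD))
  have b : ∫ x, φ' x * deriv w x = -∫ x, φ'' x * w x :=
    integral_mul_deriv_eq_deriv_mul_of_integrable (fun x _ => hφ' x) (fun x _ => (hw x).hasDerivAt)
      (i1.mul_bdd m1 (Eventually.of_forall hD)) (i2.mul_bdd m0 (Eventually.of_forall hB))
      (i1.mul_bdd m0 (Eventually.of_forall hB))
  rw [a, b, neg_neg]

/-! ### Compactly supported amplitudes and their Fourier transforms. -/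

/-- A `C²` function supported in `[-R, R]` that is bounded, with two derivatives, by `A`. -/
structure BandLimited (R A : ℝ) (χ : ℝ → ℂ) : Prop where
  contDiff : ContDiff ℝ 2 χ
  eq_zero : ∀ p, R < |p| → χ p = 0
  bound : ∀ p, ‖χ p‖ ≤ A
  bound_deriv : ∀ p, ‖deriv χ p‖ ≤ A
  bound_deriv_deriv : ∀ p, ‖deriv (deriv χ) p‖ ≤ A

namespace BandLimited

variable {R A : ℝ} {χ : ℝ → ℂ}

theorem differentiable (h : BandLimited R A χ) : Differentiable ℝ χ :=
  h.contDiff.differentiable (by norm_num)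

theorem contDiff_deriv (h : BandLimited R A χ) : ContDiff ℝ 1 (deriv χ) :=
  (contDiff_succ_iff_deriv (n := 1).1 (by exact h.contDiff)).2.2

theorem deriv_eq_zero {f : ℝ → ℂ} (h : ∀ p, R < |p| → f p = 0) (p : ℝ) (hp : R < |p|) :
    deriv f p = 0 := by
  have : f =ᶠ[𝓝 p] fun _ => 0 := by
    filter_upwards [continuous_abs.continuousAt.eventually (lt_mem_nhds hp)] with q hq
    exact h q hq
  rw [this.deriv_eq, deriv_const]

theorem continuous_deriv_deriv (h : BandLimited R A χ) : Continuous (deriv (deriv χ)) :=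
  h.contDiff_deriv.continuous_deriv le_rfl

/-- The constant comes from (pχ)'' = 2χ' + pχ''. Each factor p costs only R + 2, so n factors p²
cost a geometric amount. -/
theorem mul_id (h : BandLimited R A χ) (hR : 0 ≤ R) :
    BandLimited R ((R + 2) * A) fun p => (p : ℂ) * χ p := by
  have hA : 0 ≤ A := (norm_nonneg _).trans (h.bound 0)
  have key : ∀ {f : ℝ → ℂ}, (∀ p, R < |p| → f p = 0) → (∀ p, ‖f p‖ ≤ A) →
      ∀ p : ℝ, ‖(p : ℂ) * f p‖ ≤ R * A := by
    intro f hf hfb p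
    rcases lt_or_ge R |p| with hp | hp
    · rw [hf p hp, mul_zero, norm_zero]
      positivity
    · rw [norm_mul, Complex.norm_real]
      exact mul_le_mul hp (hfb p) (norm_nonneg _) hR
  have of : ∀ p, HasDerivAt (fun p : ℝ => (p : ℂ)) 1 p := fun p => by
    simpa using! Complex.ofRealCLM.hasDerivAt (x := p)
  have d1 : deriv (fun p : ℝ => (p : ℂ) * χ p) = fun p : ℝ => χ p + (p : ℂ) * deriv χ p := by
    funext p
    have := ((of p).mul (h.differentiable p).hasDerivAt).deriv
    rw [one_mul] at this
    exact this
  have d2 : deriv (deriv (fun p : ℝ => (p : ℂ) * χ p)) =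
      fun p : ℝ => 2 * deriv χ p + (p : ℂ) * deriv (deriv χ) p := by
    rw [d1]
    funext p
    have := ((h.differentiable p).hasDerivAt.add ((of p).mul
      (h.contDiff_deriv.differentiable one_ne_zero p).hasDerivAt)).deriv
    rw [one_mul, ← add_assoc, ← two_mul] at this
    exact this
  have z1 := deriv_eq_zero h.eq_zero
  have z2 := deriv_eq_zero z1
  refine ⟨Complex.ofRealCLM.contDiff.mul h.contDiff, fun p hp => by rw [h.eq_zero p hp, mul_zero],
    fun p => ?_, fun p => ?_, fun p => ?_⟩
  · linarith [key h.eq_zero h.bound p]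
  · rw [d1]
    have := (norm_add_le _ _).trans (add_le_add (h.bound p) (key z1 h.bound_deriv p))
    linarith
  · rw [d2]
    have := (norm_add_le _ _).trans (add_le_add ((norm_mul (2 : ℂ) _).le.trans
      (mul_le_mul_of_nonneg_left (h.bound_deriv p) (norm_nonneg _)))
      (key z2 h.bound_deriv_deriv p))
    rw [Complex.norm_ofNat] at this
    linarith

theorem const_mul (h : BandLimited R A χ) (c : ℂ) : BandLimited R (‖c‖ * A) fun p => c * χ p := by
  have d1 : deriv (fun p => c * χ p) = fun p => c * deriv χ p := by
    funext p
    exact ((h.differentiable p).hasDerivAt.const_mul c).deriv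
  have d2 : deriv (fun p => c * deriv χ p) = fun p => c * deriv (deriv χ) p := by
    funext p
    exact ((h.contDiff_deriv.differentiable one_ne_zero p).hasDerivAt.const_mul c).deriv
  refine ⟨contDiff_const.mul h.contDiff, fun p hp => by rw [h.eq_zero p hp, mul_zero],
    fun p => ?_, fun p => ?_, fun p => ?_⟩
  · rw [norm_mul]
    exact mul_le_mul_of_nonneg_left (h.bound p) (norm_nonneg _)
  · rw [d1, norm_mul]
    exact mul_le_mul_of_nonneg_left (h.bound_deriv p) (norm_nonneg _)
  · rw [d1, d2, norm_mul]
    exact mul_le_mul_of_nonneg_left (h.bound_deriv_deriv p) (norm_nonneg _)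

theorem exists_of_hasCompactSupport {f : ℝ → ℂ} (hf : ContDiff ℝ 2 f) (hs : HasCompactSupport f) :
    ∃ R A, 0 ≤ R ∧ BandLimited R A f := by
  have c1 : ContDiff ℝ 1 (deriv f) := (contDiff_succ_iff_deriv (n := 1).1 (by exact hf)).2.2
  obtain ⟨A0, h0⟩ := hs.exists_bound_of_continuous hf.continuous
  obtain ⟨A1, h1⟩ := hs.deriv.exists_bound_of_continuous c1.continuous
  obtain ⟨A2, h2⟩ := hs.deriv.deriv.exists_bound_of_continuous (c1.continuous_deriv le_rfl)
  obtain ⟨R, hR⟩ := hs.isCompact.isBounded.exists_norm_le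
  refine ⟨max R 0, max A0 (max A1 A2), le_max_right _ _, hf, fun p hp => ?_, fun p => ?_,
    fun p => ?_, fun p => ?_⟩
  · by_contra hne
    exact absurd ((hR p (subset_tsupport f hne)).trans (le_max_left R 0)) (not_le.2 hp)
  · exact (h0 p).trans (le_max_left _ _)
  · exact (h1 p).trans ((le_max_left _ _).trans (le_max_right _ _))
  · exact (h2 p).trans ((le_max_right _ _).trans (le_max_right _ _))

theorem integrable_of_eq_zero {f : ℝ → ℂ} (hc : Continuous f) (h0 : ∀ p, R < |p| → f p = 0)
    (hb : ∀ p, ‖f p‖ ≤ A) (hR : 0 ≤ R) : Integrable f ∧ ∫ p, ‖f p‖ ≤ 2 * R * A := by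
  have hs : Function.support f ⊆ Icc (-R) R := by
    intro p hp
    refine abs_le.1 ?_
    by_contra hne
    exact hp (h0 p (not_le.1 hne))
  refine ⟨hc.integrable_of_hasCompactSupport
    (HasCompactSupport.of_support_subset_isCompact isCompact_Icc hs), ?_⟩
  have hs' : (Function.support fun p => ‖f p‖) ⊆ Icc (-R) R := by
    intro p hp
    exact hs (norm_ne_zero_iff.1 hp)
  rw [← setIntegral_eq_integral_of_forall_compl_eq_zero fun p hp => by
    by_contra hne
    exact hp (hs' hne)]
  have := norm_setIntegral_le_of_norm_le_const (μ := volume) (f := fun p => ‖f p‖)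
    (s := Icc (-R) R) (C := A) (by simp) (fun p _ => by rw [norm_norm]; exact hb p)
  rw [Real.norm_eq_abs] at this
  refine (le_abs_self _).trans (this.trans_eq ?_)
  rw [measureReal_def, Real.volume_Icc, ENNReal.toReal_ofReal (by linarith)]
  ring

theorem integrable (h : BandLimited R A χ) (hR : 0 ≤ R) : Integrable χ :=
  (integrable_of_eq_zero h.contDiff.continuous h.eq_zero h.bound hR).1

/-- χ̂ and x² χ̂, the latter up to sign the transform of χ'', are each bounded by an L¹ norm of at
most 2RA. -/
theorem norm_fourierHat_le (h : BandLimited R A χ) (hR : 0 ≤ R) (x : ℝ) :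
    ‖fourierHat χ x‖ ≤ 4 * R * A * (1 + x ^ 2)⁻¹ := by
  have z1 := deriv_eq_zero h.eq_zero
  have z2 := deriv_eq_zero z1
  have I0 := integrable_of_eq_zero h.contDiff.continuous h.eq_zero h.bound hR
  have I1 := integrable_of_eq_zero h.contDiff_deriv.continuous z1 h.bound_deriv hR
  have I2 := integrable_of_eq_zero h.continuous_deriv_deriv z2 h.bound_deriv_deriv hR
  have e : fourierHat (deriv (deriv χ)) x = -(x : ℂ) ^ 2 * fourierHat χ x := by
    rw [fourierHat_eq, fourierHat_eq, Real.fourier_deriv I1.1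
      (h.contDiff_deriv.differentiable one_ne_zero) I2.1, Real.fourier_deriv I0.1 h.differentiable I1.1]
    have : (Real.pi : ℂ) ≠ 0 := by exact_mod_cast Real.pi_ne_zero
    simp only [smul_eq_mul]
    push_cast
    have hx : 2 * (Real.pi : ℂ) * Complex.I * (x / (2 * Real.pi)) = Complex.I * x := by
      field_simp
    rw [hx, ← mul_assoc, ← sq, mul_pow, Complex.I_sq]
    ring
  have b0 := (_root_.norm_fourierHat_le χ x).trans I0.2
  have b2 := (_root_.norm_fourierHat_le (deriv (deriv χ)) x).trans I2.2
  rw [e, norm_mul, norm_neg, norm_pow, Complex.norm_real, Real.norm_eq_abs, sq_abs] at b2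
  rw [← div_eq_mul_inv, le_div_iff₀ (by positivity)]
  linarith

theorem integrable_fourierHat (h : BandLimited R A χ) (hR : 0 ≤ R) :
    Integrable (fourierHat χ) ∧ ∫ x, ‖fourierHat χ x‖ ≤ 4 * R * A * Real.pi := by
  have hi : Integrable fun x : ℝ => 4 * R * A * (1 + x ^ 2)⁻¹ :=
    integrable_inv_one_add_sq.const_mul _
  have h1 : Integrable (fourierHat χ) := hi.mono'
    (continuous_fourierHat (h.integrable hR)).aestronglyMeasurable
    (Eventually.of_forall (h.norm_fourierHat_le hR))
  refine ⟨h1, (integral_mono h1.norm hi (h.norm_fourierHat_le hR)).trans_eq ?_⟩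
  rw [integral_const_mul, integral_univ_inv_one_add_sq]

theorem hasDerivAt_fourierHat (h : BandLimited R A χ) (hR : 0 ≤ R) (x : ℝ) :
    HasDerivAt (fourierHat χ) (fourierHat (fun p => -Complex.I * (p * χ p)) x) x := by
  have e : ∀ f : ℝ → ℂ, ∀ x, fourierHat f x = (2 * Real.pi : ℂ) * fourierInvHat f (-x) := by
    intro f x
    rw [fourierInvHat, ← mul_assoc, mul_one_div, div_self (by simp), one_mul,
      fourierHat]
    congr 1
    funext p
    push_cast
    congr 2
    ring
  have i1 : Integrable fun p : ℝ => Complex.I * p * χ p := by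
    simpa only [mul_assoc] using ((h.mul_id hR).integrable hR).const_mul Complex.I
  have h1 := ((hasDerivAt_fourierInvHat (h.integrable hR) i1 (-x)).scomp x
    (hasDerivAt_neg x)).const_mul (2 * Real.pi : ℂ)
  have h2 : fourierHat χ = fun x => (2 * Real.pi : ℂ) * fourierInvHat χ (-x) := funext (e χ)
  rw [h2, e]
  convert! h1 using 2
  rw [neg_smul, one_smul, ← neg_one_mul (fourierInvHat _ _), ← fourierInvHat_const_mul]
  congr 1
  funext p
  ring

end BandLimited

theorem integral_fourierHat_mul {g χ : ℝ → ℂ} (hg : Integrable g) (hχ : Integrable χ) :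
    ∫ p, fourierHat g p * χ p = ∫ x, fourierHat χ x * g x := by
  have hexp : Continuous fun z : ℝ × ℝ => Complex.exp (-(Complex.I * z.1 * z.2)) := by fun_prop
  have hi : Integrable fun z : ℝ × ℝ =>
      Complex.exp (-(Complex.I * z.1 * z.2)) * (χ z.1 * g z.2) := by
    have := hχ.mul_prod hg
    refine this.norm.mono' (hexp.aestronglyMeasurable.mul this.aestronglyMeasurable) ?_
    exact Eventually.of_forall fun z => by rw [norm_mul, norm_exp_neg_I_mul, one_mul]
  calc ∫ p, fourierHat g p * χ p
      = ∫ p : ℝ, ∫ x : ℝ, Complex.exp (-(Complex.I * p * x)) * (χ p * g x) := by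
        congr 1
        funext p
        rw [fourierHat, ← integral_mul_const]
        congr 1
        funext x
        ring
    _ = ∫ x : ℝ, ∫ p : ℝ, Complex.exp (-(Complex.I * p * x)) * (χ p * g x) :=
        integral_integral_swap hi
    _ = _ := by
        congr 1
        funext x
        rw [fourierHat, ← integral_mul_const]
        congr 1
        funext p
        rw [mul_right_comm Complex.I (p : ℂ)]
        ring

/-! ### Consequences of a dominated time derivative. -/

/-- The majorant is made measurable and extended by zero, so that it can enter half-line
convolutions and Fubini. -/
theorem HasDominatedTimeDeriv.exists_majorant {u : ℝ → ℝ → ℂ} (hd : HasDominatedTimeDeriv u) {b : ℝ}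
    (hb : 0 < b) : ∃ m : ℝ → ℝ, StronglyMeasurable m ∧ Integrable m ∧ (∀ t ≤ 0, m t = 0) ∧
      ∀ x, ∀ᵐ t, ‖(Ioo 0 b).indicator (deriv (u x)) t‖ ≤ m t := by
  obtain ⟨m, hm, h⟩ := hd b hb
  refine ⟨(Ioo 0 b).indicator (hm.1.mk m), hm.1.stronglyMeasurable_mk.indicator measurableSet_Ioo,
    (integrable_indicator_iff measurableSet_Ioo).2 (hm.congr hm.1.ae_eq_mk),
    fun t ht => indicator_of_notMem (fun h => ht.not_gt h.1) _, fun x => ?_⟩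
  filter_upwards [(ae_restrict_iff' measurableSet_Ioo).1 (h x),
    (ae_restrict_iff' measurableSet_Ioo).1 hm.1.ae_eq_mk] with t ht he
  by_cases htb : t ∈ Ioo 0 b
  · rw [indicator_of_mem htb, indicator_of_mem htb, ← he htb]
    exact ht htb
  · rw [indicator_of_notMem htb, indicator_of_notMem htb, norm_zero]

section

variable {u : ℝ → ℝ → ℂ} {b : ℝ} {m : ℝ → ℝ}

theorem indicator_deriv_ae_eq (v : ℝ → ℂ) {t : ℝ} (htb : t ≤ b) :
    ∀ᵐ s, s ∈ Ioc 0 t → deriv v s = (Ioo 0 b).indicator (deriv v) s := by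
  have h0 : ∀ᵐ s : ℝ, s ≠ t := by simp [ae_iff, measure_singleton]
  filter_upwards [h0] with s hs hst
  exact (indicator_of_mem (show s ∈ Ioo 0 b from
    ⟨hst.1, (lt_of_le_of_ne hst.2 hs).trans_le htb⟩) _).symm

theorem norm_sub_le_of_deriv_majorant (hac : ∀ x, AbsolutelyContinuousOnInterval (u x) 0 b)
    (hmi : Integrable m) (hm : ∀ x, ∀ᵐ t, ‖(Ioo 0 b).indicator (deriv (u x)) t‖ ≤ m t) (x : ℝ)
    {s t : ℝ} (hs : s ∈ Icc 0 b) (ht : t ∈ Icc 0 b) :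
    ‖u x t - u x s‖ ≤ |(∫ r in (0 : ℝ)..t, m r) - ∫ r in (0 : ℝ)..s, m r| := by
  have hb : 0 ≤ b := hs.1.trans hs.2
  have hac' : AbsolutelyContinuousOnInterval (u x) s t := by
    refine (hac x).mono ?_
    rw [uIcc_of_le hb]
    exact (convex_Icc 0 b).ordConnected.uIcc_subset hs ht
  rw [intervalIntegral.integral_interval_sub_left hmi.intervalIntegrable hmi.intervalIntegrable,
    ← hac'.integral_deriv_complex.2]
  refine intervalIntegral.norm_integral_le_abs_of_norm_le ?_ hmi.intervalIntegrable
  refine (ae_restrict_iff' measurableSet_uIoc).2 ?_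
  filter_upwards [indicator_deriv_ae_eq (u x) (le_refl b), hm x] with r hr hmr hrst
  rwa [hr]
  exact ⟨(le_min hs.1 ht.1).trans_lt hrst.1, hrst.2.trans (max_le hs.2 ht.2)⟩

/-- The primitive of m is a modulus of continuity in t, uniform in x. Together with continuity in x
for t > 0 it gives joint continuity; at t = 0 continuity in x passes to a uniform limit. Clamping t
extends the function to the whole plane. -/
theorem continuous_clamp (hb : 0 < b) (hac : ∀ x, AbsolutelyContinuousOnInterval (u x) 0 b)
    (hmi : Integrable m) (hm : ∀ x, ∀ᵐ t, ‖(Ioo 0 b).indicator (deriv (u x)) t‖ ≤ m t)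
    (hu : ∀ t > 0, Continuous fun x => u x t) :
    Continuous fun z : ℝ × ℝ => u z.1 (max 0 (min z.2 b)) := by
  have hM : Continuous fun t => ∫ r in (0 : ℝ)..t, m r :=
    intervalIntegral.continuous_primitive (fun _ _ => hmi.intervalIntegrable) 0
  have hcl : ∀ t : ℝ, max 0 (min t b) ∈ Icc 0 b := fun t =>
    ⟨le_max_left _ _, max_le hb.le (min_le_right _ _)⟩
  have hx : ∀ t ∈ Icc 0 b, Continuous fun x => u x t := by
    intro t ht
    rcases ht.1.eq_or_lt with rfl | h0
    · refine continuous_of_uniform_approx_of_continuous fun U hU => ?_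
      obtain ⟨ε, hε, hεU⟩ := Metric.mem_uniformity_dist.1 hU
      have h1 : ∀ᶠ s in 𝓝[>] 0, |(∫ r in (0 : ℝ)..0, m r) - ∫ r in (0 : ℝ)..s, m r| < ε := by
        refine nhdsWithin_le_nhds ((continuous_const.sub hM).abs.continuousAt.eventually_lt
          continuousAt_const ?_)
        simpa using hε
      obtain ⟨s, hs, hsb⟩ := (h1.and (Ioo_mem_nhdsGT hb)).exists
      refine ⟨fun x => u x s, hu s hsb.1, fun x => hεU ?_⟩
      rw [dist_eq_norm]
      exact (norm_sub_le_of_deriv_majorant hac hmi hm x (Ioo_subset_Icc_self hsb)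
        (left_mem_Icc.2 hb.le)).trans_lt hs
    · exact hu t h0
  rw [continuous_iff_continuousAt]
  rintro ⟨x₀, t₀⟩
  have h1 : Tendsto (fun z : ℝ × ℝ => |(∫ r in (0 : ℝ)..(max 0 (min z.2 b)), m r) -
      ∫ r in (0 : ℝ)..(max 0 (min t₀ b)), m r| +
      ‖u z.1 (max 0 (min t₀ b)) - u x₀ (max 0 (min t₀ b))‖) (𝓝 (x₀, t₀)) (𝓝 0) := by
    have hc : Continuous fun z : ℝ × ℝ => |(∫ r in (0 : ℝ)..(max 0 (min z.2 b)), m r) -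
      ∫ r in (0 : ℝ)..(max 0 (min t₀ b)), m r| +
      ‖u z.1 (max 0 (min t₀ b)) - u x₀ (max 0 (min t₀ b))‖ := by
      have := (hx _ (hcl t₀)).comp (continuous_fst (X := ℝ) (Y := ℝ))
      have h2 := hM.comp (show Continuous fun z : ℝ × ℝ => max 0 (min z.2 b) by fun_prop)
      exact (h2.sub continuous_const).abs.add (this.sub continuous_const).norm
    simpa using hc.tendsto (x₀, t₀)
  rw [ContinuousAt, tendsto_iff_norm_sub_tendsto_zero]
  refine squeeze_zero (fun _ => norm_nonneg _) (fun z => ?_) h1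
  refine (norm_sub_le_norm_sub_add_norm_sub _ (u z.1 (max 0 (min t₀ b))) _).trans ?_
  exact add_le_add_left (norm_sub_le_of_deriv_majorant hac hmi hm z.1 (hcl _) (hcl _)) _

/-- The slice t = b is continuous and tends to 0 at ±∞, hence bounded; the primitive of m carries
the bound to the other times. -/
theorem exists_norm_le_of_deriv_majorant (hb : 0 < b)
    (hac : ∀ x, AbsolutelyContinuousOnInterval (u x) 0 b)
    (hmi : Integrable m) (hm : ∀ x, ∀ᵐ t, ‖(Ioo 0 b).indicator (deriv (u x)) t‖ ≤ m t)
    (hc : Continuous fun x => u x b) (ht : Tendsto (fun x => u x b) atTop (𝓝 0))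
    (hbot : Tendsto (fun x => u x b) atBot (𝓝 0)) :
    ∃ B, 0 ≤ B ∧ ∀ x, ∀ t ∈ Icc 0 b, ‖u x t‖ ≤ B := by
  obtain ⟨B, hB0, hB⟩ := exists_norm_le_of_tendsto_zero hc ht hbot
  have hM : Continuous fun t => ∫ r in (0 : ℝ)..t, m r :=
    intervalIntegral.continuous_primitive (fun _ _ => hmi.intervalIntegrable) 0
  obtain ⟨C, hC⟩ := isCompact_Icc.exists_bound_of_continuousOn (s := Icc 0 b)
    (continuous_const.sub hM : Continuous fun t =>
      (∫ r in (0 : ℝ)..b, m r) - ∫ r in (0 : ℝ)..t, m r).continuousOn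
  have hC0 : 0 ≤ C := (norm_nonneg _).trans (hC 0 (left_mem_Icc.2 hb.le))
  refine ⟨B + C, by positivity, fun x t ht => ?_⟩
  have h1 := norm_sub_le_of_deriv_majorant hac hmi hm x ht (right_mem_Icc.2 hb.le)
  have h2 := norm_sub_le (u x b) (u x b - u x t)
  rw [sub_sub_cancel] at h2
  exact h2.trans (add_le_add (hB x) (h1.trans (hC t ht)))

/-- Derivatives of a jointly continuous family are jointly measurable, and on (0, b) the clamp does
not change them. -/
theorem stronglyMeasurable_indicator_deriv
    (hc : Continuous fun z : ℝ × ℝ => u z.1 (max 0 (min z.2 b))) :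
    StronglyMeasurable fun z : ℝ × ℝ => (Ioo 0 b).indicator (deriv (u z.1)) z.2 := by
  have h := (stronglyMeasurable_deriv_with_param (𝕜 := ℝ)
    (f := fun x t => u x (max 0 (min t b))) hc).indicator
    (measurable_snd (measurableSet_Ioo (a := (0 : ℝ)) (b := b)))
  convert h using 1
  funext z
  by_cases hz : z.2 ∈ Ioo 0 b
  · rw [indicator_of_mem hz, indicator_of_mem (show z ∈ Prod.snd ⁻¹' Ioo 0 b from hz)]
    refine Filter.EventuallyEq.deriv_eq ?_
    filter_upwards [isOpen_Ioo.mem_nhds hz] with s hs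
    rw [min_eq_left hs.2.le, max_eq_right hs.1.le]
  · rw [indicator_of_notMem hz, indicator_of_notMem (show z ∉ Prod.snd ⁻¹' Ioo 0 b from hz)]

/-- Pairing in the space variable commutes with convolution in the time variable. -/
theorem hconv_integral_mul {f : ℝ → ℝ → ℂ} (hf : StronglyMeasurable fun z : ℝ × ℝ => f z.1 z.2)
    (hmS : StronglyMeasurable m) (hm : ∀ x, ∀ᵐ t, ‖f x t‖ ≤ m t) {φ : ℝ → ℂ} (hφ : Integrable φ)
    {κ : ℝ → ℝ} (hκ : StronglyMeasurable κ) {t : ℝ}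
    (hint : Integrable fun s => κ (t - s) * m s) :
    hconv κ (fun s => ∫ x, φ x * f x s) t = ∫ x, φ x * hconv κ (f x) t ∧
    Integrable fun s => κ (t - s) • ∫ x, φ x * f x s := by
  have hae : ∀ᵐ z : ℝ × ℝ, ‖f z.1 z.2‖ ≤ m z.2 := by
    rw [Measure.volume_eq_prod, Measure.ae_prod_iff_ae_ae]
    · exact Eventually.of_forall hm
    · exact measurableSet_le hf.norm.measurable (hmS.measurable.comp measurable_snd)
  have hi : Integrable fun z : ℝ × ℝ => κ (t - z.2) • (φ z.1 * f z.1 z.2) := by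
    have h1 : Integrable fun z : ℝ × ℝ => ‖φ z.1‖ * ‖κ (t - z.2) * m z.2‖ :=
      hφ.norm.mul_prod hint.norm
    refine h1.mono' ?_ ?_
    · exact (hκ.comp_measurable (measurable_const.sub measurable_snd)).aestronglyMeasurable.smul
        (hφ.aestronglyMeasurable.comp_fst.mul hf.aestronglyMeasurable)
    · filter_upwards [hae] with z hz
      rw [norm_smul, norm_mul, norm_mul, mul_left_comm]
      gcongr
      exact hz.trans (le_abs_self _)
  have hi' := hi.swap
  have e1 : ∀ s, κ (t - s) • ∫ x, φ x * f x s = ∫ x, κ (t - s) • (φ x * f x s) := fun s =>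
    (integral_smul _ _).symm
  constructor
  · simp only [hconv, e1]
    rw [integral_integral_swap (f := fun s x => κ (t - s) • (φ x * f x s)) hi']
    congr 1
    funext x
    rw [← integral_const_mul]
    congr 1
    funext s
    rw [mul_smul_comm]
  · simp_rw [e1]
    exact hi'.integral_prod_left

end

/-! ### The weak Volterra equation satisfied by a solution. -/

/-- The pairing `∫ φ(x) u(x,t) dx`, cut off to the time interval `(0,b)`. -/
noncomputable def spacePairing (b : ℝ) (u : ℝ → ℝ → ℂ) (φ : ℝ → ℂ) : ℝ → ℂ :=
  (Ioo 0 b).indicator fun t => ∫ x, φ x * u x t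

theorem norm_spacePairing_le {b B : ℝ} {u : ℝ → ℝ → ℂ} (hB : ∀ x, ∀ t ∈ Icc 0 b, ‖u x t‖ ≤ B)
    (hB0 : 0 ≤ B) {φ : ℝ → ℂ} (hφ : Integrable φ) (t : ℝ) :
    ‖spacePairing b u φ t‖ ≤ B * (∫ x, ‖φ x‖) * rlKernel 1 t := by
  by_cases ht : t ∈ Ioo 0 b
  · rw [spacePairing, indicator_of_mem ht, rlKernel_one ht.1, mul_one, mul_comm,
      ← integral_mul_const]
    refine norm_integral_le_of_norm_le (hφ.norm.mul_const B) (Eventually.of_forall fun x => ?_)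
    rw [norm_mul]
    exact mul_le_mul_of_nonneg_left (hB x t (Ioo_subset_Icc_self ht)) (norm_nonneg _)
  · rw [spacePairing, indicator_of_notMem ht, norm_zero]
    have := rlKernel_nonneg one_pos t
    positivity

theorem powBound_spacePairing {b B : ℝ} {u : ℝ → ℝ → ℂ}
    (hc : Continuous fun z : ℝ × ℝ => u z.1 (max 0 (min z.2 b)))
    (hB : ∀ x, ∀ t ∈ Icc 0 b, ‖u x t‖ ≤ B) (hB0 : 0 ≤ B) {φ : ℝ → ℂ} (hφ : Continuous φ)
    (hφ' : Integrable φ) : PowBound 1 (spacePairing b u φ) := by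
  refine ⟨?_, fun _ => ⟨_, by positivity, fun t _ => norm_spacePairing_le hB hB0 hφ' t⟩⟩
  have h : StronglyMeasurable fun z : ℝ × ℝ => φ z.1 * u z.1 (max 0 (min z.2 b)) :=
    ((hφ.comp continuous_fst).mul hc).stronglyMeasurable
  have h' := (h.integral_prod_left' (μ := volume)).indicator (measurableSet_Ioo (a := (0 : ℝ)) (b := b))
  convert h' using 1
  funext t
  by_cases ht : t ∈ Ioo 0 b
  · rw [spacePairing, indicator_of_mem ht, indicator_of_mem ht]
    dsimp only
    rw [min_eq_left ht.2.le, max_eq_right ht.1.le]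
  · rw [spacePairing, indicator_of_notMem ht, indicator_of_notMem ht]

section

variable {ρ ω γ μ K : ℝ} {g : ℝ → ℂ} {u : ℝ → ℝ → ℂ} {b : ℝ}

theorem IsDiffusionSolution.apply_zero (hu : IsDiffusionSolution ρ ω γ μ K g u) (x : ℝ) :
    u x 0 = g x := by
  have h := (hu.absCont x 1 one_pos).continuousOn
  rw [uIcc_of_le zero_le_one] at h
  have h1 := (h 0 (left_mem_Icc.2 zero_le_one)).tendsto.mono_left
    (nhdsWithin_le_iff.2 (Icc_mem_nhdsGT_of_mem ⟨le_rfl, one_pos⟩))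
  exact tendsto_nhds_unique h1 (hu.initial x)

/-- The convolution of two L¹ functions exists almost everywhere; cutting k off at b makes it
integrable. -/
theorem ae_integrable_mul_of_powBound {α : ℝ} (hα : 0 < α) {k m : ℝ → ℝ} (hk : PowBound α k)
    (hm : Integrable m) (hm0 : ∀ t ≤ 0, m t = 0) (b : ℝ) :
    ∀ᵐ t, t ≤ b → Integrable fun s => k (t - s) * m s := by
  have hk' : Integrable ((Iic b).indicator k) :=
    (hk.integrableOn hα b).integrable_indicator measurableSet_Iic
  filter_upwards [hm.ae_convolution_exists (ContinuousLinearMap.mul ℝ ℝ) hk'] with t ht htb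
  refine Integrable.congr ht (Eventually.of_forall fun s => ?_)
  dsimp only
  rcases le_or_gt s 0 with hs | hs
  · simp [hm0 s hs]
  · rw [ContinuousLinearMap.mul_apply', indicator_of_mem (show t - s ∈ Iic b by rw [mem_Iic]; linarith), mul_comm]

/-- The equation tested against an integrable function of the space variable, after the time
derivative has been inverted. -/
theorem IsDiffusionSolution.exists_weak_equation (hρ : 0 < ρ) (hμ : 0 < μ) (hμ1 : μ < 1)
    (hK : 0 < K) (hu : IsDiffusionSolution ρ ω γ μ K g u) (hd : HasDominatedTimeDeriv u)
    (hb : 0 < b) : Continuous (fun z : ℝ × ℝ => u z.1 (max 0 (min z.2 b))) ∧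
      ∃ B, 0 ≤ B ∧ (∀ x, ∀ t ∈ Icc 0 b, ‖u x t‖ ≤ B) ∧
      ∀ φ φ' φ'' : ℝ → ℂ, (∀ x, HasDerivAt φ (φ' x) x) → (∀ x, HasDerivAt φ' (φ'' x) x) →
        Integrable φ → Integrable φ' → Integrable φ'' → ∀ t ∈ Ioo 0 b,
        spacePairing b u φ t = (∫ x, φ x * g x) +
          K • hconv (prabhakarSeries ρ ω μ γ) (spacePairing b u φ'') t := by
  obtain ⟨m, hmS, hmi, hm0, hm⟩ := hd.exists_majorant hb
  have hac : ∀ x, AbsolutelyContinuousOnInterval (u x) 0 b := fun x => hu.absCont x b hb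
  have hcl := continuous_clamp hb hac hmi hm fun t ht => (hu.diff t ht).continuous
  obtain ⟨B, hB0, hB⟩ := exists_norm_le_of_deriv_majorant hb hac hmi hm
    (hu.diff b hb).continuous (hu.decay_top b hb) (hu.decay_bot b hb)
  refine ⟨hcl, B, hB0, hB, fun φ φ' φ'' d1 d2 i0 i1 i2 t ht => ?_⟩
  have hμ' : 0 < 1 - μ := by linarith
  set h := prabhakarSeries ρ ω μ γ with hh
  set k := prabhakarSeries ρ ω (1 - μ) (-γ) with hk
  have ph : PowBound μ h := powBound_prabhakarSeries γ hρ hμ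
  have pk : PowBound (1 - μ) k := powBound_prabhakarSeries (-γ) hρ hμ'
  set f : ℝ → ℝ → ℂ := fun x s => (Ioo 0 b).indicator (deriv (u x)) s with hf
  have fS : StronglyMeasurable fun z : ℝ × ℝ => f z.1 z.2 := stronglyMeasurable_indicator_deriv hcl
  have f0 : ∀ x, ∀ s ≤ 0, f x s = 0 := fun x s hs =>
    indicator_of_notMem (fun h => hs.not_gt h.1) _
  have φc : Continuous φ := continuous_iff_continuousAt.2 fun x => (d1 x).continuousAt
  -- F is the pairing of φ with ∂u/∂t. The plan is to evaluate h * k * F in two ways: h * k = 1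
  -- gives the increment ∫ φ (u(·,t) - u(·,0)), and the equation gives K h * ∫ φ'' u.
  set F : ℝ → ℂ := fun s => ∫ x, φ x * f x s with hF
  have FS : StronglyMeasurable F := by
    have : StronglyMeasurable fun z : ℝ × ℝ => φ z.1 * f z.1 z.2 :=
      (φc.comp continuous_fst).stronglyMeasurable.mul fS
    exact this.integral_prod_left'
  have F0 : ∀ s ≤ 0, F s = 0 := fun s hs => by simp [hF, f0 _ s hs]
  have Fi : Integrable F := by
    have := (hconv_integral_mul fS hmS hm i0 (κ := fun _ => 1) stronglyMeasurable_const (t := 0)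
      (by simpa using hmi)).2
    simpa using this
  -- At almost every s the integral ∫ |k(s-r) m(r)| dr converges and bounds K u_xx(·,s) uniformly in
  -- x, which permits the integrations by parts. Almost every s is enough, since the identity is
  -- next convolved with h.
  have E1 : ∀ᵐ s, s ∈ Ioo 0 b → hconv k F s = K • spacePairing b u φ'' s := by
    filter_upwards [ae_integrable_mul_of_powBound hμ' pk hmi hm0 b] with s hs hsb
    have hsi := hs hsb.2.le
    have e : ∀ x, hconv k (f x) s = K * deriv (deriv fun y => u y s) x := by
      intro x
      rw [← hu.equation x s hsb.1, regHilferPrabhakarDeriv, prabhakarIntegral,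
        intervalIntegral.integral_of_le hsb.1.le, hconv_eq_integral (fun _ => pk.eq_zero) (f0 x)]
      exact (integral_congr_ae (prabhakarKernel_mul_deriv_ae_eq
        (indicator_deriv_ae_eq (u x) hsb.2.le))).symm
    have hN : ∀ x, ‖deriv (deriv fun y => u y s) x‖ ≤ (∫ r, ‖k (s - r) * m r‖) / K := by
      intro x
      rw [le_div_iff₀ hK, mul_comm]
      calc K * ‖deriv (deriv fun y => u y s) x‖ = ‖hconv k (f x) s‖ := by
            rw [e, norm_mul, Complex.norm_real, Real.norm_of_nonneg hK.le]
        _ ≤ ∫ r, ‖k (s - r) * m r‖ := by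
            refine norm_integral_le_of_norm_le hsi.norm ?_
            filter_upwards [hm x] with r hr
            rw [norm_smul, norm_mul]
            exact mul_le_mul_of_nonneg_left (hr.trans (le_abs_self _)) (norm_nonneg _)
    rw [(hconv_integral_mul fS hmS hm i0 pk.meas hsi).1, spacePairing, indicator_of_mem hsb,
      ← integral_mul_deriv_deriv_eq d1 d2 i0 i1 i2 (hu.diff s hsb.1) (hu.diff_two s hsb.1)
        (fun x => hB x s (Ioo_subset_Icc_self hsb)) hN, ← integral_smul]
    congr 1
    funext x
    rw [e, Complex.real_smul]
    ring
  have E2 : hconv h (hconv k F) t = K • hconv h (spacePairing b u φ'') t := by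
    rw [← hconv_const_smul_right]
    refine integral_congr_ae ?_
    filter_upwards [E1] with s hs
    rcases le_or_gt s 0 with h0 | h0
    · rw [hconv_eq_integral (fun _ => pk.eq_zero) F0, Ioc_eq_empty h0.not_gt, setIntegral_empty,
        spacePairing, indicator_of_notMem (fun h => h0.not_gt h.1), smul_zero, smul_zero, smul_zero]
    · rcases lt_or_ge s t with hst | hst
      · rw [hs ⟨h0, hst.trans ht.2⟩]
      · rw [ph.eq_zero (sub_nonpos.2 hst), zero_smul, zero_smul]
  have hk1 : hconv h k = rlKernel 1 := funext fun s => by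
    rw [hconv_comm, hk, hh, hconv_prabhakar_dual hρ hμ hμ1]
  have one_le : ∀ s, ‖rlKernel 1 s‖ ≤ 1 := fun s => by
    rcases le_or_gt s 0 with h0 | h0
    · rw [rlKernel_of_nonpos h0, norm_zero]
      exact zero_le_one
    · rw [rlKernel_one h0, norm_one]
  have m1 : ∀ t, Measurable fun s => rlKernel 1 (t - s) := fun t =>
    (measurable_rlKernel 1).comp (measurable_const.sub measurable_id)
  -- Here μ + (1 - μ) = 1 and k_1 is bounded, so integrability of F suffices for associativity.
  have E3 : hconv h (hconv k F) t = hconv (rlKernel 1) F t := by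
    rw [hconv_assoc_of_integrable hμ hμ' ph pk FS F0, hk1]
    rw [add_sub_cancel]
    exact Fi.norm.bdd_mul (m1 t).aestronglyMeasurable (Eventually.of_forall fun s => one_le _)
  have E4 : hconv (rlKernel 1) F t = ∫ x, φ x * (u x t - u x 0) := by
    rw [(hconv_integral_mul fS hmS hm i0 (measurable_rlKernel 1).stronglyMeasurable
      (hmi.bdd_mul (m1 t).aestronglyMeasurable (Eventually.of_forall fun s => one_le _))).1]
    congr 1
    funext x
    have hac' := (hac x).mono (c := 0) (d := t) (by
      rw [uIcc_of_le ht.1.le, uIcc_of_le hb.le]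
      exact Icc_subset_Icc_right ht.2.le)
    rw [hconv_one_eq (f0 x), ← hac'.integral_deriv_complex.2,
      intervalIntegral.integral_of_le ht.1.le]
    congr 1
    refine (setIntegral_congr_ae measurableSet_Ioc ?_).symm
    exact indicator_deriv_ae_eq (u x) ht.2.le
  have hc : ∀ s ∈ Icc 0 b, Continuous fun x => u x s := fun s hs => by
    have := hcl.comp (Continuous.prodMk_left s)
    simpa only [Function.comp_def, min_eq_left hs.2, max_eq_right hs.1] using this
  have iφ : ∀ s ∈ Icc 0 b, Integrable fun x => φ x * u x s := fun s hs =>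
    i0.mul_bdd (hc s hs).aestronglyMeasurable (Eventually.of_forall fun x => hB x s hs)
  have iφ0 := iφ 0 (left_mem_Icc.2 hb.le)
  rw [← E2, E3, E4, spacePairing, indicator_of_mem ht, ← integral_add]
  · congr 1
    funext x
    rw [hu.apply_zero]
    ring
  · simpa only [hu.apply_zero] using iφ0
  · simpa only [mul_sub] using! (iφ t (Ioo_subset_Icc_self ht)).sub iφ0

end

/-! ### Iteration of the weak equation to the Neumann series. -/

/-- Multiplication by `-p²`, the Fourier symbol of the second derivative. -/
noncomputable def negSqMul (χ : ℝ → ℂ) (p : ℝ) : ℂ := -Complex.I * (p * (-Complex.I * (p * χ p)))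

theorem iterate_negSqMul (χ : ℝ → ℂ) (n : ℕ) (p : ℝ) :
    negSqMul^[n] χ p = ((-(p ^ 2)) ^ n : ℝ) * χ p := by
  induction n with
  | zero => simp
  | succ n ih =>
    rw [Function.iterate_succ_apply', negSqMul, ih, pow_succ]
    push_cast
    linear_combination (-(p : ℂ) ^ 2) ^ n * (p : ℂ) ^ 2 * χ p * Complex.I_sq

theorem BandLimited.neg_I_mul {R A : ℝ} {χ : ℝ → ℂ} (h : BandLimited R A χ) (hR : 0 ≤ R) :
    BandLimited R ((R + 2) * A) fun p => -Complex.I * (p * χ p) := by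
  have := (h.mul_id hR).const_mul (-Complex.I)
  rwa [norm_neg, Complex.norm_I, one_mul] at this

theorem BandLimited.iterate_negSqMul {R A : ℝ} {χ : ℝ → ℂ} (h : BandLimited R A χ) (hR : 0 ≤ R)
    (n : ℕ) : BandLimited R (((R + 2) ^ 2) ^ n * A) (negSqMul^[n] χ) := by
  induction n with
  | zero => simpa using h
  | succ n ih =>
    have := (ih.neg_I_mul hR).neg_I_mul hR
    rw [Function.iterate_succ_apply']
    convert! this using 1
    ring

section

variable {E : Type*} [NormedAddCommGroup E] [NormedSpace ℝ E]

/-- Iteration of a scale of Volterra equations. -/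
theorem iterate_volterra [CompleteSpace E] {α K b : ℝ} (hα : 0 < α) {h : ℝ → ℝ} (hh : PowBound α h)
    {V : ℕ → ℝ → E} {c : ℕ → E} (hV : ∀ n, PowBound 1 (V n))
    (heq : ∀ n, ∀ t ∈ Ioo 0 b, V n t = c n + K • hconv h (V (n + 1)) t) (N : ℕ) {t : ℝ}
    (ht : t ∈ Ioo 0 b) :
    V 0 t = c 0 + ∑ n ∈ Finset.range N, (K ^ (n + 1) * hconv (rlKernel 1) (convPow h n) t) •
      c (n + 1) + K ^ (N + 1) • hconv (convPow h N) (V (N + 1)) t := by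
  induction N with
  | zero => simpa [convPow] using heq 0 t ht
  | succ N ih =>
    have hN := hh.toConvPow hα N
    have hN0 : 0 < α * (N : ℝ) + α := by positivity
    have hV2 := hh.toHconv (hV (N + 2)) hα one_pos
    -- The constant is multiplied by k_1, so that it vanishes for s ≤ 0 and can be convolved.
    have p1 : PowBound 1 fun s => rlKernel 1 s • c (N + 1) := by
      refine ⟨(measurable_rlKernel 1).stronglyMeasurable.smul_const _, fun b =>
        ⟨‖c (N + 1)‖, norm_nonneg _, fun s _ => ?_⟩⟩
      rw [norm_smul, mul_comm, Real.norm_of_nonneg (rlKernel_nonneg one_pos s)]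
    have e : hconv (convPow h N) (V (N + 1)) t =
        hconv (convPow h N) (fun s => rlKernel 1 s • c (N + 1) + K • hconv h (V (N + 2)) s) t := by
      refine integral_congr_ae (Eventually.of_forall fun s => ?_)
      dsimp only
      rcases le_or_gt s 0 with h0 | h0
      · rw [(hV _).eq_zero h0, rlKernel_of_nonpos h0, hV2.eq_zero h0]
        simp
      · rcases lt_or_ge s t with hst | hst
        · rw [heq (N + 1) s ⟨h0, hst.trans ht.2⟩, rlKernel_one h0, one_smul]
        · rw [hN.eq_zero (sub_nonpos.2 hst), zero_smul, zero_smul]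
    have e2 : hconv (convPow h N) (fun s => rlKernel 1 s • c (N + 1)) t =
        hconv (rlKernel 1) (convPow h N) t • c (N + 1) := by
      rw [hconv_comm, hconv, hconv, ← integral_smul_const]
      simp only [smul_smul, smul_eq_mul]
    have e3 : hconv (convPow h N) (hconv h (V (N + 2))) t =
        hconv (convPow h (N + 1)) (V (N + 2)) t := by
      rw [hN.hconv_assoc hN0 hα one_pos hh (hV _),
        show hconv (convPow h N) h = convPow h (N + 1) from funext fun s => hconv_comm _ _ _]
    rw [ih, e, hconv_add_right (hN.integrable p1 hN0 one_pos t)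
      (hN.integrable (hV2.const_smul K) hN0 (by positivity) t), hconv_const_smul_right, e2, e3,
      Finset.sum_range_succ]
    module

/-- `V n` grows only geometrically, while the convolution powers of h are bounded by a geometric
factor times kernels of order α(N + 1), which decay faster than any geometric sequence. -/
theorem tendsto_volterra_remainder {α K Q B t : ℝ} (hα : 0 < α) (hQ : 0 ≤ Q) (hB : 0 ≤ B)
    {h : ℝ → ℝ} (hh : PowBound α h) {V : ℕ → ℝ → E}
    (hV : ∀ n s, ‖V n s‖ ≤ B * Q ^ n * rlKernel 1 s) :
    Tendsto (fun N : ℕ => K ^ (N + 1) • hconv (convPow h N) (V (N + 1)) t) atTop (𝓝 0) := by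
  obtain ⟨C, hC, hCb⟩ := hh.bound (max t 0)
  set q := |K| * C * Q with hq
  have hq0 : 0 ≤ q := by positivity
  set ε := 1 / (2 * (q + 1)) with hε
  have hε0 : 0 < ε := by positivity
  obtain ⟨D, hD, hDb⟩ := exists_rlKernel_le_geometric hα (show 0 < α + 1 by positivity) hε0 t
  have hr : q * ε ≤ 1 / 2 := by
    rw [hε, mul_one_div, div_le_div_iff₀ (by positivity) two_pos]
    linarith
  have hlim : Tendsto (fun N : ℕ => q * B * D * rlKernel (α + 1) t * (1 / 2 : ℝ) ^ N) atTop
      (𝓝 0) := by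
    simpa using (tendsto_pow_atTop_nhds_zero_of_lt_one (by norm_num : (0 : ℝ) ≤ 1 / 2)
      (by norm_num)).const_mul (q * B * D * rlKernel (α + 1) t)
  refine squeeze_zero_norm (fun N => ?_) hlim
  have h1 := norm_hconv_le (show 0 < α * (N : ℝ) + α by positivity) one_pos
    (fun s hs => abs_convPow_le hα (le_max_right t 0) hC hCb N hs)
    (fun s (_ : s ≤ max t 0) => hV (N + 1) s) (by positivity) (by positivity) (le_max_right t 0)
    (le_max_left t 0)
  have h2 := hDb N t le_rfl
  have hk := rlKernel_nonneg (show 0 < α + 1 by positivity) t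
  rw [add_assoc] at h1
  rw [norm_smul, norm_pow, Real.norm_eq_abs]
  calc |K| ^ (N + 1) * ‖hconv (convPow h N) (V (N + 1)) t‖
      ≤ |K| ^ (N + 1) * (C ^ (N + 1) * (B * Q ^ (N + 1)) * (D * ε ^ N * rlKernel (α + 1) t)) := by
        gcongr
        exact h1.trans (by gcongr)
    _ = q * B * D * rlKernel (α + 1) t * (q * ε) ^ N := by
        rw [hq]
        ring
    _ ≤ _ := by gcongr

end

section

variable {ρ ω γ μ K : ℝ} {g : ℝ → ℂ}

theorem abs_symbolTerm_le_of_abs_le {p R : ℝ} (hp : |p| ≤ R) (t : ℝ) (n : ℕ) :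
    |symbolTerm ρ ω γ μ K p t n| ≤ |symbolTerm ρ ω γ μ K R t n| := by
  have : p ^ (2 * n) ≤ R ^ (2 * n) := by
    rw [pow_mul, pow_mul, ← sq_abs p]
    gcongr
  have h0 : 0 ≤ p ^ (2 * n) := by
    rw [pow_mul]
    positivity
  simp only [symbolTerm, abs_mul, abs_of_nonneg h0, abs_of_nonneg (h0.trans this)]
  gcongr

/-- On the support of χ the terms are dominated by those at p = R, whose series converges
absolutely; the bounded support is what allows termwise integration. -/
theorem hasSum_integral_symbolTerm (hρ : 0 < ρ) (hμ : 0 < μ) (hg : Integrable g) {R A : ℝ}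
    {χ : ℝ → ℂ} (hχ : BandLimited R A χ) (hR : 0 ≤ R) {t : ℝ} (ht : 0 < t) :
    HasSum (fun n => ∫ p, fourierHat g p * (χ p * (symbolTerm ρ ω γ μ K p t n : ℝ)))
      (∫ p, fourierHat g p * (χ p * (relaxation ρ ω γ μ K p t : ℝ))) := by
  have hχi := hχ.integrable hR
  have hs := (hasSum_symbolTerm ω γ hρ hμ K R ht).summable.abs
  refine hasSum_integral_of_dominated_convergence
    (fun n p => (∫ x, ‖g x‖) * ‖χ p‖ * |symbolTerm ρ ω γ μ K R t n|) (fun n => ?_) (fun n => ?_)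
    ?_ ?_ ?_
  · have : Continuous fun p => symbolTerm ρ ω γ μ K p t n := by
      unfold symbolTerm
      fun_prop
    exact ((continuous_fourierHat hg).mul (hχ.contDiff.continuous.mul
      (Complex.continuous_ofReal.comp this))).aestronglyMeasurable
  · refine Eventually.of_forall fun p => ?_
    rw [norm_mul, norm_mul, Complex.norm_real, Real.norm_eq_abs, ← mul_assoc]
    rcases lt_or_ge R |p| with hp | hp
    · rw [hχ.eq_zero p hp]
      simp
    · exact mul_le_mul (mul_le_mul_of_nonneg_right (norm_fourierHat_le g p) (norm_nonneg _))
        (abs_symbolTerm_le_of_abs_le hp t n) (abs_nonneg _)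
        (mul_nonneg ((norm_nonneg _).trans (norm_fourierHat_le g p)) (norm_nonneg _))
  · exact Eventually.of_forall fun p => hs.mul_left _
  · simp_rw [tsum_mul_left]
    exact (hχi.norm.const_mul _).mul_const _
  · refine Eventually.of_forall fun p => ?_
    have h := (hasSum_symbolTerm ω γ hρ hμ K p ht).summable.hasSum
    exact ((Complex.hasSum_ofReal.2 h).mul_left _).mul_left _

/-- The weak form of û = ĝ w. Differentiating χ̂ twice multiplies χ by -p², so the weak equations
for χ, -p² χ, p⁴ χ, … form a chain that can be iterated. The partial sums are integrals of ĝ χ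
against the partial sums of the series. -/
theorem IsDiffusionSolution.integral_fourierHat_mul (hρ : 0 < ρ) (hμ : 0 < μ) (hμ1 : μ < 1)
    (hK : 0 < K) (hg : Integrable g) {u : ℝ → ℝ → ℂ} (hu : IsDiffusionSolution ρ ω γ μ K g u)
    (hd : HasDominatedTimeDeriv u) {R A : ℝ} {χ : ℝ → ℂ} (hχ : BandLimited R A χ) (hR : 0 ≤ R)
    {t : ℝ} (ht : 0 < t) : ∫ x, fourierHat χ x * u x t =
      ∫ p, fourierHat g p * (χ p * (relaxation ρ ω γ μ K p t : ℝ)) := by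
  obtain ⟨hcl, B, hB0, hB, hweak⟩ := hu.exists_weak_equation hρ hμ hμ1 hK hd
    (show 0 < t + 1 by linarith)
  have htb : t ∈ Ioo 0 (t + 1) := ⟨ht, lt_add_one t⟩
  have hA : 0 ≤ A := (norm_nonneg _).trans (hχ.bound 0)
  have hχn := hχ.iterate_negSqMul hR
  have hφi := fun n => ((hχn n).integrable_fourierHat hR).1
  have hφc := fun n => continuous_fourierHat ((hχn n).integrable hR)
  set V : ℕ → ℝ → ℂ := fun n => spacePairing (t + 1) u (fourierHat (negSqMul^[n] χ)) with hV
  set c : ℕ → ℂ := fun n => ∫ x, fourierHat (negSqMul^[n] χ) x * g x with hc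
  have ph := powBound_prabhakarSeries (ω := ω) γ hρ hμ
  have hVp : ∀ n, PowBound 1 (V n) := fun n =>
    powBound_spacePairing hcl hB hB0 (hφc n) (hφi n)
  have heq : ∀ n, ∀ s ∈ Ioo 0 (t + 1),
      V n s = c n + K • hconv (prabhakarSeries ρ ω μ γ) (V (n + 1)) s := by
    intro n
    have b1 := (hχn n).neg_I_mul hR
    have d2 := b1.hasDerivAt_fourierHat hR
    have i2 := ((b1.neg_I_mul hR).integrable_fourierHat hR).1
    simp only [hV, hc, Function.iterate_succ_apply']
    exact hweak _ _ _ ((hχn n).hasDerivAt_fourierHat hR) d2 (hφi n)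
      (b1.integrable_fourierHat hR).1 i2
  have hrem := tendsto_volterra_remainder (K := K) (t := t) hμ (sq_nonneg (R + 2))
    (show 0 ≤ B * (4 * R * A * Real.pi) by positivity) ph (V := V) fun n s => by
      refine (norm_spacePairing_le hB hB0 (hφi n) s).trans ?_
      have := ((hχn n).integrable_fourierHat hR).2
      have h1 := rlKernel_nonneg one_pos s
      calc _ ≤ B * (4 * R * (((R + 2) ^ 2) ^ n * A) * Real.pi) * rlKernel 1 s := by gcongr
        _ = _ := by ring
  have hcn : ∀ n, c n = ∫ p, fourierHat g p * (((-(p ^ 2)) ^ n : ℝ) * χ p) := by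
    intro n
    simp only [hc]
    rw [← _root_.integral_fourierHat_mul hg ((hχn n).integrable hR)]
    simp only [_root_.iterate_negSqMul]
  have hterm : ∀ n, (K ^ (n + 1) *
      hconv (rlKernel 1) (convPow (prabhakarSeries ρ ω μ γ) n) t) • c (n + 1) =
      ∫ p, fourierHat g p * (χ p * (symbolTerm ρ ω γ μ K p t (n + 1) : ℝ)) := by
    intro n
    rw [hcn, ← integral_smul]
    congr 1
    funext p
    rw [symbolTerm_succ hρ hμ K p n ht, Complex.real_smul, neg_pow, mul_pow, ← pow_mul]
    push_cast
    ring
  have hpart : ∀ N, c 0 + ∑ n ∈ Finset.range N, (K ^ (n + 1) *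
      hconv (rlKernel 1) (convPow (prabhakarSeries ρ ω μ γ) n) t) • c (n + 1) =
      ∑ n ∈ Finset.range (N + 1),
        ∫ p, fourierHat g p * (χ p * (symbolTerm ρ ω γ μ K p t n : ℝ)) := by
    intro N
    rw [Finset.sum_range_succ', add_comm, hcn]
    simp only [hterm, symbolTerm_zero, pow_zero, Complex.ofReal_one, one_mul, mul_one]
  have hlim := ((hasSum_integral_symbolTerm (ω := ω) (γ := γ) (K := K) hρ hμ hg hχ hR
    ht).tendsto_sum_nat.comp (tendsto_add_atTop_nat 1)).add hrem
  rw [add_zero] at hlim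
  have h0 : ∀ N, V 0 t = _ := fun N => iterate_volterra hμ ph hVp heq N htb
  have hV0 : V 0 t = ∫ x, fourierHat χ x * u x t := indicator_of_mem htb _
  rw [← hV0]
  refine tendsto_nhds_unique (tendsto_const_nhds.congr fun N => ?_) hlim
  rw [h0 N, hpart]
  rfl

end

/-! ### Recovering pointwise values, and the theorem. -/

/-- The amplitude `e^{ipa} χ(εp)`, whose Fourier transform concentrates at `a` as `ε → 0`. -/
noncomputable def localizer (χ : ℝ → ℂ) (a ε p : ℝ) : ℂ :=
  Complex.exp (Complex.I * p * a) * χ (ε * p)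

theorem exists_bandLimited_localizer {χ : ℝ → ℂ} (hχ : ContDiff ℝ 2 χ) (hs : HasCompactSupport χ)
    (a : ℝ) {ε : ℝ} (hε : 0 < ε) : ∃ R A, 0 ≤ R ∧ BandLimited R A (localizer χ a ε) := by
  refine BandLimited.exists_of_hasCompactSupport ?_ ?_
  · have h1 : ContDiff ℝ 2 fun p : ℝ => Complex.exp (Complex.I * p * a) :=
      ((contDiff_const.mul Complex.ofRealCLM.contDiff).mul contDiff_const).cexp
    exact h1.mul (hχ.comp (contDiff_const.mul contDiff_id))
  · exact (hs.comp_smul hε.ne').mul_left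

theorem integral_fourierHat_localizer_mul (χ : ℝ → ℂ) (a : ℝ) {ε : ℝ} (hε : 0 < ε) (w : ℝ → ℂ) :
    ∫ x, fourierHat (localizer χ a ε) x * w x = ∫ y, fourierHat χ y * w (a + ε * y) := by
  have h1 := Measure.integral_comp_mul_left
    (fun z => fourierHat (localizer χ a ε) (a + z) * w (a + z)) ε
  rw [integral_add_left_eq_self (fun x => fourierHat (localizer χ a ε) x * w x) a] at h1
  have h2 : ∀ y, fourierHat (localizer χ a ε) (a + ε * y) = |ε⁻¹| • fourierHat χ y := by
    intro y
    rw [fourierHat, fourierHat, ← Measure.integral_comp_mul_left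
      (fun p : ℝ => Complex.exp (-(Complex.I * y * p)) * χ p) ε]
    congr 1
    funext p
    rw [localizer, ← mul_assoc, ← Complex.exp_add]
    congr 2
    push_cast
    ring
  have h3 : |ε⁻¹| ≠ 0 := abs_ne_zero.2 (inv_ne_zero hε.ne')
  simp only [h2, smul_mul_assoc, integral_smul] at h1
  exact (smul_right_injective ℂ h3 h1).symm

/-- After the substitution x = a + εy this is an approximate identity at a; its mass ∫ χ̂ = 2π χ(0)
is the inversion formula at 0. -/
theorem tendsto_integral_fourierHat_localizer {χ : ℝ → ℂ} (hχ : Continuous χ) (hχi : Integrable χ)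
    (hφ : Integrable (fourierHat χ)) {w : ℝ → ℂ} (hw : Continuous w) {B : ℝ}
    (hB : ∀ x, ‖w x‖ ≤ B) (a : ℝ) {ε : ℕ → ℝ} (hε : Tendsto ε atTop (𝓝 0)) (hε0 : ∀ n, 0 < ε n) :
    Tendsto (fun n => ∫ x, fourierHat (localizer χ a (ε n)) x * w x) atTop
      (𝓝 (2 * Real.pi * χ 0 * w a)) := by
  have hint : 2 * Real.pi * χ 0 = ∫ y, fourierHat χ y := by
    have h := fourierInvHat_fourierHat hχ hχi hφ 0
    have hpi : (Real.pi : ℂ) ≠ 0 := by exact_mod_cast Real.pi_ne_zero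
    rw [← h, fourierInvHat, ← mul_assoc, mul_one_div, div_self (by simp), one_mul]
    simp
  rw [hint, ← integral_mul_const]
  simp_rw [integral_fourierHat_localizer_mul χ a (hε0 _)]
  refine tendsto_integral_of_dominated_convergence (fun y => ‖fourierHat χ y‖ * B) (fun n => ?_)
    (hφ.norm.mul_const B) (fun n => Eventually.of_forall fun y => ?_)
    (Eventually.of_forall fun y => ?_)
  · have : Continuous fun y => w (a + ε n * y) := by fun_prop
    exact hφ.aestronglyMeasurable.mul this.aestronglyMeasurable
  · rw [norm_mul]
    exact mul_le_mul_of_nonneg_left (hB _) (norm_nonneg _)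
  · refine Tendsto.const_mul _ ?_
    have h1 : Tendsto (fun n => a + ε n * y) atTop (𝓝 a) := by
      simpa using (hε.mul_const y).const_add a
    exact (hw.tendsto a).comp h1

theorem tendsto_integral_mul_localizer {χ : ℝ → ℂ} (hχ : Continuous χ) (hb : ∀ p, ‖χ p‖ ≤ 1)
    {G : ℝ → ℂ} (hG : Integrable G) (a : ℝ) {ε : ℕ → ℝ} (hε : Tendsto ε atTop (𝓝 0)) :
    Tendsto (fun n => ∫ p, localizer χ a (ε n) p * G p) atTop
      (𝓝 (χ 0 * ∫ p : ℝ, Complex.exp (Complex.I * p * a) * G p)) := by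
  rw [← integral_const_mul]
  refine tendsto_integral_of_dominated_convergence (fun p => ‖G p‖) (fun n => ?_) hG.norm
    (fun n => Eventually.of_forall fun p => ?_) (Eventually.of_forall fun p => ?_)
  · have : Continuous (localizer χ a (ε n)) := by
      unfold localizer
      fun_prop
    exact this.aestronglyMeasurable.mul hG.aestronglyMeasurable
  · rw [localizer, norm_mul, norm_mul, norm_exp_I_mul, one_mul]
    exact mul_le_of_le_one_left (norm_nonneg _) (hb _)
  · rw [← mul_assoc, mul_comm (χ 0)]
    refine Tendsto.mul_const _ (Tendsto.const_mul _ ?_)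
    have h1 : Tendsto (fun n => ε n * p) atTop (𝓝 0) := by simpa using hε.mul_const p
    exact (hχ.tendsto 0).comp h1

theorem IsDiffusionSolution.eq_diffusionFormula {ρ ω γ μ K : ℝ} {g : ℝ → ℂ} (hρ : 0 < ρ)
    (hμ : 0 < μ) (hμ1 : μ < 1) (hK : 0 < K) (hg : Integrable g) {u : ℝ → ℝ → ℂ}
    (hu : IsDiffusionSolution ρ ω γ μ K g u) (hd : HasDominatedTimeDeriv u) (a : ℝ) {t : ℝ}
    (ht : 0 < t) : u a t = diffusionFormula ρ ω γ μ K g a t := by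
  -- All that matters is that χ is C² with compact support, |χ| ≤ 1 and χ(0) = 1.
  let f : ContDiffBump (0 : ℝ) := ⟨1, 2, one_pos, one_lt_two⟩
  set χ : ℝ → ℂ := fun p => (f p : ℂ) with hχ
  have χd : ContDiff ℝ 2 χ := Complex.ofRealCLM.contDiff.comp f.contDiff
  have χs : HasCompactSupport χ := f.hasCompactSupport.comp_left Complex.ofReal_zero
  have χb : ∀ p, ‖χ p‖ ≤ 1 := fun p => by
    rw [hχ, Complex.norm_real, Real.norm_of_nonneg f.nonneg]
    exact f.le_one
  have χ0 : χ 0 = 1 := by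
    have : f 0 = 1 := f.one_of_mem_closedBall (Metric.mem_closedBall_self zero_le_one)
    simp [hχ, this]
  obtain ⟨R, A, hR, hRA⟩ := BandLimited.exists_of_hasCompactSupport χd χs
  obtain ⟨B, -, hB⟩ := exists_norm_le_of_tendsto_zero (hu.diff t ht).continuous
    (hu.decay_top t ht) (hu.decay_bot t ht)
  have hε : Tendsto (fun n : ℕ => 1 / ((n : ℝ) + 1)) atTop (𝓝 0) :=
    tendsto_one_div_add_atTop_nhds_zero_nat
  have hε0 : ∀ n : ℕ, 0 < 1 / ((n : ℝ) + 1) := fun n => by positivity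
  have h1 := tendsto_integral_fourierHat_localizer χd.continuous (hRA.integrable hR)
    (hRA.integrable_fourierHat hR).1 (hu.diff t ht).continuous hB a hε hε0
  have h2 := tendsto_integral_mul_localizer χd.continuous χb
    (integrable_fourierHat_mul_relaxation (ω := ω) (γ := γ) hρ hμ hμ1 hK hg ht) a hε
  have e : ∀ n : ℕ, ∫ x, fourierHat (localizer χ a (1 / ((n : ℝ) + 1))) x * u x t =
      ∫ p, localizer χ a (1 / ((n : ℝ) + 1)) p *
        (fourierHat g p * (relaxation ρ ω γ μ K p t : ℂ)) := by
    intro n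
    obtain ⟨R', A', hR', h'⟩ := exists_bandLimited_localizer χd χs a (hε0 n)
    rw [hu.integral_fourierHat_mul hρ hμ hμ1 hK hg hd h' hR' ht]
    congr 1
    funext p
    ring
  simp only [e] at h1
  have h3 := tendsto_nhds_unique h1 h2
  rw [χ0, mul_one, one_mul] at h3
  have hpi : (2 * Real.pi : ℂ) ≠ 0 := by
    simp
  rw [diffusionFormula_eq, fourierInvHat, ← h3, ← mul_assoc, one_div, inv_mul_cancel₀ hpi, one_mul]

theorem theorem4p4 (ρ ω γ μ K : ℝ) (hρ : 0 < ρ) (hγ : 0 ≤ γ) (hμ0 : 0 < μ) (hμ1 : μ < 1)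
    (hK : 0 < K) (g : ℝ → ℂ) (hg : Integrable g) :
    -- the series and, for `t > 0`, the inverse Fourier integral converge absolutely
    (∀ p t : ℝ, 0 ≤ t → Summable (symbolTerm ρ ω γ μ K p t)) ∧
    (∀ t : ℝ, 0 < t → Integrable (fun p : ℝ =>
      fourierHat g p * ((∑' n : ℕ, symbolTerm ρ ω γ μ K p t n : ℝ) : ℂ))) ∧
    -- existence: if the inversion formula applies to `g`, then the formula is a solution,
    -- with time derivative dominated uniformly in `x`
    (Continuous g → Integrable (fourierHat g) →
      IsDiffusionSolution ρ ω γ μ K g (diffusionFormula ρ ω γ μ K g) ∧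
      HasDominatedTimeDeriv (diffusionFormula ρ ω γ μ K g)) ∧
    -- uniqueness: every such solution is given by the formula
    (∀ u : ℝ → ℝ → ℂ, IsDiffusionSolution ρ ω γ μ K g u → HasDominatedTimeDeriv u →
      ∀ x t : ℝ, 0 < t → u x t = diffusionFormula ρ ω γ μ K g x t) := by
  refine ⟨fun p t ht => ?_, fun t ht => ?_, fun hc hg' => ⟨?_, ?_⟩, fun u hu hd x t ht => ?_⟩
  · rcases ht.eq_or_lt with rfl | ht
    · exact (hasSum_symbolTerm_at_zero ω γ K p hμ0).summable
    · exact (hasSum_symbolTerm ω γ hρ hμ0 K p ht).summable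
  · exact integrable_fourierHat_mul_relaxation hρ hμ0 hμ1 hK hg ht
  · exact isDiffusionSolution_diffusionFormula hρ hμ0 hμ1 hK hc hg hg'
  · exact hasDominatedTimeDeriv_diffusionFormula hρ hμ0 hμ1 hK hc hg hg'
  · exact hu.eq_diffusionFormula hρ hμ0 hμ1 hK hg hd x ht
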